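/- An instance $\mathcal I=(X,D,dom,N)$ of the AtMost-NValue constraint consists of a finite set $X$ of $n$ variables, a finite non-empty totally ordered set $D$ of values, a non-empty domain $dom(x)\subseteq D$ for each $x\in X$, and an integer $N$. An instantiation $\alpha$ with $\alpha(x)\in dom(x)$ for all $x\in X$ is legal if $|\{\alpha(x): x\in X\}|\le N$; the constraint supports $v$ for $x$ if some legal instantiation $\alpha$ has $\alpha(x)=v$. To enforce hyper-arc consistency (HAC) is to remove from each domain $dom(x)$ all values that are not supported for $x$ (removed values are also removed from $D$). A hole of $D'\subseteq D$ is a pair $(u,w)\in D'\times D'$ such that some $v\in D\setminus D'$ satisfies $u<v<w$ and no $v'\in D'$ satisfies $u<v'<w$; $k$ is the total number of holes in the domains $dom(x)$, $x\in X$. Instances are given by the succinct description: $n$, $|D|$, $N$, the values of $D$ in increasing order, and for each domain the number of its intervals (maximal hole-free subsets) and their left and right endpoints; $|\mathcal I|=O(n+|D|+k)$ is its length. Corollary 2. If a value is not supported for one of the variables that have it in their domain, then it is not supported for any of them. HAC for an AtMost-NValue constraint can be enforced in time $O(\phi^k\cdot k^2\cdot|D|+|\mathcal I|\cdot|D|)$,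 where $\phi=\frac{1+\sqrt5}{2}<1.6181$: on a unit-cost word RAM with words of $O(\log(|\mathcal I|+\max D+|N|))$ bits (values being natural numbers), a single program computes, from the succinct description of any instance, the succinct description of the instance obtained by enforcing HAC within this number of steps, with an absolute constant. -/

import Mathlib

/-! ## The constraint -/

namespace AtMostNValue

/-- The data `(X, D, dom, N)` of an AtMost-NValue constraint: variables `X = {0, …, n - 1}`, a finite
totally ordered set `D` of values, a domain of values for every variable, and an integer `N`. -/
structure Instance where
  n : ℕ
  D : Finset ℕ
  dom : Fin n → Finset ℕ
  N : ℤ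

/-- Admissible inputs: all domains are non-empty subsets of `D`, and `D` is non-empty (which can
fail only if there are no variables and no values at all). -/
def Instance.IsInput (I : Instance) : Prop :=
  I.D.Nonempty ∧ ∀ x, (I.dom x).Nonempty ∧ I.dom x ⊆ I.D

/-- Legal instantiations: every variable takes a value of its domain, and at most `N` distinct
values are used. -/
def Instance.Legal (I : Instance) (α : Fin I.n → ℕ) : Prop :=
  (∀ x, α x ∈ I.dom x) ∧ ((Finset.univ.image α).card : ℤ) ≤ I.N

/-- The constraint supports the value `v` for the variable `x`. -/
def Instance.Supports (I : Instance) (x : Fin I.n) (v : ℕ) : Prop :=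
  ∃ α, I.Legal α ∧ α x = v

open Classical in
/-- The result of enforcing hyper arc consistency: from each domain, all values that are not
supported for its variable are removed, and every removed value is also removed from the set of
values. -/
noncomputable def Instance.enforceHAC (I : Instance) : Instance where
  n := I.n
  D := I.D.filter fun v => ¬ ∃ x, v ∈ I.dom x ∧ ¬ I.Supports x v
  dom := fun x => (I.dom x).filter fun v => I.Supports x v
  N := I.N

/-- `(u, w)` is a hole of `S` in `D`. -/
def IsHole (D S : Finset ℕ) (u w : ℕ) : Prop :=
  u ∈ S ∧ w ∈ S ∧ (∃ v ∈ D \ S, u < v ∧ v < w) ∧ ¬ ∃ v ∈ S, u < v ∧ v < w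

instance (D S : Finset ℕ) (u w : ℕ) : Decidable (IsHole D S u w) := by
  unfold IsHole; infer_instance

/-- The number of holes of `S` in `D`. -/
def numHoles (D S : Finset ℕ) : ℕ :=
  ((S ×ˢ S).filter fun p => IsHole D S p.1 p.2).card

/-- The total number of holes in the domains of the variables. -/
def Instance.holes (I : Instance) : ℕ :=
  ∑ x, numHoles I.D (I.dom x)

/-! ### The succinct description of an instance -/

/-- Left endpoints of the intervals (the maximal hole-free subsets) of `S` in `D`. -/
def leftEnds (D S : Finset ℕ) : Finset ℕ :=
  S.filter fun v => (∀ u ∈ S, v ≤ u) ∨ ∃ u ∈ S, IsHole D S u v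

/-- Right endpoints of the intervals (the maximal hole-free subsets) of `S` in `D`. -/
def rightEnds (D S : Finset ℕ) : Finset ℕ :=
  S.filter fun v => (∀ w ∈ S, w ≤ v) ∨ ∃ w ∈ S, IsHole D S v w

/-- The intervals of `S` in `D`, from left to right, as pairs of endpoints. -/
def intervals (D S : Finset ℕ) : List (ℕ × ℕ) :=
  ((leftEnds D S).sort (· ≤ ·)).zip ((rightEnds D S).sort (· ≤ ·))

/-- A domain is described by the number of its intervals, followed by the left and the right
endpoint of each of them. -/
def encodeDom (D S : Finset ℕ) : List ℕ :=
  (intervals D S).length :: (intervals D S).flatMap fun p => [p.1, p.2]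

/-- The succinct description: the number of variables, the number of values, the integer `N` (as
its positive and its negative part), the values in increasing order, and the domains. -/
def Instance.encode (I : Instance) : List ℕ :=
  [I.n, I.D.card, I.N.toNat, (-I.N).toNat] ++ I.D.sort (· ≤ ·) ++
    (List.finRange I.n).flatMap fun x => encodeDom I.D (I.dom x)

/-- The size `|I|`: the length of the succinct description. -/
def Instance.size (I : Instance) : ℕ :=
  I.encode.length

/-- A quantity polynomial in which bounds the numbers in a machine word:
words have `O(log (|I| + max D + |N|))` bits. -/
def Instance.wordBase (I : Instance) : ℕ :=
  I.size + I.D.sup id + I.N.natAbs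

end AtMostNValue

/-! ## The machine model

A unit-cost word RAM, programmed in a structured language. A program uses finitely many registers
and finitely many arrays of words; an array cell is accessed at a computed index in one step. Each
literal, register access, array access, arithmetic operation, comparison, assignment and test costs
one step. All numbers computed, addresses included, have to stay below a bound `B`; a run in which
this fails does not count as a run. -/

namespace WordRAM

/-- Operations: natural-number arithmetic (subtraction is truncated, division is rounded down),
and comparisons with the result `1` (true) or `0` (false). -/
inductive Op
  | add | sub | mul | div | lt | eq

def Op.eval : Op → ℕ → ℕ → ℕ
  | .add, a, b => a + b
  | .sub, a, b => a - b
  | .mul, a, b => a * b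
  | .div, a, b => a / b
  | .lt, a, b => if a < b then 1 else 0
  | .eq, a, b => if a = b then 1 else 0

/-- Expressions: literals, registers, array cells, and operations. -/
inductive Exp
  | lit (c : ℕ)
  | reg (r : ℕ)
  | get (a : ℕ) (i : Exp)
  | op (o : Op) (e f : Exp)

/-- Programs. The tests of `ite` and `loop` succeed on non-zero numbers. -/
inductive Prog
  | skip
  | assign (r : ℕ) (e : Exp)
  | store (a : ℕ) (i e : Exp)
  | seq (p q : Prog)
  | ite (e : Exp) (p q : Prog)
  | loop (e : Exp) (p : Prog)

/-- The contents of the registers and of the arrays. -/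
structure State where
  reg : ℕ → ℕ
  arr : ℕ → ℕ → ℕ

def State.setReg (s : State) (r v : ℕ) : State :=
  { s with reg := Function.update s.reg r v }

def State.setArr (s : State) (a i v : ℕ) : State :=
  { s with arr := Function.update s.arr a (Function.update (s.arr a) i v) }

/-- The input is written into array `0`; everything else is `0`. -/
def State.init (L : List ℕ) : State where
  reg := fun _ => 0
  arr := fun a i => if a = 0 then L.getD i 0 else 0

/-- The output is `L`: it is read off from array `1` (the list has to announce its length itself). -/
def State.HasOutput (s : State) (L : List ℕ) : Prop :=
  ∀ (i : ℕ) (h : i < L.length), s.arr 1 i = L[i]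

namespace Exp

/-- The value of an expression. -/
def eval (s : State) : Exp → ℕ
  | lit c => c
  | reg r => s.reg r
  | get a i => s.arr a (i.eval s)
  | op o e f => o.eval (e.eval s) (f.eval s)

/-- The number of steps that the evaluation of an expression takes. -/
def cost : Exp → ℕ
  | lit _ => 1
  | reg _ => 1
  | get _ i => i.cost + 1
  | op _ e f => e.cost + f.cost + 1

/-- All numbers that occur in the evaluation of an expression are smaller than `B`. -/
def Fits (B : ℕ) (s : State) : Exp → Prop
  | lit c => c < B
  | reg r => s.reg r < B
  | get a i => i.Fits B s ∧ s.arr a (i.eval s) < B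
  | op o e f => e.Fits B s ∧ f.Fits B s ∧ o.eval (e.eval s) (f.eval s) < B

end Exp

/-- `Exec B p s t s'`: started in the state `s`, the program `p` halts after exactly `t` steps in
the state `s'`, and all numbers in the run are smaller than `B`. -/
inductive Exec (B : ℕ) : Prog → State → ℕ → State → Prop
  | skip (s : State) : Exec B .skip s 1 s
  | assign (s : State) (r : ℕ) (e : Exp) (he : e.Fits B s) :
      Exec B (.assign r e) s (e.cost + 1) (s.setReg r (e.eval s))
  | store (s : State) (a : ℕ) (i e : Exp) (hi : i.Fits B s) (he : e.Fits B s) :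
      Exec B (.store a i e) s (i.cost + e.cost + 1) (s.setArr a (i.eval s) (e.eval s))
  | seq {p q : Prog} {s₀ s₁ s₂ : State} {t₁ t₂ : ℕ} (hp : Exec B p s₀ t₁ s₁)
      (hq : Exec B q s₁ t₂ s₂) : Exec B (.seq p q) s₀ (t₁ + t₂) s₂
  | ite_true {e : Exp} {p q : Prog} {s₀ s₁ : State} {t : ℕ} (he : e.Fits B s₀)
      (h : e.eval s₀ ≠ 0) (hp : Exec B p s₀ t s₁) : Exec B (.ite e p q) s₀ (e.cost + 1 + t) s₁
  | ite_false {e : Exp} {p q : Prog} {s₀ s₁ : State} {t : ℕ} (he : e.Fits B s₀)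
      (h : e.eval s₀ = 0) (hq : Exec B q s₀ t s₁) : Exec B (.ite e p q) s₀ (e.cost + 1 + t) s₁
  | loop_true {e : Exp} {p : Prog} {s₀ s₁ s₂ : State} {t₁ t₂ : ℕ} (he : e.Fits B s₀)
      (h : e.eval s₀ ≠ 0) (hp : Exec B p s₀ t₁ s₁) (hl : Exec B (.loop e p) s₁ t₂ s₂) :
      Exec B (.loop e p) s₀ (e.cost + 1 + t₁ + t₂) s₂
  | loop_false {e : Exp} {p : Prog} {s : State} (he : e.Fits B s) (h : e.eval s = 0) :
      Exec B (.loop e p) s (e.cost + 1) s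

end WordRAM

/-! ## A program logic for the word RAM -/

namespace WordRAM

-- If `v` lies in `dom x`, then it is supported for `x` exactly when fewer than `N` values hit all
-- domains that avoid `v`, since the variables whose domain contains `v` can all take it. This
-- criterion no longer mentions `x` (`Instance.supports_iff`). That gives the claim about shared
-- support, and it leaves one hitting set question per value.
--
-- Each question is answered by a sweep over the ranks of the values. Look at the sets that begin
-- after the current point, and let `g` be the first right end of a leading interval among them. If
-- `g` ends a set without holes, some point up to `g` is forced, and `g` itself is the best choice
-- (`Sys.WF.tot_pick`). If `g` ends the first interval of a set with holes, either `g` is picked or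
-- that interval is forgotten (`Sys.WF.tot_branch`).
--
-- Both alternatives destroy at least one hole. Suppose that each destroys exactly one and holes are
-- left. Then both branches reach their next decision at the same point `r` (`Sys.WF.stop_eq`), and
-- their costs can be compared there. If the picking branch is not more expensive, it dominates the
-- other branch with `r` picked (`Sys.tot_prune_drop`). If it is more expensive, the forgetting
-- branch can afford one extra point for the set it still owes, and it dominates the picking branch
-- with `r` picked (`Sys.WF.tot_prune_pick`). So one of the two branches may forget a further
-- interval without branching. The size of the search tree therefore obeys the Fibonacci recurrence
-- (`Sys.WF.branch_step`, `pot_branch`), and it is `O(φ ^ k)` (`pot_le`).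
--
-- A node of the tree has to cost `O(k ^ 2)`, independently of the number of domains without holes.
-- The endpoints of the intervals of domains with holes cut the ranks into `O(k)` segments. Inside a
-- segment the greedy choices depend only on the domains without holes, so a whole run of choices is
-- replaced by one lookup in a precomputed table (`Sys.WF.tot_jump`). Every round of the greedy
-- algorithm then enters a later segment (`Sys.WF.sub_pick`) and scans at most `k` sets with holes.
-- For each value the tables are rebuilt in time `O(n + |D|)`.
--
-- The algorithm is written as one program and verified with a small Hoare logic: loop-free code is
-- evaluated symbolically (`Runs.straight`), and loops are paid for by a potential or a known number
-- of iterations (`Runs.loop`, `Runs.for`). All stored numbers stay below a fixed power of the word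
-- base, and intermediate results are at most an eighth power of that.

infixl:65 " ∔ " => Exp.op Op.add
infixl:65 " ⊖ " => Exp.op Op.sub
infixl:70 " ⊠ " => Exp.op Op.mul
infix:50 " ≺ " => Exp.op Op.lt
infix:50 " ≐ " => Exp.op Op.eq
infixr:30 " ;; " => Prog.seq

/-- All registers and array cells hold numbers at most `M`. -/
def Bdd (M : ℕ) (s : State) : Prop := (∀ r, s.reg r ≤ M) ∧ ∀ a i, s.arr a i ≤ M

/-- If the state is bounded by `M`, then `(M + 10) ^ e.deg` bounds the value of `e`. -/
def Exp.deg : Exp → ℕ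
  | .lit c => if c ≤ 10 then 1 else 100
  | .reg _ => 1
  | .get _ _ => 1
  | .op .add e f => max e.deg f.deg + 1
  | .op .sub e _ => e.deg
  | .op .mul e f => e.deg + f.deg
  | .op .div e _ => e.deg
  | .op .lt _ _ => 1
  | .op .eq _ _ => 1

/-- All subexpressions have degree at most `8`. -/
def Exp.low : Exp → Bool
  | .lit c => c ≤ 10
  | .reg _ => true
  | .get _ i => i.low
  | .op o e f => e.low && f.low && ((Exp.op o e f).deg ≤ 8)

/-- An addition raises the degree by one because twice a power of `M + 10` is at most the next
power. Products add degrees. Truncated subtraction and division never increase their first argument.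
-/
theorem Exp.eval_le {M : ℕ} {s : State} (hs : Bdd M s) :
    ∀ e : Exp, e.low = true → e.eval s ≤ (M + 10) ^ e.deg ∧ 1 ≤ e.deg := by
  intro e
  induction e with
  | lit c =>
    intro h
    simp only [Exp.low, decide_eq_true_eq] at h
    simp only [Exp.eval, Exp.deg, h, if_true, pow_one]
    omega
  | reg r => intro _; have := hs.1 r; simp only [Exp.eval, Exp.deg, pow_one]; omega
  | get a i => intro _; have := hs.2 a (i.eval s); simp only [Exp.eval, Exp.deg, pow_one]; omega
  | op o e f ihe ihf =>
    intro h
    simp only [Exp.low, Bool.and_eq_true] at h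
    obtain ⟨he, he1⟩ := ihe h.1.1
    obtain ⟨hf, hf1⟩ := ihf h.1.2
    have h1 : 1 ≤ M + 10 := by omega
    cases o with
    | add =>
      refine ⟨?_, by simp [Exp.deg]⟩
      simp only [Exp.eval, Op.eval, Exp.deg]
      have a1 := Nat.pow_le_pow_right h1 (le_max_left e.deg f.deg)
      have a2 := Nat.pow_le_pow_right h1 (le_max_right e.deg f.deg)
      rw [pow_succ]
      nlinarith
    | sub =>
      refine ⟨?_, by simpa [Exp.deg] using he1⟩
      simp only [Exp.eval, Op.eval, Exp.deg]
      omega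
    | mul =>
      refine ⟨?_, by simp only [Exp.deg]; omega⟩
      simp only [Exp.eval, Op.eval, Exp.deg]
      rw [pow_add]
      exact Nat.mul_le_mul he hf
    | div =>
      refine ⟨?_, by simpa [Exp.deg] using he1⟩
      simp only [Exp.eval, Op.eval, Exp.deg]
      exact (Nat.div_le_self _ _).trans he
    | lt =>
      refine ⟨?_, by simp [Exp.deg]⟩
      simp only [Exp.eval, Op.eval, Exp.deg, pow_one]
      split_ifs <;> omega
    | eq =>
      refine ⟨?_, by simp [Exp.deg]⟩
      simp only [Exp.eval, Op.eval, Exp.deg, pow_one]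
      split_ifs <;> omega

/-- Degree at most `8` in every subexpression turns the word size condition into a syntactic check.
Afterwards only the stored numbers have to be controlled. -/
theorem Exp.fits_of_low {M B : ℕ} (hB : (M + 10) ^ 8 < B) {s : State} (hs : Bdd M s) :
    ∀ e : Exp, e.low = true → e.Fits B s := by
  have hM : M + 10 ≤ (M + 10) ^ 8 := Nat.le_self_pow (by norm_num) _
  intro e
  induction e with
  | lit c => intro h; simp only [Exp.low, decide_eq_true_eq] at h; simp only [Exp.Fits]; omega
  | reg r => intro _; have := hs.1 r; simp only [Exp.Fits]; omega
  | get a i ih =>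
    intro h
    have := hs.2 a (i.eval s)
    exact ⟨ih h, by omega⟩
  | op o e f ihe ihf =>
    intro h
    have h' := h
    simp only [Exp.low, Bool.and_eq_true, decide_eq_true_eq] at h
    refine ⟨ihe h.1.1, ihf h.1.2, ?_⟩
    have := (Exp.eval_le hs _ h').1
    have h2 := Nat.pow_le_pow_right (show 1 ≤ M + 10 by omega) h.2
    exact lt_of_le_of_lt (this.trans h2) hB

/-! ### Registers and arrays that a program leaves alone -/

/-- `p.wr r`: the program `p` may write the register `r`. -/
def Prog.wr : Prog → ℕ → Bool
  | .skip, _ => false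
  | .assign r _, r' => r == r'
  | .store _ _ _, _ => false
  | .seq p q, r => p.wr r || q.wr r
  | .ite _ p q, r => p.wr r || q.wr r
  | .loop _ p, r => p.wr r

/-- `p.wa a`: the program `p` may write the array `a`. -/
def Prog.wa : Prog → ℕ → Bool
  | .skip, _ => false
  | .assign _ _, _ => false
  | .store a _ _, a' => a == a'
  | .seq p q, a => p.wa a || q.wa a
  | .ite _ p q, a => p.wa a || q.wa a
  | .loop _ p, a => p.wa a

/-- What `p` does not write is the same in both states. -/
def Frame (p : Prog) (s s' : State) : Prop :=
  (∀ r, p.wr r = false → s'.reg r = s.reg r) ∧ ∀ a, p.wa a = false → s'.arr a = s.arr a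

theorem Frame.refl (p : Prog) (s : State) : Frame p s s := ⟨fun _ _ => rfl, fun _ _ => rfl⟩

theorem Frame.trans {p : Prog} {s s' s'' : State} (h : Frame p s s') (h' : Frame p s' s'') :
    Frame p s s'' :=
  ⟨fun r hr => (h'.1 r hr).trans (h.1 r hr), fun a ha => (h'.2 a ha).trans (h.2 a ha)⟩

theorem Frame.mono {p q : Prog} {s s' : State} (hr : ∀ r, q.wr r = false → p.wr r = false)
    (ha : ∀ a, q.wa a = false → p.wa a = false) (h : Frame p s s') : Frame q s s' :=
  ⟨fun r h' => h.1 r (hr r h'), fun a h' => h.2 a (ha a h')⟩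

theorem Exec.frame {B : ℕ} {p : Prog} {s s' : State} {t : ℕ} (h : Exec B p s t s') :
    Frame p s s' := by
  induction h with
  | skip s => exact Frame.refl _ _
  | assign s r e he =>
    refine ⟨fun r' h => ?_, fun _ _ => rfl⟩
    simp only [Prog.wr, beq_eq_false_iff_ne, ne_eq] at h
    exact Function.update_of_ne (fun h' => h h'.symm) _ _
  | store s a i e hi he =>
    refine ⟨fun _ _ => rfl, fun a' h => ?_⟩
    simp only [Prog.wa, beq_eq_false_iff_ne, ne_eq] at h
    exact Function.update_of_ne (fun h' => h h'.symm) _ _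
  | seq hp hq ihp ihq =>
    exact (ihp.mono (fun r h => by simp_all [Prog.wr]) (fun r h => by simp_all [Prog.wa])).trans
      (ihq.mono (fun r h => by simp_all [Prog.wr]) (fun r h => by simp_all [Prog.wa]))
  | ite_true he h hp ih =>
    exact ih.mono (fun r h => by simp_all [Prog.wr]) (fun r h => by simp_all [Prog.wa])
  | ite_false he h hp ih =>
    exact ih.mono (fun r h => by simp_all [Prog.wr]) (fun r h => by simp_all [Prog.wa])
  | loop_true he h hp hl ihp ihl =>
    exact (ihp.mono (fun r h => by simp_all [Prog.wr]) (fun r h => by simp_all [Prog.wa])).trans ihl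
  | loop_false he h => exact Frame.refl _ _

/-- The side conditions are Boolean computations, so for a concrete program they hold by `rfl`. -/
theorem Frame.congr {p : Prog} {s s' : State} (h : Frame p s s') {lr la : List ℕ}
    (hr : (lr.all fun r => !p.wr r) = true) (ha : (la.all fun a => !p.wa a) = true) :
    (∀ r ∈ lr, s'.reg r = s.reg r) ∧ ∀ a ∈ la, s'.arr a = s.arr a := by
  simp only [List.all_eq_true, Bool.not_eq_true'] at hr ha
  exact ⟨fun r h' => h.1 r (hr r h'), fun a h' => h.2 a (ha a h')⟩

/-- Started in `s`, the program `p` halts within `T` steps in a state that satisfies `Q`; all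
numbers in the run are below `B`, all numbers in the final state at most `M`. -/
def Runs (B M : ℕ) (p : Prog) (s : State) (T : ℕ) (Q : State → Prop) : Prop :=
  ∃ t s', Exec B p s t s' ∧ t ≤ T ∧ Bdd M s' ∧ Q s'

/-- The effect of a program without loops. -/
def Prog.step : Prog → State → State
  | .skip, s => s
  | .assign r e, s => s.setReg r (e.eval s)
  | .store a i e, s => s.setArr a (i.eval s) (e.eval s)
  | .seq p q, s => q.step (p.step s)
  | .ite e p q, s => if e.eval s ≠ 0 then p.step s else q.step s
  | .loop _ _, s => s

/-- The numbers that a program without loops writes are at most `M`. -/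
def Prog.Safe (M : ℕ) : Prog → State → Prop
  | .skip, _ => True
  | .assign _ e, s => e.eval s ≤ M
  | .store _ _ e, s => e.eval s ≤ M
  | .seq p q, s => p.Safe M s ∧ q.Safe M (p.step s)
  | .ite e p q, s => (e.eval s ≠ 0 → p.Safe M s) ∧ (e.eval s = 0 → q.Safe M s)
  | .loop _ _, _ => False

/-- All expressions are low. -/
def Prog.low : Prog → Bool
  | .skip => true
  | .assign _ e => e.low
  | .store _ i e => i.low && e.low
  | .seq p q => p.low && q.low
  | .ite e p q => e.low && p.low && q.low
  | .loop e p => e.low && p.low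

/-- A bound on the running time of a program without loops. -/
def Prog.cost : Prog → ℕ
  | .skip => 1
  | .assign _ e => e.cost + 1
  | .store _ i e => i.cost + e.cost + 1
  | .seq p q => p.cost + q.cost
  | .ite e p q => e.cost + 1 + max p.cost q.cost
  | .loop _ _ => 0

/-! ### Hoare rules with time bounds -/

section rules

variable {B M : ℕ} (hB : (M + 10) ^ 8 < B)

theorem Bdd.setReg {s : State} (hs : Bdd M s) {v : ℕ} (hv : v ≤ M) (r : ℕ) :
    Bdd M (s.setReg r v) := by
  refine ⟨fun r' => ?_, hs.2⟩
  simp only [State.setReg, Function.update_apply]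
  split_ifs
  exacts [hv, hs.1 _]

theorem Bdd.setArr {s : State} (hs : Bdd M s) {v : ℕ} (hv : v ≤ M) (a i : ℕ) :
    Bdd M (s.setArr a i v) := by
  refine ⟨hs.1, fun a' i' => ?_⟩
  simp only [State.setArr, Function.update_apply]
  split_ifs
  · simp only [Function.update_apply]
    split_ifs
    exacts [hv, hs.2 _ _]
  · exact hs.2 _ _

-- Loop-free code is run by evaluating `Prog.step`; what remains to be proved is that the written
-- values stay at most `M`.
include hB in
theorem exec_step : ∀ (p : Prog) (s : State), Bdd M s → p.low = true → p.Safe M s →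
    ∃ t, Exec B p s t (p.step s) ∧ t ≤ p.cost ∧ Bdd M (p.step s) := by
  intro p
  induction p with
  | skip => intro s hs _ _; exact ⟨1, Exec.skip s, le_rfl, hs⟩
  | assign r e =>
    intro s hs hl hsafe
    exact ⟨_, Exec.assign s r e (Exp.fits_of_low hB hs e hl), le_rfl, hs.setReg hsafe r⟩
  | store a i e =>
    intro s hs hl hsafe
    simp only [Prog.low, Bool.and_eq_true] at hl
    exact ⟨_, Exec.store s a i e (Exp.fits_of_low hB hs i hl.1) (Exp.fits_of_low hB hs e hl.2),
      le_rfl, hs.setArr hsafe _ _⟩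
  | seq p q ihp ihq =>
    intro s hs hl hsafe
    simp only [Prog.low, Bool.and_eq_true] at hl
    obtain ⟨t₁, h₁, ht₁, hs₁⟩ := ihp s hs hl.1 hsafe.1
    obtain ⟨t₂, h₂, ht₂, hs₂⟩ := ihq _ hs₁ hl.2 hsafe.2
    exact ⟨_, Exec.seq h₁ h₂, Nat.add_le_add ht₁ ht₂, hs₂⟩
  | ite e p q ihp ihq =>
    intro s hs hl hsafe
    simp only [Prog.low, Bool.and_eq_true] at hl
    have hf := Exp.fits_of_low hB hs e hl.1.1
    by_cases h : e.eval s = 0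
    · obtain ⟨t, h₁, ht, hs₁⟩ := ihq s hs hl.2 (hsafe.2 h)
      have : (Prog.ite e p q).step s = q.step s := by simp [Prog.step, h]
      rw [this]
      refine ⟨_, Exec.ite_false hf h h₁, ?_, hs₁⟩
      simp only [Prog.cost]
      have := le_max_right p.cost q.cost
      omega
    · obtain ⟨t, h₁, ht, hs₁⟩ := ihp s hs hl.1.2 (hsafe.1 h)
      have : (Prog.ite e p q).step s = p.step s := by simp [Prog.step, h]
      rw [this]
      refine ⟨_, Exec.ite_true hf h h₁, ?_, hs₁⟩
      simp only [Prog.cost]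
      have := le_max_left p.cost q.cost
      omega
  | loop e p ih => intro s hs hl hsafe; exact hsafe.elim

include hB in
theorem Runs.straight {p : Prog} {s : State} {T : ℕ} {Q : State → Prop} (hl : p.low = true)
    (hT : p.cost ≤ T) (hs : Bdd M s) (hsafe : p.Safe M s) (hQ : Q (p.step s)) :
    Runs B M p s T Q := by
  obtain ⟨t, h, ht, hs'⟩ := exec_step hB p s hs hl hsafe
  exact ⟨t, _, h, ht.trans hT, hs', hQ⟩

theorem Runs.mono {p : Prog} {s : State} {T T' : ℕ} {Q Q' : State → Prop}
    (h : Runs B M p s T Q) (hT : T ≤ T') (hQ : ∀ s', Bdd M s' → Frame p s s' → Q s' → Q' s') :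
    Runs B M p s T' Q' := by
  obtain ⟨t, s', he, ht, hb, hq⟩ := h
  exact ⟨t, s', he, ht.trans hT, hb, hQ s' hb he.frame hq⟩

theorem Runs.seq {p q : Prog} {s : State} {T₁ T₂ T : ℕ} {R Q : State → Prop}
    (h₁ : Runs B M p s T₁ R) (hT : T₁ + T₂ ≤ T)
    (h₂ : ∀ s', Bdd M s' → Frame p s s' → R s' → Runs B M q s' T₂ Q) :
    Runs B M (p ;; q) s T Q := by
  obtain ⟨t, s', he, ht, hb, hq⟩ := h₁
  obtain ⟨t', s'', he', ht', hb', hq'⟩ := h₂ s' hb he.frame hq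
  exact ⟨_, s'', Exec.seq he he', by omega, hb', hq'⟩

include hB in
theorem Runs.ite {e : Exp} {p q : Prog} {s : State} {T T' : ℕ} {Q : State → Prop}
    (hl : e.low = true) (hs : Bdd M s) (hT : e.cost + 1 + T' ≤ T)
    (h₁ : e.eval s ≠ 0 → Runs B M p s T' Q) (h₂ : e.eval s = 0 → Runs B M q s T' Q) :
    Runs B M (.ite e p q) s T Q := by
  have hf := Exp.fits_of_low hB hs e hl
  by_cases h : e.eval s = 0
  · obtain ⟨t, s', he, ht, hb, hq⟩ := h₂ h
    exact ⟨_, s', Exec.ite_false hf h he, by omega, hb, hq⟩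
  · obtain ⟨t, s', he, ht, hb, hq⟩ := h₁ h
    exact ⟨_, s', Exec.ite_true hf h he, by omega, hb, hq⟩

include hB in
/-- The loop rule. The potential `μ` pays for the iterations. -/
theorem Runs.loop {e : Exp} {p : Prog} (Inv : State → Prop) (μ : State → ℕ)
    (hl : e.low = true) {s₀ : State} (hs₀ : Bdd M s₀) (h₀ : Inv s₀)
    (hbody : ∀ s, Bdd M s → Frame p s₀ s → Inv s → e.eval s ≠ 0 →
      ∃ T, Runs B M p s T fun s' => Inv s' ∧ T + e.cost + 1 + μ s' ≤ μ s) :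
    Runs B M (.loop e p) s₀ (μ s₀ + e.cost + 1) fun s => Inv s ∧ e.eval s = 0 := by
  suffices H : ∀ (m : ℕ) (s : State), μ s ≤ m → Bdd M s → Frame p s₀ s → Inv s →
      Runs B M (.loop e p) s (μ s + e.cost + 1) fun s => Inv s ∧ e.eval s = 0 from
    H _ s₀ le_rfl hs₀ (Frame.refl _ _) h₀
  intro m
  induction m with
  | zero =>
    intro s hm hs hF hI
    have hf := Exp.fits_of_low hB hs e hl
    by_cases h : e.eval s = 0
    · exact ⟨_, s, Exec.loop_false hf h, by omega, hs, hI, h⟩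
    · obtain ⟨T, t, s', he, ht, hb, hI', hμ⟩ := hbody s hs hF hI h
      -- An iteration lowers the potential by at least `e.cost + 1`, which is impossible at
      -- potential zero.
      omega
  | succ m ih =>
    intro s hm hs hF hI
    have hf := Exp.fits_of_low hB hs e hl
    by_cases h : e.eval s = 0
    · exact ⟨_, s, Exec.loop_false hf h, by omega, hs, hI, h⟩
    · obtain ⟨T, t, s', he, ht, hb, hI', hμ⟩ := hbody s hs hF hI h
      obtain ⟨t', s'', he', ht', hb', hq'⟩ := ih s' (by omega) hb (hF.trans he.frame) hI'
      exact ⟨_, s'', Exec.loop_true hf h he he', by omega, hb', hq'⟩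

include hB in
/-- The rule for loops whose number of iterations is known. -/
theorem Runs.for {e : Exp} {p : Prog} (Inv : ℕ → State → Prop) (n Tb : ℕ)
    (hl : e.low = true) {s₀ : State} (hs₀ : Bdd M s₀) (h₀ : Inv 0 s₀)
    (hcond : ∀ k s, k ≤ n → Frame p s₀ s → Inv k s → (e.eval s ≠ 0 ↔ k < n))
    (hbody : ∀ k s, k < n → Bdd M s → Frame p s₀ s → Inv k s → Runs B M p s Tb (Inv (k + 1)))
    {T : ℕ} (hT : n * (Tb + e.cost + 1) + e.cost + 1 ≤ T) :
    Runs B M (.loop e p) s₀ T (Inv n) := by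
  suffices H : ∀ (m k : ℕ) (s : State), k + m = n → Bdd M s → Frame p s₀ s → Inv k s →
      Runs B M (.loop e p) s (m * (Tb + e.cost + 1) + e.cost + 1) (Inv n) from
    (H n 0 s₀ (by omega) hs₀ (Frame.refl _ _) h₀).mono hT fun _ _ _ h => h
  intro m
  induction m with
  | zero =>
    intro k s hk hs hF hI
    obtain rfl : k = n := by omega
    have hf := Exp.fits_of_low hB hs e hl
    have h : e.eval s = 0 := by
      by_contra h
      exact absurd ((hcond k s le_rfl hF hI).1 h) (lt_irrefl _)
    exact ⟨_, s, Exec.loop_false hf h, by omega, hs, hI⟩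
  | succ m ih =>
    intro k s hk hs hF hI
    have hf := Exp.fits_of_low hB hs e hl
    have h := (hcond k s (by omega) hF hI).2 (by omega)
    obtain ⟨t, s', he, ht, hb, hI'⟩ := hbody k s (by omega) hs hF hI
    obtain ⟨t', s'', he', ht', hb', hq'⟩ := ih (k + 1) s' (by omega) hb (hF.trans he.frame) hI'
    refine ⟨_, s'', Exec.loop_true hf h he he', ?_, hb', hq'⟩
    have : (m + 1) * (Tb + e.cost + 1) = m * (Tb + e.cost + 1) + (Tb + e.cost + 1) := by ring
    omega

end rules

end WordRAM

/-! ## Hitting sets for unions of intervals -/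

namespace AtMostNValue

/-- A hitting set problem on the points `1, …, d`: the set `F` of intervals has to be hit, and `H`
further sets. The latter are given by indices `t`, which stand for the union of the intervals
`[L u, R u]` with `t ≤ u ≤ t + hl t`; the predicate `hv` tells which indices may occur. The points
are partitioned into segments, numbered by `sg`; `nx p` is the first right end of an interval of `F`
that begins after `p`, or `d + 1`; `la p` is the last and `cn p` the number of further points that
iterating `nx` reaches within the segment of `p`. Less than `lim` points may be used. -/
structure Sys where
  d : ℕ
  H : ℕ
  lim : ℕ
  L : ℕ → ℕ
  R : ℕ → ℕ
  hl : ℕ → ℕ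
  sg : ℕ → ℕ
  nx : ℕ → ℕ
  la : ℕ → ℕ
  cn : ℕ → ℕ
  F : Set (ℕ × ℕ)
  hv : ℕ → Prop

namespace Sys

variable (Y : Sys)

/-- No segment boundary is crossed by `p` only if the next point lies in another segment. -/
def Settled (p : ℕ) : Prop := Y.nx p ≤ Y.d → Y.sg p < Y.sg (Y.nx p)

/-- By `sgL` and `sgR`, a new segment starts at each left end and directly after each right end of
an interval of a set with holes. The field `chain` is the recursion that defines `la` and `cn` along
`nx` within a segment. -/
structure WF : Prop where
  bound : ∀ t, Y.hv t → 1 ≤ Y.L t ∧ Y.L t ≤ Y.R t ∧ Y.R t ≤ Y.d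
  succ : ∀ t, Y.hv t → 0 < Y.hl t →
    Y.hv (t + 1) ∧ Y.hl (t + 1) + 1 = Y.hl t ∧ Y.R t < Y.L (t + 1)
  sgL : ∀ t p, Y.hv t → p < Y.L t → Y.sg p < Y.sg (Y.L t)
  sgR : ∀ t g, Y.hv t → Y.R t < g → g ≤ Y.d → Y.sg (Y.R t) < Y.sg g
  sg_mono : ∀ p q, p ≤ q → q ≤ Y.d → Y.sg p ≤ Y.sg q
  Fbound : ∀ f ∈ Y.F, 1 ≤ f.1 ∧ f.1 ≤ f.2 ∧ f.2 ≤ Y.d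
  nx_bound : ∀ p, p ≤ Y.d → p < Y.nx p ∧ Y.nx p ≤ Y.d + 1
  nx_le : ∀ p, p ≤ Y.d → ∀ f ∈ Y.F, p < f.1 → Y.nx p ≤ f.2
  nx_mem : ∀ p, Y.nx p ≤ Y.d → p ≤ Y.d → ∃ f ∈ Y.F, p < f.1 ∧ f.2 = Y.nx p
  chain : ∀ g, g ≤ Y.d → (Y.la g = g ∧ Y.cn g = 0 ∧ Y.Settled g) ∨
    (Y.nx g ≤ Y.d ∧ Y.sg (Y.nx g) = Y.sg g ∧ Y.la g = Y.la (Y.nx g) ∧ Y.cn g = Y.cn (Y.nx g) + 1)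

/-- The set that the index `t` stands for. -/
def Dm (t : ℕ) : Set ℕ := {p | ∃ u, t ≤ u ∧ u ≤ t + Y.hl t ∧ Y.L u ≤ p ∧ p ≤ Y.R u}

/-- `S` hits all sets that begin after `p`. -/
def Hits (p : ℕ) (ts : ℕ → ℕ) (S : Finset ℕ) : Prop :=
  (∀ f ∈ Y.F, p < f.1 → ∃ q ∈ S, f.1 ≤ q ∧ q ≤ f.2) ∧
    ∀ j < Y.H, p < Y.L (ts j) → ∃ q ∈ S, q ∈ Y.Dm (ts j)

/-- After `c` points, the last one of them `p`, the solution can be completed. -/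
def Tot (c p : ℕ) (ts : ℕ → ℕ) : Prop := ∃ S : Finset ℕ, c + S.card < Y.lim ∧ Y.Hits p ts S

/-! ### Greedy choice, branching and pruning -/

variable {Y}

/-- The intervals of a set are numbered from left to right, so all later ones lie beyond the first.
-/
theorem WF.le_of_mem_Dm (hY : Y.WF) {t q : ℕ} (ht : Y.hv t) (hq : q ∈ Y.Dm t) : Y.L t ≤ q := by
  obtain ⟨u, h₁, h₂, h₃, h₄⟩ := hq
  induction hk : Y.hl t generalizing t with
  | zero =>
    obtain rfl : u = t := by omega
    exact h₃
  | succ k ih =>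
    obtain ⟨a, b, c⟩ := hY.succ t ht (by omega)
    rcases Nat.eq_or_lt_of_le h₁ with rfl | h
    · exact h₃
    · have := ih a h (by omega) (by omega)
      have := hY.bound t ht
      omega

theorem mem_Dm_of_first {t q : ℕ} (h₁ : Y.L t ≤ q) (h₂ : q ≤ Y.R t) : q ∈ Y.Dm t :=
  ⟨t, le_rfl, Nat.le_add_right _ _, h₁, h₂⟩

theorem Dm_of_hl_eq_zero {t q : ℕ} (ht : Y.hl t = 0) (hq : q ∈ Y.Dm t) : q ≤ Y.R t := by
  obtain ⟨u, h₁, h₂, h₃, h₄⟩ := hq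
  obtain rfl : u = t := by omega
  exact h₄

theorem WF.Dm_succ (hY : Y.WF) {t q : ℕ} (ht : Y.hv t) (h : 0 < Y.hl t) :
    q ∈ Y.Dm (t + 1) ↔ q ∈ Y.Dm t ∧ Y.R t < q := by
  obtain ⟨a, b, c⟩ := hY.succ t ht h
  constructor
  · intro hq
    have := hY.le_of_mem_Dm a hq
    obtain ⟨u, h₁, h₂, h₃, h₄⟩ := hq
    exact ⟨⟨u, by omega, by omega, h₃, h₄⟩, by omega⟩
  · rintro ⟨⟨u, h₁, h₂, h₃, h₄⟩, h₅⟩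
    have : u ≠ t := by rintro rfl; omega
    exact ⟨u, by omega, by omega, h₃, h₄⟩

/-- A set that begins after `p` but not after `g` contains `g`, because its first interval does not
end before `g`. -/
theorem hits_insert_of_hits {g p : ℕ} {ts : ℕ → ℕ} {S : Finset ℕ} (hS : Y.Hits g ts S)
    (hF : ∀ f ∈ Y.F, p < f.1 → g ≤ f.2) (hT : ∀ j < Y.H, p < Y.L (ts j) → g ≤ Y.R (ts j)) :
    Y.Hits p ts (insert g S) := by
  refine ⟨fun f hf hp => ?_, fun j hj hp => ?_⟩
  · by_cases h : g < f.1
    · obtain ⟨q, hq, hq'⟩ := hS.1 f hf h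
      exact ⟨q, Finset.mem_insert_of_mem hq, hq'⟩
    · exact ⟨g, Finset.mem_insert_self _ _, by omega, hF f hf hp⟩
  · by_cases h : g < Y.L (ts j)
    · obtain ⟨q, hq, hq'⟩ := hS.2 j hj h
      exact ⟨q, Finset.mem_insert_of_mem hq, hq'⟩
    · exact ⟨g, Finset.mem_insert_self _ _, mem_Dm_of_first (by omega) (hT j hj hp)⟩

/-- Points up to `g` are useless for sets that begin after `g`. -/
theorem WF.hits_filter_of_hits (hY : Y.WF) {g p : ℕ} {ts : ℕ → ℕ} {S : Finset ℕ}
    (hv : ∀ j < Y.H, Y.hv (ts j)) (hpg : p ≤ g) (hS : Y.Hits p ts S) :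
    Y.Hits g ts (S.filter (g < ·)) := by
  refine ⟨fun f hf hp => ?_, fun j hj hp => ?_⟩
  · obtain ⟨q, hq, hq'⟩ := hS.1 f hf (by omega)
    exact ⟨q, Finset.mem_filter.2 ⟨hq, by omega⟩, hq'⟩
  · obtain ⟨q, hq, hq'⟩ := hS.2 j hj (by omega)
    have := hY.le_of_mem_Dm (hv j hj) hq'
    exact ⟨q, Finset.mem_filter.2 ⟨hq, by omega⟩, hq'⟩

/-- Discarding the points up to `g` removes at least one, which pays for the increased cost. -/
theorem WF.tot_of_hits (hY : Y.WF) {g p c : ℕ} {ts : ℕ → ℕ} {S : Finset ℕ}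
    (hv : ∀ j < Y.H, Y.hv (ts j)) (hpg : p ≤ g) (hS : Y.Hits p ts S) (hc : c + S.card < Y.lim)
    (h : ∃ q ∈ S, q ≤ g) : Y.Tot (c + 1) g ts := by
  obtain ⟨q, hq, hqg⟩ := h
  refine ⟨S.filter (g < ·), ?_, hY.hits_filter_of_hits hv hpg hS⟩
  have : (S.filter (g < ·)).card < S.card :=
    Finset.card_lt_card (Finset.filter_ssubset.2 ⟨q, hq, by omega⟩)
  omega

theorem tot_of_tot_pick {g p c : ℕ} {ts : ℕ → ℕ} (h : Y.Tot (c + 1) g ts)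
    (hF : ∀ f ∈ Y.F, p < f.1 → g ≤ f.2) (hT : ∀ j < Y.H, p < Y.L (ts j) → g ≤ Y.R (ts j)) :
    Y.Tot c p ts := by
  obtain ⟨S, hc, hS⟩ := h
  have := Finset.card_insert_le g S
  exact ⟨insert g S, by omega, hits_insert_of_hits hS hF hT⟩

/-- The greedy choice: `g` is the first right end of a set, and this set is an interval. -/
theorem WF.tot_pick (hY : Y.WF) {g p c : ℕ} {ts : ℕ → ℕ} (hv : ∀ j < Y.H, Y.hv (ts j)) (hpg : p ≤ g)
    (hF : ∀ f ∈ Y.F, p < f.1 → g ≤ f.2) (hT : ∀ j < Y.H, p < Y.L (ts j) → g ≤ Y.R (ts j))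
    (hg : (∃ f ∈ Y.F, p < f.1 ∧ f.2 = g) ∨
      ∃ j < Y.H, p < Y.L (ts j) ∧ Y.R (ts j) = g ∧ Y.hl (ts j) = 0) :
    Y.Tot c p ts ↔ Y.Tot (c + 1) g ts := by
  refine ⟨?_, fun h => tot_of_tot_pick h hF hT⟩
  rintro ⟨S, hc, hS⟩
  refine hY.tot_of_hits hv hpg hS hc ?_
  rcases hg with ⟨f, hf, hp, rfl⟩ | ⟨j, hj, hp, rfl, h0⟩
  · obtain ⟨q, hq, hq'⟩ := hS.1 f hf hp
    exact ⟨q, hq, hq'.2⟩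
  · obtain ⟨q, hq, hq'⟩ := hS.2 j hj hp
    exact ⟨q, hq, Dm_of_hl_eq_zero h0 hq'⟩

/-- Iterating `nx` inside one segment is a sequence of forced picks, whatever the sets with holes
are. The picks increase strictly, so their number is at most the distance covered; this later keeps
costs below positions. -/
theorem WF.tot_jump (hY : Y.WF) {ts : ℕ → ℕ} (hv : ∀ j < Y.H, Y.hv (ts j)) (g : ℕ) (hg : g ≤ Y.d) :
    g ≤ Y.la g ∧ Y.la g ≤ Y.d ∧ Y.sg (Y.la g) = Y.sg g ∧ Y.Settled (Y.la g) ∧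
      Y.cn g + g ≤ Y.la g ∧ ∀ c, Y.Tot c g ts ↔ Y.Tot (c + Y.cn g) (Y.la g) ts := by
  induction hk : Y.d - g using Nat.strong_induction_on generalizing g with
  | _ k ih =>
    rcases hY.chain g hg with ⟨h₁, h₂, h₃⟩ | ⟨h₁, h₂, h₃, h₄⟩
    · rw [h₁, h₂]
      exact ⟨le_rfl, hg, rfl, h₃, by omega, fun c => Iff.rfl⟩
    · have hlt := (hY.nx_bound g hg).1
      obtain ⟨a, b, c, e, f, i⟩ := ih (Y.d - Y.nx g) (by omega) (Y.nx g) h₁ rfl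
      rw [h₃, h₄]
      refine ⟨by omega, b, c.trans h₂, e, by omega, fun c => ?_⟩
      rw [hY.tot_pick hv hlt.le (hY.nx_le g hg) ?_ (Or.inl (hY.nx_mem g h₁ hg)), i,
        show c + 1 + Y.cn (Y.nx g) = c + (Y.cn (Y.nx g) + 1) by ring]
      intro j hj hL
      -- A set with holes that begins after `g` and whose first interval ends before `nx g` would
      -- put segment boundaries between these two points of the same segment.
      by_contra hR
      have := hY.sgL _ _ (hv j hj) hL
      have := hY.sgR _ _ (hv j hj) (not_le.1 hR) h₁
      have := hY.sg_mono _ _ (hY.bound _ (hv j hj)).2.1 (hY.bound _ (hv j hj)).2.2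
      omega

/-- The greedy algorithm stops at `p`: the first right end after `p` is `rm`, and it belongs to the
set number `jm`, which is not an interval; or there are no more sets, and `rm = d + 1`. -/
structure Stop (Y : Sys) (p : ℕ) (ts : ℕ → ℕ) (rm jm : ℕ) : Prop where
  le : rm ≤ Y.d + 1
  hF : ∀ f ∈ Y.F, p < f.1 → rm ≤ f.2
  hT : ∀ j < Y.H, p < Y.L (ts j) → rm ≤ Y.R (ts j)
  hjm : rm ≤ Y.d → jm < Y.H ∧ p < Y.L (ts jm) ∧ Y.R (ts jm) = rm ∧ 0 < Y.hl (ts jm)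

/-- Advance the `j`-th set: forget its first interval. -/
def adv (ts : ℕ → ℕ) (j : ℕ) : ℕ → ℕ := Function.update ts j (ts j + 1)

theorem WF.hv_adv (hY : Y.WF) {ts : ℕ → ℕ} (hv : ∀ j < Y.H, Y.hv (ts j)) {j : ℕ} (hj : j < Y.H)
    (h : 0 < Y.hl (ts j)) : ∀ i < Y.H, Y.hv (adv ts j i) := by
  intro i hi
  simp only [adv, Function.update_apply]
  split_ifs
  exacts [(hY.succ _ (hv j hj) h).1, hv i hi]

/-- A solution either uses a point up to `rm`, which may then be moved to `rm`, or it hits the set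
`jm` beyond its first interval. -/
theorem WF.tot_branch (hY : Y.WF) {p c rm jm : ℕ} {ts : ℕ → ℕ} (hv : ∀ j < Y.H, Y.hv (ts j))
    (hs : Y.Stop p ts rm jm) (h : rm ≤ Y.d) :
    Y.Tot c p ts ↔ Y.Tot (c + 1) rm ts ∨ Y.Tot c p (adv ts jm) := by
  obtain ⟨hj, hp, hR, hl⟩ := hs.hjm h
  have hb := hY.bound _ (hv jm hj)
  obtain ⟨a, b, e⟩ := hY.succ _ (hv jm hj) hl
  constructor
  · rintro ⟨S, hc, hS⟩
    by_cases hq : ∃ q ∈ S, q ≤ rm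
    · exact Or.inl (hY.tot_of_hits hv (by omega) hS hc hq)
    · push Not at hq
      refine Or.inr ⟨S, hc, hS.1, fun j hj' hp' => ?_⟩
      by_cases hjj : j = jm
      · subst hjj
        obtain ⟨q, hq1, hq2⟩ := hS.2 j hj hp
        refine ⟨q, hq1, ?_⟩
        simp only [adv, Function.update_self]
        exact (hY.Dm_succ (hv j hj) hl).2 ⟨hq2, hR ▸ hq q hq1⟩
      · simp only [adv, Function.update_of_ne hjj] at hp' ⊢
        exact hS.2 j hj' hp'
  · rintro (h' | ⟨S, hc, hS⟩)
    · exact tot_of_tot_pick h' hs.hF hs.hT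
    · refine ⟨S, hc, hS.1, fun j hj' hp' => ?_⟩
      by_cases hjj : j = jm
      · subst hjj
        have := hS.2 j hj
        simp only [adv, Function.update_self] at this
        obtain ⟨q, hq1, hq2⟩ := this (by omega)
        exact ⟨q, hq1, ((hY.Dm_succ (hv j hj) hl).1 hq2).1⟩
      · have := hS.2 j hj'
        simp only [adv, Function.update_of_ne hjj] at this
        exact this hp'

/-- No set begins after `p` any more, so the empty completion suffices and only the cost matters. -/
theorem WF.tot_finish (hY : Y.WF) {p c rm jm : ℕ} {ts : ℕ → ℕ} (hv : ∀ j < Y.H, Y.hv (ts j))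
    (hs : Y.Stop p ts rm jm) (h : ¬ rm ≤ Y.d) : Y.Tot c p ts ↔ c < Y.lim := by
  constructor
  · rintro ⟨S, hc, -⟩
    omega
  · intro hc
    refine ⟨∅, by simpa using hc, fun f hf hp => ?_, fun j hj hp => ?_⟩
    · have := hs.hF f hf hp
      have := (hY.Fbound f hf).2.2
      omega
    · have := hs.hT j hj hp
      have := (hY.bound _ (hv j hj)).2.2
      omega

/-- Two branches with the same next position `r`: if the branch that picks the end of the first
interval of the set `j` costs at most as much, then the other branch need not pick `r`. -/
theorem tot_prune_drop {r cA cB j : ℕ} {ts : ℕ → ℕ} (hj : Y.L (ts j) ≤ r) (hc : cA ≤ cB)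
    (h : Y.Tot (cB + 1) r (adv ts j)) : Y.Tot (cA + 1) r ts := by
  obtain ⟨S, hS, h1, h2⟩ := h
  refine ⟨S, by omega, h1, fun i hi hp => ?_⟩
  have hij : i ≠ j := by rintro rfl; omega
  have := h2 i hi
  simp only [adv, Function.update_of_ne hij] at this
  exact this hp

/-- If it costs more, then it need not pick `r`. -/
theorem WF.tot_prune_pick (hY : Y.WF) {r cA cB j : ℕ} {ts : ℕ → ℕ} (hv : Y.hv (ts j))
    (hl : 0 < Y.hl (ts j)) (hc : cB < cA) (h : Y.Tot (cA + 1) r ts) :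
    Y.Tot (cB + 1) r (adv ts j) := by
  obtain ⟨S, hS, h1, h2⟩ := h
  have := Finset.card_insert_le (Y.R (ts j + 1)) S
  obtain ⟨a, -, -⟩ := hY.succ _ hv hl
  -- One extra point in the second interval hits what is left of the set `j`; the cost difference
  -- `cB < cA` pays for it.
  refine ⟨insert (Y.R (ts j + 1)) S, by omega, fun f hf hp => ?_, fun i hi hp => ?_⟩
  · obtain ⟨q, hq, hq'⟩ := h1 f hf hp
    exact ⟨q, Finset.mem_insert_of_mem hq, hq'⟩
  · by_cases hij : i = j
    · subst hij
      refine ⟨_, Finset.mem_insert_self _ _, ?_⟩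
      simp only [adv, Function.update_self]
      exact mem_Dm_of_first (hY.bound _ a).2.1 le_rfl
    · simp only [adv, Function.update_of_ne hij] at hp ⊢
      obtain ⟨q, hq, hq'⟩ := h2 i hi hp
      exact ⟨q, Finset.mem_insert_of_mem hq, hq'⟩

/-! ### The measure -/

/-- The number of holes of the sets that begin after `p`. -/
def rest (Y : Sys) (p : ℕ) (ts : ℕ → ℕ) : ℕ :=
  ∑ j ∈ Finset.range Y.H, if p < Y.L (ts j) then Y.hl (ts j) else 0

theorem rest_anti {p q : ℕ} (h : p ≤ q) (ts : ℕ → ℕ) : Y.rest q ts ≤ Y.rest p ts := by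
  refine Finset.sum_le_sum fun j _ => ?_
  split_ifs <;> omega

theorem rest_congr {p : ℕ} {ts ts' : ℕ → ℕ} (h : ∀ j < Y.H, ts j = ts' j) :
    Y.rest p ts = Y.rest p ts' := by
  refine Finset.sum_congr rfl fun j hj => ?_
  rw [h j (Finset.mem_range.1 hj)]

theorem hits_congr {p : ℕ} {ts ts' : ℕ → ℕ} {S : Finset ℕ} (h : ∀ j < Y.H, ts j = ts' j) :
    Y.Hits p ts S ↔ Y.Hits p ts' S := by
  unfold Hits
  refine and_congr Iff.rfl (forall_congr' fun j => forall_congr' fun hj => ?_)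
  rw [h j hj]

theorem tot_congr {c p : ℕ} {ts ts' : ℕ → ℕ} (h : ∀ j < Y.H, ts j = ts' j) :
    Y.Tot c p ts ↔ Y.Tot c p ts' := by
  unfold Tot
  refine exists_congr fun S => ?_
  rw [hits_congr h]

/-- The next interval lies further right, so the set still counts, with one hole less. -/
theorem WF.rest_adv (hY : Y.WF) {p j : ℕ} {ts : ℕ → ℕ} (hj : j < Y.H) (hv : Y.hv (ts j))
    (hp : p < Y.L (ts j)) (hl : 0 < Y.hl (ts j)) : Y.rest p (adv ts j) + 1 = Y.rest p ts := by
  have hj' : j ∈ Finset.range Y.H := Finset.mem_range.2 hj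
  obtain ⟨a, b, c⟩ := hY.succ _ hv hl
  have := hY.bound _ hv
  unfold rest
  rw [← Finset.add_sum_erase _ _ hj', ← Finset.add_sum_erase _ _ hj',
    Finset.sum_congr rfl (g := fun i => if p < Y.L (ts i) then Y.hl (ts i) else 0)]
  · simp only [adv, Function.update_self]
    rw [if_pos (by omega), if_pos hp]
    omega
  · intro i hi
    simp only [adv, Function.update_of_ne (Finset.ne_of_mem_erase hi)]

/-- The set `j` no longer begins after the position, so all its holes are lost at once. -/
theorem rest_pick {p q j : ℕ} {ts : ℕ → ℕ} (hj : j < Y.H) (hpq : p ≤ q)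
    (hp : p < Y.L (ts j)) (hq : Y.L (ts j) ≤ q) : Y.rest q ts + Y.hl (ts j) ≤ Y.rest p ts := by
  have hj' : j ∈ Finset.range Y.H := Finset.mem_range.2 hj
  unfold rest
  rw [← Finset.add_sum_erase _ _ hj', ← Finset.add_sum_erase _ _ hj', if_pos hp,
    if_neg (by omega)]
  have : ∑ i ∈ (Finset.range Y.H).erase j, (if q < Y.L (ts i) then Y.hl (ts i) else 0) ≤
      ∑ i ∈ (Finset.range Y.H).erase j, if p < Y.L (ts i) then Y.hl (ts i) else 0 := by
    refine Finset.sum_le_sum fun j _ => ?_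
    split_ifs <;> omega
  omega

/-- If hardly any hole is lost, then no set with holes is lost. -/
theorem lt_of_rest {p q i : ℕ} {ts : ℕ → ℕ} (hpq : p ≤ q) (h : Y.rest q ts = Y.rest p ts)
    (hi : i < Y.H) (hp : p < Y.L (ts i)) (hl : 0 < Y.hl (ts i)) : q < Y.L (ts i) := by
  by_contra hq
  have := rest_pick hi hpq hp (not_lt.1 hq)
  omega

/-- The set `j` already accounts for the entire loss, so no other set with holes can have been
passed. -/
theorem lt_of_rest_pick {p q i j : ℕ} {ts : ℕ → ℕ}
    (h : Y.rest q ts + Y.hl (ts j) = Y.rest p ts) (hj : j < Y.H) (hp : p < Y.L (ts j))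
    (hq : Y.L (ts j) ≤ q) (hi : i < Y.H) (hij : i ≠ j) (hpi : p < Y.L (ts i))
    (hl : 0 < Y.hl (ts i)) : q < Y.L (ts i) := by
  by_contra hqi
  revert h
  have hj' : j ∈ Finset.range Y.H := Finset.mem_range.2 hj
  have hi' : i ∈ (Finset.range Y.H).erase j := Finset.mem_erase.2 ⟨hij, Finset.mem_range.2 hi⟩
  unfold rest
  rw [← Finset.add_sum_erase _ _ hj', ← Finset.add_sum_erase _ _ hj', ← Finset.add_sum_erase _ _ hi',
    ← Finset.add_sum_erase _ _ hi', if_pos hp, if_neg (by omega), if_pos hpi, if_neg (by omega)]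
  have : ∑ i ∈ ((Finset.range Y.H).erase j).erase i, (if q < Y.L (ts i) then Y.hl (ts i) else 0) ≤
      ∑ i ∈ ((Finset.range Y.H).erase j).erase i, if p < Y.L (ts i) then Y.hl (ts i) else 0 := by
    refine Finset.sum_le_sum fun j _ => ?_
    split_ifs <;> omega
  omega

theorem Stop.rest_pos {p rm jm : ℕ} {ts : ℕ → ℕ} (hs : Y.Stop p ts rm jm) (h : rm ≤ Y.d) :
    1 ≤ Y.rest p ts := by
  obtain ⟨hj, hp, -, hl⟩ := hs.hjm h
  have := Finset.single_le_sum (s := Finset.range Y.H)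
    (f := fun j => if p < Y.L (ts j) then Y.hl (ts j) else 0) (fun _ _ => Nat.zero_le _)
    (Finset.mem_range.2 hj)
  simp only [hp, if_true] at this
  unfold rest
  omega

theorem WF.stop_le_of_rest_pos (hY : Y.WF) {p rm jm : ℕ} {ts : ℕ → ℕ}
    (hv : ∀ j < Y.H, Y.hv (ts j)) (hs : Y.Stop p ts rm jm) (h : 1 ≤ Y.rest p ts) : rm ≤ Y.d := by
  by_contra hrm
  have : Y.rest p ts = 0 := by
    refine Finset.sum_eq_zero fun j hj => ?_
    rw [Finset.mem_range] at hj
    refine if_neg fun hp => ?_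
    have := hs.hT j hj hp
    have := (hY.bound _ (hv j hj)).2.2
    omega
  omega

/-- If both branches lose a single hole only, and holes are left, then they stop at the same
position. -/
theorem WF.stop_eq (hY : Y.WF) {p rm jm pA rA jA pB rB jB : ℕ} {ts : ℕ → ℕ}
    (hv : ∀ j < Y.H, Y.hv (ts j)) (hs : Y.Stop p ts rm jm) (h : rm ≤ Y.d)
    (hpA : rm ≤ pA) (hpB : p ≤ pB) (hA : Y.Stop pA ts rA jA) (hB : Y.Stop pB (adv ts jm) rB jB)
    (hrA : Y.rest pA ts + 1 = Y.rest p ts) (hrB : Y.rest pB (adv ts jm) + 1 = Y.rest p ts)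
    (h2 : 2 ≤ Y.rest p ts) : rA = rB := by
  obtain ⟨hj, hp, hR, hl⟩ := hs.hjm h
  have hLR := (hY.bound _ (hv jm hj)).2.1
  obtain ⟨hvs, hls, hLs⟩ := hY.succ _ (hv jm hj) hl
  have hv' := hY.hv_adv hv hj hl
  have hadv := hY.rest_adv hj (hv jm hj) hp hl
  have hpick := rest_pick (Y := Y) hj (show p ≤ pA by omega) hp (by omega)
  -- Picking loses all holes of the set `jm`, and only one hole was lost. Once its first interval is
  -- forgotten, this set is an interval and cannot stop the second branch.
  have hl1 : Y.hl (ts jm) = 1 := by omega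
  obtain ⟨hjA, hpjA, hRA, hlA⟩ := hA.hjm (hY.stop_le_of_rest_pos hv hA (by omega))
  obtain ⟨hjB, hpjB, hRB, hlB⟩ := hB.hjm (hY.stop_le_of_rest_pos hv' hB (by omega))
  have hneA : jA ≠ jm := by rintro rfl; omega
  have hneB : jB ≠ jm := by
    rintro rfl
    simp only [adv, Function.update_self] at hlB
    omega
  apply le_antisymm
  -- The first branch has passed no set with holes except `jm`, so the set `jB` still begins after
  -- `pA` and its right end bounds `rA`. The other inequality is symmetric.
  · simp only [adv, Function.update_of_ne hneB] at hpjB hRB hlB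
    rw [← hRB]
    exact hA.hT jB hjB (lt_of_rest_pick (by omega) hj hp (by omega) hjB hneB
      (by omega) hlB)
  · have := hB.hT jA hjA
    have h3 := lt_of_rest (i := jA) hpB (show Y.rest pB (adv ts jm) = Y.rest p (adv ts jm) by omega)
      hjA
    simp only [adv, Function.update_of_ne hneA] at this h3
    rw [← hRA]
    exact this (h3 (by omega) hlA)

end Sys

/-! ### The Fibonacci bound for the search tree -/

/-- The potential of a subproblem with `k` holes. -/
def pot (k : ℕ) : ℕ := 2 * Nat.fib (k + 2) - 1

theorem one_le_fib (k : ℕ) : 1 ≤ Nat.fib (k + 2) := Nat.fib_pos.2 (by omega)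

theorem pot_mono {k l : ℕ} (h : k ≤ l) : pot k ≤ pot l := by
  have := Nat.fib_mono (show k + 2 ≤ l + 2 by omega)
  unfold pot
  omega

/-- One node and two subtrees: the factor `2` and the summand `-1` in `pot` absorb the node itself
in the Fibonacci recurrence. -/
theorem pot_add (k : ℕ) : 1 + pot (k + 1) + pot k = pot (k + 2) := by
  have h1 : Nat.fib (k + 2 + 2) = Nat.fib (k + 2) + Nat.fib (k + 1 + 2) := Nat.fib_add_two
  have := one_le_fib k
  have := one_le_fib (k + 1)
  unfold pot
  omega

theorem one_le_pot (k : ℕ) : 1 ≤ pot k := by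
  have := one_le_fib k
  unfold pot
  omega

theorem pot_zero : pot 0 = 1 := rfl

/-- With a single hole there is no second one to lose, but then both subtrees are leaves, and `1 + 1
+ 1 = pot 1`. -/
theorem pot_branch {k a b : ℕ} (hk : 1 ≤ k) (ha : a + 1 ≤ k) (hb : b + 1 ≤ k)
    (h : 2 ≤ k → a + 2 ≤ k ∨ b + 2 ≤ k) : 1 + pot a + pot b ≤ pot k := by
  obtain rfl | hk := Nat.eq_or_lt_of_le hk
  · obtain rfl : a = 0 := by omega
    obtain rfl : b = 0 := by omega
    exact le_rfl
  · obtain ⟨k, rfl⟩ : ∃ l, k = l + 2 := ⟨k - 2, by omega⟩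
    have := pot_add k
    rcases h hk with h | h
    · have := pot_mono (show a ≤ k by omega)
      have := pot_mono (show b ≤ k + 1 by omega)
      omega
    · have := pot_mono (show a ≤ k + 1 by omega)
      have := pot_mono (show b ≤ k by omega)
      omega

/-- Powers of `φ` satisfy the Fibonacci recurrence because `φ ^ 2 = φ + 1`; the induction carries
two consecutive terms. -/
theorem fib_le_goldenRatio_pow (k : ℕ) : (Nat.fib (k + 1) : ℝ) ≤ Real.goldenRatio ^ k := by
  have hsq := Real.goldenRatio_sq
  have hone := Real.one_lt_goldenRatio
  suffices h : (Nat.fib (k + 1) : ℝ) ≤ Real.goldenRatio ^ k ∧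
      (Nat.fib (k + 2) : ℝ) ≤ Real.goldenRatio ^ (k + 1) from h.1
  induction k with
  | zero => norm_num; exact hone.le
  | succ k ih =>
    refine ⟨ih.2, ?_⟩
    have h1 : Nat.fib (k + 1 + 2) = Nat.fib (k + 1) + Nat.fib (k + 2) := Nat.fib_add_two
    rw [h1]
    push_cast
    calc (Nat.fib (k + 1) : ℝ) + Nat.fib (k + 2)
        ≤ Real.goldenRatio ^ k + Real.goldenRatio ^ (k + 1) := add_le_add ih.1 ih.2
      _ = Real.goldenRatio ^ (k + 1 + 1) := by
        rw [pow_succ, pow_succ, pow_succ, mul_assoc, ← sq, hsq]; ring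

/-- One factor `2` comes from the definition of `pot`, the other one from the index shift and `φ <
2`. -/
theorem pot_le (k : ℕ) : (pot k : ℝ) ≤ 4 * Real.goldenRatio ^ k := by
  have h := fib_le_goldenRatio_pow (k + 1)
  have h1 : (pot k : ℝ) ≤ 2 * Nat.fib (k + 2) := by
    have : pot k ≤ 2 * Nat.fib (k + 2) := Nat.sub_le _ _
    exact_mod_cast this
  have h2 := Real.goldenRatio_lt_two
  have h3 : 0 < Real.goldenRatio ^ k := pow_pos Real.goldenRatio_pos k
  rw [pow_succ] at h
  nlinarith

end AtMostNValue

/-! ## Intervals of a domain -/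

namespace AtMostNValue

theorem sort_insert_max {s : Finset ℕ} {a : ℕ} (h : ∀ b ∈ s, b < a) :
    (insert a s).sort (· ≤ ·) = s.sort (· ≤ ·) ++ [a] := by
  have hnd : (s.sort (· ≤ ·) ++ [a]).Nodup := by
    rw [List.nodup_append]
    refine ⟨Finset.sort_nodup _ _, List.nodup_singleton _, fun b hb c hc => ?_⟩
    rw [Finset.mem_sort] at hb
    rw [List.mem_singleton] at hc
    have := h b hb
    omega
  have := (List.toFinset_sort (r := (· ≤ ·)) hnd).2 (by
    rw [List.pairwise_append]
    refine ⟨Finset.pairwise_sort _ _, List.pairwise_singleton _ _, fun b hb c hc => ?_⟩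
    rw [Finset.mem_sort] at hb
    rw [List.mem_singleton] at hc
    exact hc ▸ (h b hb).le)
  rw [← this]
  congr 1
  ext b
  simp

/-- A missing value that separates `v` from the nearest smaller element of `S` separates it from all
smaller ones. Without the nearest element, the condition is easier to follow when values are
appended. -/
theorem mem_leftEnds {D S : Finset ℕ} {v : ℕ} :
    v ∈ leftEnds D S ↔ v ∈ S ∧ ∀ u ∈ S, u < v → ∃ w ∈ D \ S, u < w ∧ w < v := by
  unfold leftEnds
  rw [Finset.mem_filter]
  refine and_congr_right fun hv => ⟨?_, fun h => ?_⟩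
  · rintro (h | ⟨u, hu, -, -, ⟨w, hw, huw, hwv⟩, hn⟩) u' hu' hlt
    · have := h u' hu'
      omega
    · refine ⟨w, hw, ?_, hwv⟩
      by_contra hc
      exact hn ⟨u', hu', by omega, hlt⟩
  · by_cases hmin : ∀ u ∈ S, v ≤ u
    · exact Or.inl hmin
    · right
      push Not at hmin
      have hne : (S.filter (· < v)).Nonempty := by
        obtain ⟨u, hu, huv⟩ := hmin
        exact ⟨u, Finset.mem_filter.2 ⟨hu, huv⟩⟩
      have hm := Finset.mem_filter.1 (Finset.max'_mem _ hne)
      refine ⟨_, hm.1, hm.1, hv, h _ hm.1 hm.2, ?_⟩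
      rintro ⟨u, hu, h1, h2⟩
      have := Finset.le_max' (S.filter (· < v)) u (Finset.mem_filter.2 ⟨hu, h2⟩)
      omega

theorem mem_rightEnds {D S : Finset ℕ} {v : ℕ} :
    v ∈ rightEnds D S ↔ v ∈ S ∧ ∀ u ∈ S, v < u → ∃ w ∈ D \ S, v < w ∧ w < u := by
  unfold rightEnds
  rw [Finset.mem_filter]
  refine and_congr_right fun hv => ⟨?_, fun h => ?_⟩
  · rintro (h | ⟨u, hu, -, -, ⟨w, hw, huw, hwv⟩, hn⟩) u' hu' hlt
    · have := h u' hu'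
      omega
    · refine ⟨w, hw, huw, ?_⟩
      by_contra hc
      exact hn ⟨u', hu', hlt, by omega⟩
  · by_cases hmax : ∀ u ∈ S, u ≤ v
    · exact Or.inl hmax
    · right
      push Not at hmax
      have hne : (S.filter (v < ·)).Nonempty := by
        obtain ⟨u, hu, huv⟩ := hmax
        exact ⟨u, Finset.mem_filter.2 ⟨hu, huv⟩⟩
      have hm := Finset.mem_filter.1 (Finset.min'_mem _ hne)
      refine ⟨_, hm.1, hv, hm.1, h _ hm.1 hm.2, ?_⟩
      rintro ⟨u, hu, h1, h2⟩
      have := Finset.min'_le (S.filter (v < ·)) u (Finset.mem_filter.2 ⟨hu, h1⟩)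
      omega

/-- Every left end except the minimum is the right component of a hole. -/
theorem numHoles_bound {D S : Finset ℕ} (hS : S.Nonempty) :
    (leftEnds D S).card ≤ numHoles D S + 1 := by
  have : leftEnds D S ⊆ insert (S.min' hS)
      (((S ×ˢ S).filter fun p => IsHole D S p.1 p.2).image Prod.snd) := by
    intro v hv
    rw [leftEnds, Finset.mem_filter] at hv
    obtain ⟨hv, h | ⟨u, hu, h⟩⟩ := hv
    · exact Finset.mem_insert.2 (Or.inl (le_antisymm (h _ (Finset.min'_mem _ _))
        (Finset.min'_le _ _ hv)))
    · refine Finset.mem_insert_of_mem (Finset.mem_image.2 ⟨(u, v), ?_, rfl⟩)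
      rw [Finset.mem_filter, Finset.mem_product]
      exact ⟨⟨hu, hv⟩, h⟩
  refine (Finset.card_le_card this).trans ((Finset.card_insert_le _ _).trans ?_)
  exact Nat.add_le_add_right Finset.card_image_le _

/-! ### Intervals after appending a new largest value -/

section insert

variable {D S : Finset ℕ} {v : ℕ} (hD : ∀ u ∈ D, u < v) (hS : S ⊆ D)

include hD hS

theorem leftEnds_insert_of_notMem : leftEnds (insert v D) S = leftEnds D S := by
  ext w
  rw [mem_leftEnds, mem_leftEnds]
  refine and_congr_right fun hw => forall_congr' fun u => forall_congr' fun _ =>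
    forall_congr' fun _ => exists_congr fun z => ?_
  have := hD w (hS hw)
  simp only [Finset.mem_sdiff, Finset.mem_insert]
  constructor
  · rintro ⟨⟨rfl | h, h'⟩, h1, h2⟩
    · omega
    · exact ⟨⟨h, h'⟩, h1, h2⟩
  · rintro ⟨⟨h, h'⟩, h1, h2⟩
    exact ⟨⟨Or.inr h, h'⟩, h1, h2⟩

theorem rightEnds_insert_of_notMem : rightEnds (insert v D) S = rightEnds D S := by
  ext w
  rw [mem_rightEnds, mem_rightEnds]
  refine and_congr_right fun _ => forall_congr' fun u => forall_congr' fun hu =>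
    forall_congr' fun _ => exists_congr fun z => ?_
  have := hD u (hS hu)
  simp only [Finset.mem_sdiff, Finset.mem_insert]
  constructor
  · rintro ⟨⟨rfl | h, h'⟩, h1, h2⟩
    · omega
    · exact ⟨⟨h, h'⟩, h1, h2⟩
  · rintro ⟨⟨h, h'⟩, h1, h2⟩
    exact ⟨⟨Or.inr h, h'⟩, h1, h2⟩

theorem intervals_insert_of_notMem : intervals (insert v D) S = intervals D S := by
  rw [intervals, intervals, leftEnds_insert_of_notMem hD hS, rightEnds_insert_of_notMem hD hS]

omit hS in
theorem insert_sdiff_insert_max : insert v D \ insert v S = D \ S := by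
  ext w
  simp only [Finset.mem_sdiff, Finset.mem_insert, not_or]
  constructor
  · rintro ⟨h | h, h1, h2⟩
    · exact absurd h h1
    · exact ⟨h, h2⟩
  · rintro ⟨h, h2⟩
    exact ⟨Or.inr h, (hD w h).ne, h2⟩

theorem mem_leftEnds_insert {w : ℕ} : w ∈ leftEnds (insert v D) (insert v S) ↔
    w ∈ leftEnds D S ∨ (w = v ∧ ∀ u ∈ S, ∃ z ∈ D \ S, u < z) := by
  rw [mem_leftEnds, mem_leftEnds, insert_sdiff_insert_max hD]
  constructor
  · rintro ⟨hw, h⟩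
    rcases Finset.mem_insert.1 hw with rfl | hw
    · refine Or.inr ⟨rfl, fun u hu => ?_⟩
      obtain ⟨z, hz, h1, h2⟩ := h u (Finset.mem_insert_of_mem hu) (hD u (hS hu))
      exact ⟨z, hz, h1⟩
    · exact Or.inl ⟨hw, fun u hu => h u (Finset.mem_insert_of_mem hu)⟩
  · rintro (⟨hw, h⟩ | ⟨rfl, h⟩)
    · refine ⟨Finset.mem_insert_of_mem hw, fun u hu hlt => ?_⟩
      rcases Finset.mem_insert.1 hu with rfl | hu
      · have := hD w (hS hw)
        omega
      · exact h u hu hlt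
    · refine ⟨Finset.mem_insert_self _ _, fun u hu hlt => ?_⟩
      rcases Finset.mem_insert.1 hu with rfl | hu
      · omega
      · obtain ⟨z, hz, h1⟩ := h u hu
        exact ⟨z, hz, h1, hD z (Finset.mem_sdiff.1 hz).1⟩

theorem mem_rightEnds_insert {w : ℕ} : w ∈ rightEnds (insert v D) (insert v S) ↔
    (w ∈ rightEnds D S ∧ ∃ z ∈ D \ S, w < z) ∨ w = v := by
  rw [mem_rightEnds, mem_rightEnds, insert_sdiff_insert_max hD]
  constructor
  · rintro ⟨hw, h⟩
    rcases Finset.mem_insert.1 hw with rfl | hw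
    · exact Or.inr rfl
    · refine Or.inl ⟨⟨hw, fun u hu => h u (Finset.mem_insert_of_mem hu)⟩, ?_⟩
      obtain ⟨z, hz, h1, h2⟩ := h v (Finset.mem_insert_self _ _) (hD w (hS hw))
      exact ⟨z, hz, h1⟩
  · rintro (⟨⟨hw, h⟩, z, hz, h1⟩ | rfl)
    · refine ⟨Finset.mem_insert_of_mem hw, fun u hu hlt => ?_⟩
      rcases Finset.mem_insert.1 hu with rfl | hu
      · exact ⟨z, hz, h1, hD z (Finset.mem_sdiff.1 hz).1⟩
      · exact h u hu hlt
    · refine ⟨Finset.mem_insert_self _ _, fun u hu hlt => ?_⟩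
      rcases Finset.mem_insert.1 hu with rfl | hu
      · omega
      · have := hD u (hS hu)
        omega

theorem leftEnds_insert_new (hnew : ∀ u ∈ S, ∃ z ∈ D \ S, u < z) :
    leftEnds (insert v D) (insert v S) = insert v (leftEnds D S) := by
  ext w
  rw [mem_leftEnds_insert hD hS, Finset.mem_insert, or_comm]
  exact or_congr_left (and_iff_left hnew)

theorem rightEnds_insert_new (hnew : ∀ u ∈ S, ∃ z ∈ D \ S, u < z) :
    rightEnds (insert v D) (insert v S) = insert v (rightEnds D S) := by
  ext w
  rw [mem_rightEnds_insert hD hS, Finset.mem_insert, or_comm]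
  exact or_congr_right (and_iff_left_of_imp fun h => hnew w (mem_rightEnds.1 h).1)

/-- By `hnew`, either `S` is empty or the last value before `v` is missing from `S`; so `v` opens an
interval of its own. -/
theorem intervals_insert_new (hc : (leftEnds D S).card = (rightEnds D S).card)
    (hnew : ∀ u ∈ S, ∃ z ∈ D \ S, u < z) :
    intervals (insert v D) (insert v S) = intervals D S ++ [(v, v)] := by
  unfold intervals
  rw [leftEnds_insert_new hD hS hnew, rightEnds_insert_new hD hS hnew, sort_insert_max,
    sort_insert_max, List.zip_append]
  · rfl
  · rw [Finset.length_sort, Finset.length_sort, hc]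
  · exact fun b hb => hD b (hS (mem_rightEnds.1 hb).1)
  · exact fun b hb => hD b (hS (mem_leftEnds.1 hb).1)

variable {y : ℕ} (hyS : y ∈ S) (hy : ∀ u ∈ D, u ≤ y)

include hyS hy

theorem leftEnds_insert_ext : leftEnds (insert v D) (insert v S) = leftEnds D S := by
  ext w
  rw [mem_leftEnds_insert hD hS]
  refine or_iff_left ?_
  rintro ⟨-, h⟩
  obtain ⟨z, hz, hlt⟩ := h y hyS
  have := hy z (Finset.mem_sdiff.1 hz).1
  omega

omit hD in
theorem rightEnds_eq_insert_erase : rightEnds D S = insert y ((rightEnds D S).erase y) := by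
  refine (Finset.insert_erase (mem_rightEnds.2 ⟨hyS, fun u hu hlt => ?_⟩)).symm
  have := hy u (hS hu)
  omega

theorem rightEnds_insert_ext :
    rightEnds (insert v D) (insert v S) = insert v ((rightEnds D S).erase y) := by
  ext w
  rw [mem_rightEnds_insert hD hS, Finset.mem_insert, or_comm, Finset.mem_erase]
  refine or_congr_right ⟨?_, ?_⟩
  · rintro ⟨h, z, hz, hlt⟩
    have := hy z (Finset.mem_sdiff.1 hz).1
    exact ⟨by omega, h⟩
  · rintro ⟨hne, h⟩
    refine ⟨h, ?_⟩
    obtain ⟨hw, h⟩ := mem_rightEnds.1 h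
    have := hy w (hS hw)
    obtain ⟨z, hz, h1, -⟩ := h y hyS (by omega)
    exact ⟨z, hz, h1⟩

/-- The last value `y` before `v` lies in `S` and closes the last interval; appending `v` only moves
this right end. -/
theorem intervals_insert_ext (hc : (leftEnds D S).card = (rightEnds D S).card) :
    ∃ I l, intervals D S = I ++ [(l, y)] ∧
      intervals (insert v D) (insert v S) = I ++ [(l, v)] := by
  have h1 := rightEnds_eq_insert_erase hS hyS hy
  have hlt : ∀ b ∈ (rightEnds D S).erase y, b < y := by
    intro b hb
    rw [Finset.mem_erase] at hb
    have := hy b (hS (mem_rightEnds.1 hb.2).1)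
    omega
  have h2 := sort_insert_max hlt
  have h3 : (insert v ((rightEnds D S).erase y)).sort (· ≤ ·) =
      ((rightEnds D S).erase y).sort (· ≤ ·) ++ [v] :=
    sort_insert_max fun b hb => (hlt b hb).trans (hD y (hS hyS))
  rw [← h1] at h2
  have hlen : ((leftEnds D S).sort (· ≤ ·)).length =
      (((rightEnds D S).erase y).sort (· ≤ ·)).length + 1 := by
    rw [Finset.length_sort, hc, ← Finset.length_sort (s := rightEnds D S) (· ≤ ·), h2]
    simp
  obtain ⟨l₀, l, hl⟩ : ∃ l₀ l, (leftEnds D S).sort (· ≤ ·) = l₀ ++ [l] := by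
    refine ⟨_, _, (List.dropLast_append_getLast (l := (leftEnds D S).sort (· ≤ ·)) ?_).symm⟩
    intro h
    rw [h] at hlen
    simp at hlen
  have hlen' : l₀.length = (((rightEnds D S).erase y).sort (· ≤ ·)).length := by
    rw [hl] at hlen
    simpa using hlen
  refine ⟨l₀.zip (((rightEnds D S).erase y).sort (· ≤ ·)), l, ?_, ?_⟩
  · rw [intervals, h2, hl, List.zip_append hlen']
    rfl
  · rw [intervals, rightEnds_insert_ext hD hS hyS hy, leftEnds_insert_ext hD hS hyS hy, h3, hl,
      List.zip_append hlen']
    rfl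

end insert

/-- The intervals of `S` in `D` are disjoint, ordered from left to right, and their union is `S`. -/
structure IntervalsSpec (D S : Finset ℕ) : Prop where
  card : (leftEnds D S).card = (rightEnds D S).card
  mem : ∀ a ∈ intervals D S, a.1 ∈ S ∧ a.2 ∈ S ∧ a.1 ≤ a.2
  pairwise : (intervals D S).Pairwise fun a b => a.2 < b.1
  cover : ∀ v ∈ D, v ∈ S ↔ ∃ a ∈ intervals D S, a.1 ≤ v ∧ v ≤ a.2

theorem intervals_empty (D : Finset ℕ) : intervals D ∅ = [] := by
  simp [intervals, leftEnds, rightEnds]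

/-- When the values of `D` arrive in increasing order, the list of intervals changes at most at its
end. -/
theorem intervalsSpec {D S : Finset ℕ} (hS : S ⊆ D) : IntervalsSpec D S := by
  induction D using Finset.induction_on_max generalizing S with
  | empty =>
    obtain rfl := Finset.subset_empty.1 hS
    constructor <;> simp [intervals, leftEnds, rightEnds]
  | insert v D hD ih =>
    have hvD : v ∉ D := fun h => lt_irrefl _ (hD v h)
    by_cases hv : v ∈ S
    · obtain ⟨S₀, hS₀, rfl⟩ : ∃ S₀ ⊆ D, S = insert v S₀ := by
        refine ⟨S.erase v, ?_, (Finset.insert_erase hv).symm⟩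
        rwa [← Finset.subset_insert_iff]
      have hvS : v ∉ S₀ := fun h => hvD (hS₀ h)
      obtain ⟨hc, hm, hp, hcov⟩ := ih hS₀
      by_cases hnew : ∀ u ∈ S₀, ∃ z ∈ D \ S₀, u < z
      · have hI := intervals_insert_new hD hS₀ hc hnew
        refine ⟨?_, ?_, ?_, ?_⟩
        · rw [leftEnds_insert_new hD hS₀ hnew, rightEnds_insert_new hD hS₀ hnew,
            Finset.card_insert_of_notMem, Finset.card_insert_of_notMem, hc]
          · exact fun h => hvS (mem_rightEnds.1 h).1
          · exact fun h => hvS (mem_leftEnds.1 h).1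
        · intro a ha
          rw [hI, List.mem_append, List.mem_singleton] at ha
          rcases ha with ha | rfl
          · obtain ⟨h1, h2, h3⟩ := hm a ha
            exact ⟨Finset.mem_insert_of_mem h1, Finset.mem_insert_of_mem h2, h3⟩
          · exact ⟨Finset.mem_insert_self _ _, Finset.mem_insert_self _ _, le_rfl⟩
        · rw [hI, List.pairwise_append]
          refine ⟨hp, List.pairwise_singleton _ _, fun a ha b hb => ?_⟩
          rw [List.mem_singleton] at hb
          subst hb
          exact hD _ (hS₀ (hm a ha).2.1)
        · intro w hw
          rw [hI]
          simp only [List.mem_append, List.mem_singleton]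
          rcases Finset.mem_insert.1 hw with rfl | hw
          · exact iff_of_true (Finset.mem_insert_self _ _) ⟨(w, w), Or.inr rfl, le_rfl, le_rfl⟩
          · have hwv := hD w hw
            rw [Finset.mem_insert, or_iff_right hwv.ne, hcov w hw]
            constructor
            · rintro ⟨a, ha, h⟩
              exact ⟨a, Or.inl ha, h⟩
            · rintro ⟨a, ha | rfl, h⟩
              · exact ⟨a, ha, h⟩
              · exact absurd h.1 (not_le.2 hwv)
      -- Some element of `S₀` has no missing value beyond it, so the largest value `y` of `D` lies
      -- in `S₀` and its interval is extended.
      · push Not at hnew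
        obtain ⟨u, hu, hnew⟩ := hnew
        have hne : D.Nonempty := ⟨u, hS₀ hu⟩
        obtain ⟨y, hyD, hy⟩ : ∃ y ∈ D, ∀ w ∈ D, w ≤ y :=
          ⟨D.max' hne, D.max'_mem hne, fun w hw => D.le_max' w hw⟩
        have hyS : y ∈ S₀ := by
          by_contra h
          have := hnew y (Finset.mem_sdiff.2 ⟨hyD, h⟩)
          have := hy u (hS₀ hu)
          obtain rfl : u = y := by omega
          exact h hu
        obtain ⟨I, l, hI, hI'⟩ := intervals_insert_ext hD hS₀ hyS hy hc
        have hyv := hD y hyD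
        rw [hI] at hm hp hcov
        refine ⟨?_, ?_, ?_, ?_⟩
        · rw [leftEnds_insert_ext hD hS₀ hyS hy, rightEnds_insert_ext hD hS₀ hyS hy, hc,
            Finset.card_insert_of_notMem, Finset.card_erase_of_mem]
          · have : 0 < (rightEnds D S₀).card := by
              rw [rightEnds_eq_insert_erase hS₀ hyS hy]
              exact Finset.card_pos.2 ⟨y, Finset.mem_insert_self _ _⟩
            omega
          · rw [rightEnds_eq_insert_erase hS₀ hyS hy]
            exact Finset.mem_insert_self _ _
          · exact fun h => hvS (mem_rightEnds.1 (Finset.mem_of_mem_erase h)).1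
        · intro a ha
          rw [hI', List.mem_append, List.mem_singleton] at ha
          rcases ha with ha | rfl
          · obtain ⟨h1, h2, h3⟩ := hm a (List.mem_append_left _ ha)
            exact ⟨Finset.mem_insert_of_mem h1, Finset.mem_insert_of_mem h2, h3⟩
          · obtain ⟨h1, h2, h3⟩ := hm (l, y) (by simp)
            exact ⟨Finset.mem_insert_of_mem h1, Finset.mem_insert_self _ _, h3.trans hyv.le⟩
        · rw [hI']
          rw [List.pairwise_append] at hp ⊢
          refine ⟨hp.1, List.pairwise_singleton _ _, fun a ha b hb => ?_⟩
          rw [List.mem_singleton] at hb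
          subst hb
          exact hp.2.2 a ha (l, y) (by simp)
        · intro w hw
          rw [hI']
          simp only [List.mem_append, List.mem_singleton] at hcov ⊢
          rcases Finset.mem_insert.1 hw with rfl | hw
          · refine iff_of_true (Finset.mem_insert_self _ _) ⟨(l, w), Or.inr rfl, ?_, le_rfl⟩
            exact (hm (l, y) (by simp)).2.2.trans hyv.le
          · have hwv := hD w hw
            rw [Finset.mem_insert, or_iff_right hwv.ne, hcov w hw]
            have hwy := hy w hw
            constructor
            · rintro ⟨a, ha | rfl, h⟩
              · exact ⟨a, Or.inl ha, h⟩
              · exact ⟨(l, v), Or.inr rfl, h.1, hwv.le⟩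
            · rintro ⟨a, ha | rfl, h⟩
              · exact ⟨a, Or.inl ha, h⟩
              · exact ⟨(l, y), Or.inr rfl, h.1, hwy⟩
    · have hS₀ : S ⊆ D := fun w hw => by
        rcases Finset.mem_insert.1 (hS hw) with rfl | h
        · exact absurd hw hv
        · exact h
      have hI := intervals_insert_of_notMem hD hS₀
      obtain ⟨hc, hm, hp, hcov⟩ := ih hS₀
      refine ⟨?_, by rwa [hI], by rwa [hI], ?_⟩
      · rw [leftEnds_insert_of_notMem hD hS₀, rightEnds_insert_of_notMem hD hS₀, hc]
      · intro w hw
        rw [hI]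
        rcases Finset.mem_insert.1 hw with rfl | hw
        · refine iff_of_false hv ?_
          rintro ⟨a, ha, -, h2⟩
          have := hD _ (hS₀ (hm a ha).2.1)
          omega
        · exact hcov w hw

theorem IntervalsSpec.length {D S : Finset ℕ} (h : IntervalsSpec D S) :
    (intervals D S).length = (leftEnds D S).card := by
  simp [intervals, ← h.card]

/-! ### Ranks -/

/-- The position of `v` in `D`, from `1`. -/
def rk (D : Finset ℕ) (v : ℕ) : ℕ := (D.sort (· ≤ ·)).idxOf v + 1

/-- The value at the position `p`. -/
def val (D : Finset ℕ) (p : ℕ) : ℕ := (D.sort (· ≤ ·)).getD (p - 1) 0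

section rank

variable {D : Finset ℕ}

theorem rk_le {v : ℕ} (hv : v ∈ D) : rk D v ≤ D.card := by
  have := List.idxOf_lt_length_iff.2 ((Finset.mem_sort (· ≤ ·)).2 hv)
  rw [Finset.length_sort] at this
  exact this

theorem one_le_rk (v : ℕ) : 1 ≤ rk D v := Nat.le_add_left _ _

theorem val_rk {v : ℕ} (hv : v ∈ D) : val D (rk D v) = v := by
  have := List.idxOf_lt_length_iff.2 ((Finset.mem_sort (· ≤ ·)).2 hv)
  rw [val, rk, Nat.add_sub_cancel, List.getD_eq_getElem _ _ this, List.getElem_idxOf]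

theorem val_eq {p : ℕ} (h₁ : 1 ≤ p) (h₂ : p ≤ D.card) :
    val D p = (D.sort (· ≤ ·))[p - 1]'(by rw [Finset.length_sort]; omega) := by
  rw [val, List.getD_eq_getElem]

theorem val_mem {p : ℕ} (h₁ : 1 ≤ p) (h₂ : p ≤ D.card) : val D p ∈ D := by
  rw [val_eq h₁ h₂, ← Finset.mem_sort (· ≤ ·)]
  exact List.getElem_mem _

theorem rk_val {p : ℕ} (h₁ : 1 ≤ p) (h₂ : p ≤ D.card) : rk D (val D p) = p := by
  rw [val_eq h₁ h₂, rk, List.Nodup.idxOf_getElem (Finset.sort_nodup _ _)]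
  omega

theorem val_lt_val {p q : ℕ} (h₁ : 1 ≤ p) (h₂ : p < q) (h₃ : q ≤ D.card) : val D p < val D q := by
  rw [val_eq h₁ (by omega), val_eq (by omega) h₃]
  exact (Finset.sortedLT_sort D).getElem_lt_getElem_of_lt (by omega)

theorem rk_lt_rk {u v : ℕ} (hu : u ∈ D) (hv : v ∈ D) : rk D u < rk D v ↔ u < v := by
  constructor
  · intro h
    have := val_lt_val (one_le_rk u) h (rk_le hv)
    rwa [val_rk hu, val_rk hv] at this
  · intro h
    by_contra hn
    rcases Nat.eq_or_lt_of_le (not_lt.1 hn) with he | hl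
    · have := congrArg (val D) he
      rw [val_rk hu, val_rk hv] at this
      omega
    · have := val_lt_val (one_le_rk v) hl (rk_le hu)
      rw [val_rk hu, val_rk hv] at this
      omega

theorem rk_le_rk {u v : ℕ} (hu : u ∈ D) (hv : v ∈ D) : rk D u ≤ rk D v ↔ u ≤ v := by
  rw [← not_lt, ← not_lt, rk_lt_rk hv hu]

/-- The elements of `A` among the first `p` elements of `D`. -/
def pre (D A : Finset ℕ) (p : ℕ) : Finset ℕ := A.filter fun v => rk D v ≤ p

theorem pre_zero (A : Finset ℕ) : pre D A 0 = ∅ :=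
  Finset.filter_eq_empty_iff.2 fun v _ => by have := one_le_rk (D := D) v; omega

theorem pre_card {A : Finset ℕ} (hA : A ⊆ D) : pre D A D.card = A :=
  Finset.filter_true_of_mem fun _ hv => rk_le (hA hv)

theorem pre_subset_pre {A A' : Finset ℕ} (h : A ⊆ A') (p : ℕ) : pre D A p ⊆ pre D A' p :=
  Finset.filter_subset_filter _ h

theorem lt_of_mem_pre {A : Finset ℕ} (hA : A ⊆ D) {p : ℕ} (hp : p < D.card) :
    ∀ u ∈ pre D A p, u < val D (p + 1) := by
  intro u hu
  obtain ⟨hu, h⟩ := Finset.mem_filter.1 hu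
  have := val_lt_val (D := D) (one_le_rk u) (show rk D u < p + 1 by omega) (by omega)
  rwa [val_rk (hA hu)] at this

theorem pre_succ_of_mem {A : Finset ℕ} (hA : A ⊆ D) {p : ℕ} (hp : p < D.card)
    (h : val D (p + 1) ∈ A) : pre D A (p + 1) = insert (val D (p + 1)) (pre D A p) := by
  ext u
  simp only [pre, Finset.mem_filter, Finset.mem_insert]
  constructor
  · rintro ⟨hu, hr⟩
    rcases Nat.eq_or_lt_of_le hr with hr | hr
    · rw [← hr, val_rk (hA hu)]
      exact Or.inl rfl
    · exact Or.inr ⟨hu, by omega⟩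
  · rintro (rfl | ⟨hu, hr⟩)
    · exact ⟨h, by rw [rk_val (by omega) (by omega)]⟩
    · exact ⟨hu, by omega⟩

theorem pre_succ_of_notMem {A : Finset ℕ} (hA : A ⊆ D) {p : ℕ}
    (h : val D (p + 1) ∉ A) : pre D A (p + 1) = pre D A p := by
  ext u
  simp only [pre, Finset.mem_filter]
  refine and_congr_right fun hu => ⟨fun hr => ?_, fun hr => by omega⟩
  by_contra hn
  have : rk D u = p + 1 := by omega
  rw [← this, val_rk (hA hu)] at h
  exact h hu

theorem card_pre_le {A : Finset ℕ} (hA : A ⊆ D) (p : ℕ) : (pre D A p).card ≤ p := by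
  have : (pre D A p).card = ((pre D A p).image (rk D)).card := by
    refine (Finset.card_image_of_injOn fun u hu v hv h => ?_).symm
    have := congrArg (val D) h
    rwa [val_rk (hA (Finset.mem_filter.1 hu).1), val_rk (hA (Finset.mem_filter.1 hv).1)] at this
  rw [this]
  refine (Finset.card_le_card (t := Finset.Icc 1 p) fun q hq => ?_).trans (by simp)
  obtain ⟨u, hu, rfl⟩ := Finset.mem_image.1 hq
  exact Finset.mem_Icc.2 ⟨one_le_rk u, (Finset.mem_filter.1 hu).2⟩

end rank

end AtMostNValue

/-! ## Supported values -/

namespace AtMostNValue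

namespace Instance

variable (I : Instance)

/-- `S` hits all domains that do not contain `v`. -/
def HitsBut (v : ℕ) (S : Finset ℕ) : Prop := ∀ y, v ∉ I.dom y → ∃ w ∈ S, w ∈ I.dom y

/-- The value `v` is part of a small hitting set. -/
def Good (v : ℕ) : Prop := ∃ S : Finset ℕ, S.card < I.N.toNat ∧ I.HitsBut v S

variable {I}

/-- From a legal instantiation, remove `v` from the values used. Conversely, assign `v` wherever
possible and a hitting point elsewhere. The inequality in `Good` is strict because `v` itself is one
of the `N` values. -/
theorem supports_iff {x : Fin I.n} {v : ℕ} (hv : v ∈ I.dom x) : I.Supports x v ↔ I.Good v := by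
  constructor
  · rintro ⟨α, ⟨hα, hN⟩, rfl⟩
    refine ⟨(Finset.univ.image α).erase (α x), ?_, fun y hy => ⟨α y, ?_, hα y⟩⟩
    · have hm : α x ∈ Finset.univ.image α := Finset.mem_image_of_mem _ (Finset.mem_univ _)
      rw [Finset.card_erase_of_mem hm]
      have := Finset.card_pos.2 ⟨_, hm⟩
      omega
    · refine Finset.mem_erase.2 ⟨fun h => hy (h ▸ hα y), ?_⟩
      exact Finset.mem_image_of_mem _ (Finset.mem_univ _)
  · rintro ⟨S, hS, h⟩
    have : ∀ y, ∃ w ∈ insert v S, w ∈ I.dom y ∧ (v ∈ I.dom y → w = v) := by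
      intro y
      by_cases hy : v ∈ I.dom y
      · exact ⟨v, Finset.mem_insert_self _ _, hy, fun _ => rfl⟩
      · obtain ⟨w, hw, hw'⟩ := h y hy
        exact ⟨w, Finset.mem_insert_of_mem hw, hw', fun h => absurd h hy⟩
    choose α h1 h2 h3 using this
    refine ⟨α, ⟨h2, ?_⟩, h3 x hv⟩
    have hc : (Finset.univ.image α).card ≤ (insert v S).card := by
      refine Finset.card_le_card fun w hw => ?_
      obtain ⟨y, -, rfl⟩ := Finset.mem_image.1 hw
      exact h1 y
    have := Finset.card_insert_le v S
    omega

/-- Values that occur in no domain are never removed, hence the implication. -/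
theorem mem_enforceHAC_D {v : ℕ} :
    v ∈ I.enforceHAC.D ↔ v ∈ I.D ∧ ((∃ x, v ∈ I.dom x) → I.Good v) := by
  simp only [enforceHAC, Finset.mem_filter]
  refine and_congr_right fun _ => ?_
  constructor
  · rintro h ⟨x, hx⟩
    by_contra hg
    exact h ⟨x, hx, fun hs => hg ((supports_iff hx).1 hs)⟩
  · rintro h ⟨x, hx, hs⟩
    exact hs ((supports_iff hx).2 (h ⟨x, hx⟩))

/-- Support does not depend on the variable, so a value is removed from all domains that have it or
from none. -/
theorem enforceHAC_dom (hI : I.IsInput) (x : Fin I.n) :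
    I.enforceHAC.dom x = I.dom x ∩ I.enforceHAC.D := by
  ext v
  rw [Finset.mem_inter, mem_enforceHAC_D]
  simp only [enforceHAC, Finset.mem_filter]
  refine and_congr_right fun hv => ?_
  rw [supports_iff hv]
  exact ⟨fun h => ⟨(hI.2 x).2 hv, fun _ => h⟩, fun h => h.2 ⟨x, hv⟩⟩

/-! ### Instances in terms of ranks -/

variable (I) in
/-- The intervals of the `x`-th domain. -/
def iv (x : Fin I.n) : List (ℕ × ℕ) := intervals I.D (I.dom x)

theorem length_iv_pos (hI : I.IsInput) (x : Fin I.n) : 0 < (I.iv x).length := by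
  obtain ⟨v, hv⟩ := (hI.2 x).1
  obtain ⟨a, ha, -⟩ := ((intervalsSpec (hI.2 x).2).cover v ((hI.2 x).2 hv)).1 hv
  exact List.length_pos_of_mem ha

theorem length_iv_le (hI : I.IsInput) (x : Fin I.n) :
    (I.iv x).length ≤ numHoles I.D (I.dom x) + 1 := by
  rw [iv, (intervalsSpec (hI.2 x).2).length]
  exact numHoles_bound (hI.2 x).1

/-- The intervals are stored by their ranks: those of `x` begin at the index `st x`, and `hl t`
intervals of the same domain follow the interval `t`. -/
structure Parsed (I : Instance) (st L R hl : ℕ → ℕ) : Prop where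
  hl_eq : ∀ (x : Fin I.n) (i : ℕ), i < (I.iv x).length → hl (st x + i) + i + 1 = (I.iv x).length
  L_eq : ∀ (x : Fin I.n) (i : ℕ) (h : i < (I.iv x).length), L (st x + i) = rk I.D (I.iv x)[i].1
  R_eq : ∀ (x : Fin I.n) (i : ℕ) (h : i < (I.iv x).length), R (st x + i) = rk I.D (I.iv x)[i].2

namespace Parsed

variable {st L R hl : ℕ → ℕ} (hP : I.Parsed st L R hl) (hI : I.IsInput)

include hP hI

theorem hl_st (x : Fin I.n) : hl (st x) + 1 = (I.iv x).length :=
  hP.hl_eq x 0 (length_iv_pos hI x)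

theorem bound (x : Fin I.n) (i : ℕ) (h : i ≤ hl (st x)) :
    1 ≤ L (st x + i) ∧ L (st x + i) ≤ R (st x + i) ∧ R (st x + i) ≤ I.D.card := by
  have hi : i < (I.iv x).length := by have := hP.hl_st hI x; omega
  obtain ⟨h1, h2, h3⟩ := (intervalsSpec (hI.2 x).2).mem _ (List.getElem_mem hi)
  rw [hP.L_eq x i hi, hP.R_eq x i hi]
  exact ⟨one_le_rk _, (rk_le_rk ((hI.2 x).2 h1) ((hI.2 x).2 h2)).2 h3, rk_le ((hI.2 x).2 h2)⟩

theorem R_lt_L (x : Fin I.n) (i j : ℕ) (hij : i < j) (h : j ≤ hl (st x)) :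
    R (st x + i) < L (st x + j) := by
  have hj : j < (I.iv x).length := by have := hP.hl_st hI x; omega
  have hi : i < (I.iv x).length := by omega
  obtain ⟨-, h2, -⟩ := (intervalsSpec (hI.2 x).2).mem _ (List.getElem_mem hi)
  obtain ⟨h3, -, -⟩ := (intervalsSpec (hI.2 x).2).mem _ (List.getElem_mem hj)
  rw [hP.L_eq x j hj, hP.R_eq x i hi, rk_lt_rk ((hI.2 x).2 h2) ((hI.2 x).2 h3)]
  exact List.pairwise_iff_getElem.1 (intervalsSpec (hI.2 x).2).pairwise i j hi hj hij

theorem mem_dom_iff (x : Fin I.n) {p : ℕ} (h₁ : 1 ≤ p) (h₂ : p ≤ I.D.card) :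
    val I.D p ∈ I.dom x ↔ ∃ i ≤ hl (st x), L (st x + i) ≤ p ∧ p ≤ R (st x + i) := by
  have hlen := hP.hl_st hI x
  have hv := val_mem (D := I.D) h₁ h₂
  have hs := intervalsSpec (hI.2 x).2
  have hD := (hI.2 x).2
  rw [hs.cover _ hv]
  constructor
  · rintro ⟨a, ha, h1, h2⟩
    obtain ⟨i, hi, rfl⟩ := List.getElem_of_mem ha
    obtain ⟨h3, h4, -⟩ := hs.mem _ ha
    have hi' : i < (I.iv x).length := hi
    refine ⟨i, by omega, ?_, ?_⟩
    · rw [hP.L_eq x i hi, ← rk_val (D := I.D) h₁ h₂]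
      exact (rk_le_rk (hD h3) hv).2 h1
    · rw [hP.R_eq x i hi, ← rk_val (D := I.D) h₁ h₂]
      exact (rk_le_rk hv (hD h4)).2 h2
  · rintro ⟨i, hi, h1, h2⟩
    have hi : i < (I.iv x).length := by omega
    obtain ⟨h3, h4, -⟩ := hs.mem _ (List.getElem_mem hi)
    rw [hP.L_eq x i hi, ← rk_val (D := I.D) h₁ h₂, rk_le_rk (hD h3) hv] at h1
    rw [hP.R_eq x i hi, ← rk_val (D := I.D) h₁ h₂, rk_le_rk hv (hD h4)] at h2
    exact ⟨_, List.getElem_mem hi, h1, h2⟩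

end Parsed

variable (I) in
/-- The hitting set problem that decides about the value of rank `v`. -/
def sys (v H : ℕ) (st L R hl sg nx la cn : ℕ → ℕ) : Sys where
  d := I.D.card
  H := H
  lim := I.N.toNat
  L := L
  R := R
  hl := hl
  sg := sg
  nx := nx
  la := la
  cn := cn
  F := {f | ∃ x : Fin I.n, hl (st x) = 0 ∧ val I.D v ∉ I.dom x ∧ f = (L (st x), R (st x))}
  hv := fun t => ∃ (x : Fin I.n) (i : ℕ), 0 < hl (st x) ∧ i ≤ hl (st x) ∧ t = st x + i

/-- `ts` lists the domains with holes that do not contain the value of rank `v`. -/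
structure Tracks (I : Instance) (v H : ℕ) (st hl ts : ℕ → ℕ) : Prop where
  mem : ∀ x : Fin I.n, 0 < hl (st x) → val I.D v ∉ I.dom x → ∃ j < H, ts j = st x
  of_lt : ∀ j < H, ∃ x : Fin I.n, 0 < hl (st x) ∧ val I.D v ∉ I.dom x ∧ ts j = st x

/-- Solutions are translated by `val` and `rk`. Position `0` precedes every rank, so initially all
sets have to be hit. -/
theorem tot_iff_good {v H : ℕ} {st L R hl sg nx la cn ts : ℕ → ℕ} (hI : I.IsInput)
    (hP : I.Parsed st L R hl) (hT : I.Tracks v H st hl ts) :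
    (I.sys v H st L R hl sg nx la cn).Tot 0 0 ts ↔ I.Good (val I.D v) := by
  have hDm : ∀ (x : Fin I.n) p, p ∈ (I.sys v H st L R hl sg nx la cn).Dm (st x) ↔
      ∃ i ≤ hl (st x), L (st x + i) ≤ p ∧ p ≤ R (st x + i) := by
    intro x p
    constructor
    · rintro ⟨u, h1, h2, h3⟩
      have h2' : u ≤ st x + hl (st x) := h2
      refine ⟨u - st x, by omega, ?_⟩
      rw [Nat.add_sub_cancel' h1]
      exact h3
    · rintro ⟨i, hi, h⟩
      exact ⟨st x + i, Nat.le_add_right _ _, Nat.add_le_add_left hi _, h⟩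
  constructor
  · rintro ⟨S, hS, h1, h2⟩
    refine ⟨S.image (val I.D), lt_of_le_of_lt Finset.card_image_le (Nat.zero_add S.card ▸ hS), ?_⟩
    intro y hy
    have key : ∃ q ∈ S, ∃ i ≤ hl (st y), L (st y + i) ≤ q ∧ q ≤ R (st y + i) := by
      rcases Nat.eq_zero_or_pos (hl (st y)) with h0 | h0
      · obtain ⟨q, hq, hq'⟩ := h1 (L (st y), R (st y)) ⟨y, h0, hy, rfl⟩ (hP.bound hI y 0 h0.ge).1
        exact ⟨q, hq, 0, h0.ge, hq'⟩
      · obtain ⟨j, hj, hjy⟩ := hT.mem y h0 hy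
        obtain ⟨q, hq, hq'⟩ := h2 j hj (by rw [hjy]; exact (hP.bound hI y 0 h0.le).1)
        rw [hjy] at hq'
        exact ⟨q, hq, (hDm y q).1 hq'⟩
    obtain ⟨q, hq, i, hi, hq'⟩ := key
    have := hP.bound hI y i hi
    exact ⟨_, Finset.mem_image_of_mem _ hq,
      (hP.mem_dom_iff hI y (by omega) (by omega)).2 ⟨i, hi, hq'⟩⟩
  · rintro ⟨S, hS, h⟩
    have key : ∀ y : Fin I.n, val I.D v ∉ I.dom y →
        ∃ q ∈ S.image (rk I.D), ∃ i ≤ hl (st y), L (st y + i) ≤ q ∧ q ≤ R (st y + i) := by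
      intro y hy
      obtain ⟨w, hw, hwy⟩ := h y hy
      refine ⟨_, Finset.mem_image_of_mem _ hw, ?_⟩
      have hwD := (hI.2 y).2 hwy
      rw [← hP.mem_dom_iff hI y (one_le_rk _) (rk_le hwD), val_rk hwD]
      exact hwy
    refine ⟨S.image (rk I.D), ?_, ?_, ?_⟩
    · rw [Nat.zero_add]
      exact lt_of_le_of_lt Finset.card_image_le hS
    · rintro f ⟨x, h0, hx, rfl⟩ -
      obtain ⟨q, hq, i, hi, hq'⟩ := key x hx
      obtain rfl : i = 0 := by omega
      exact ⟨q, hq, hq'⟩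
    · intro j hj _
      obtain ⟨x, h0, hx, hjx⟩ := hT.of_lt j hj
      obtain ⟨q, hq, hq'⟩ := key x hx
      rw [hjx]
      exact ⟨q, hq, (hDm x q).2 hq'⟩

end Instance

/-! ### Lists in arrays -/

/-- The list `l` is stored in the array `a` from the index `b` on. -/
def Holds (a : ℕ → ℕ) (b : ℕ) (l : List ℕ) : Prop := ∀ (i : ℕ) (h : i < l.length), a (b + i) = l[i]

theorem holds_nil (a : ℕ → ℕ) (b : ℕ) : Holds a b [] := fun i h => absurd h (Nat.not_lt_zero i)

theorem holds_append {a : ℕ → ℕ} {b : ℕ} {l l' : List ℕ} :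
    Holds a b (l ++ l') ↔ Holds a b l ∧ Holds a (b + l.length) l' := by
  constructor
  · intro h
    refine ⟨fun i hi => ?_, fun i hi => ?_⟩
    · rw [h i (by rw [List.length_append]; omega), List.getElem_append_left hi]
    · rw [add_assoc, h (l.length + i) (by rw [List.length_append]; omega),
        List.getElem_append_right (by omega)]
      simp
  · rintro ⟨h, h'⟩ i hi
    rw [List.length_append] at hi
    by_cases hl : i < l.length
    · rw [List.getElem_append_left hl, h i hl]
    · rw [List.getElem_append_right (by omega), ← h' (i - l.length) (by omega)]
      congr 1
      omega

theorem holds_cons {a : ℕ → ℕ} {b v : ℕ} {l : List ℕ} :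
    Holds a b (v :: l) ↔ a b = v ∧ Holds a (b + 1) l := by
  rw [← List.singleton_append, holds_append]
  refine and_congr ⟨fun h => h 0 (by simp), fun h i hi => ?_⟩ Iff.rfl
  simp only [List.length_singleton, Nat.lt_one_iff] at hi
  subst hi
  exact h

theorem Holds.congr {a a' : ℕ → ℕ} {b : ℕ} {l : List ℕ} (h : Holds a b l)
    (h' : ∀ i, b ≤ i → i < b + l.length → a' i = a i) : Holds a' b l :=
  fun i hi => (h' _ (by omega) (by omega)).trans (h i hi)

theorem Holds.update {a : ℕ → ℕ} {b j v : ℕ} {l : List ℕ} (h : Holds a b l)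
    (hj : j < b ∨ b + l.length ≤ j) : Holds (Function.update a j v) b l :=
  h.congr fun i h1 h2 => Function.update_of_ne (by omega) _ _

theorem flatMap_take_succ {α : Type*} (l : List α) (f : α → List ℕ) {k : ℕ} (hk : k < l.length) :
    (l.take (k + 1)).flatMap f = (l.take k).flatMap f ++ f l[k] := by
  rw [List.take_succ_eq_append_getElem hk, List.flatMap_append]
  simp

theorem flatMap_eq_take_append {α : Type*} (l : List α) (f : α → List ℕ) (k : ℕ) :
    l.flatMap f = (l.take k).flatMap f ++ (l.drop k).flatMap f := by
  rw [← List.flatMap_append, List.take_append_drop]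

namespace Instance

variable (I : Instance)

/-- The descriptions of the first `k` domains. -/
def encodeDoms (k : ℕ) : List ℕ :=
  ((List.finRange I.n).take k).flatMap fun x => encodeDom I.D (I.dom x)

theorem encodeDoms_zero : I.encodeDoms 0 = [] := by simp [encodeDoms]

theorem encodeDoms_succ {k : ℕ} (hk : k < I.n) :
    I.encodeDoms (k + 1) = I.encodeDoms k ++ encodeDom I.D (I.dom ⟨k, hk⟩) := by
  rw [encodeDoms, flatMap_take_succ _ _ (by simpa using hk)]
  simp [encodeDoms]

theorem encode_eq : I.encode =
    [I.n, I.D.card, I.N.toNat, (-I.N).toNat] ++ I.D.sort (· ≤ ·) ++ I.encodeDoms I.n := by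
  rw [encode, encodeDoms, List.take_of_length_le (by simp)]

theorem length_encodeDom (D S : Finset ℕ) :
    (encodeDom D S).length = 1 + 2 * (intervals D S).length := by
  simp [encodeDom, List.length_flatMap, add_comm, mul_comm]

theorem size_eq : I.size = 4 + I.D.card + (I.encodeDoms I.n).length := by
  rw [size, encode_eq]
  simp only [List.length_append, List.length_cons, List.length_nil, Finset.length_sort]

theorem length_encodeDoms_mono {k l : ℕ} (h : k ≤ l) :
    (I.encodeDoms k).length ≤ (I.encodeDoms l).length := by
  unfold encodeDoms
  have : ((List.finRange I.n).take k) = ((List.finRange I.n).take l).take k := by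
    rw [List.take_take, min_eq_left h]
  rw [this, flatMap_eq_take_append ((List.finRange I.n).take l) _ k, List.length_append]
  exact Nat.le_add_right _ _

/-- The input array holds the `k`-th domain. -/
theorem holds_encodeDom {a : ℕ → ℕ} (h : Holds a 0 I.encode) {k : ℕ} (hk : k < I.n) :
    Holds a (4 + I.D.card + (I.encodeDoms k).length) (encodeDom I.D (I.dom ⟨k, hk⟩)) := by
  rw [encode_eq, holds_append] at h
  have h2 := h.2
  rw [encodeDoms, flatMap_eq_take_append _ _ (k + 1), List.take_take, holds_append,
    min_eq_left (by omega)] at h2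
  have h3 := h2.1
  rw [show ((List.finRange I.n).take (k + 1)).flatMap (fun x => encodeDom I.D (I.dom x)) =
    I.encodeDoms (k + 1) from rfl, encodeDoms_succ I hk, holds_append] at h3
  have h4 := h3.2
  simp only [List.length_append, Finset.length_sort, List.length_cons, List.length_nil,
    Nat.zero_add, Nat.reduceAdd] at h4
  exact h4

end Instance

theorem holds_flatMap_iff {a : ℕ → ℕ} {b : ℕ} {l : List (ℕ × ℕ)}
    (h : Holds a b (l.flatMap fun p => [p.1, p.2])) {i : ℕ} (hi : i < l.length) :
    a (b + 2 * i) = l[i].1 ∧ a (b + 2 * i + 1) = l[i].2 := by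
  induction l generalizing b i with
  | nil => exact absurd hi (Nat.not_lt_zero _)
  | cons p l ih =>
    rw [List.flatMap_cons, List.cons_append, List.cons_append, List.nil_append, holds_cons,
      holds_cons] at h
    cases i with
    | zero => exact ⟨h.1, h.2.1⟩
    | succ i =>
      have := ih h.2.2 (i := i) (by simpa using hi)
      simp only [List.getElem_cons_succ]
      convert this using 3 <;> ring

end AtMostNValue

/-! ## The program -/

namespace WordRAM

@[simp] theorem State.reg_setReg (s : State) (r v r' : ℕ) :
    (s.setReg r v).reg r' = if r' = r then v else s.reg r' := Function.update_apply _ _ _ _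

@[simp] theorem State.arr_setReg (s : State) (r v : ℕ) : (s.setReg r v).arr = s.arr := rfl

@[simp] theorem State.reg_setArr (s : State) (a i v : ℕ) : (s.setArr a i v).reg = s.reg := rfl

@[simp] theorem State.arr_setArr (s : State) (a i v a' : ℕ) :
    (s.setArr a i v).arr a' = if a' = a then Function.update (s.arr a) i v else s.arr a' :=
  Function.update_apply _ _ _ _

attribute [simp] Prog.step Prog.Safe Exp.eval Op.eval

end WordRAM

namespace AtMostNValue

open WordRAM Exp Prog

/-! Registers: -/

notation "regN" => (0 : ℕ)
notation "regD" => (1 : ℕ)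
notation "regLim" => (2 : ℕ)
notation "regQ" => (3 : ℕ)
notation "regT" => (4 : ℕ)
notation "regX" => (5 : ℕ)
notation "regI" => (6 : ℕ)
notation "regCnt" => (7 : ℕ)
notation "regP" => (8 : ℕ)
notation "regV" => (9 : ℕ)
notation "regH" => (10 : ℕ)
notation "regAny" => (11 : ℕ)
notation "regOk" => (12 : ℕ)
notation "regTop" => (13 : ℕ)
notation "regSlot" => (14 : ℕ)
notation "regPos" => (15 : ℕ)
notation "regCost" => (16 : ℕ)
notation "regMin" => (17 : ℕ)
notation "regArg" => (18 : ℕ)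
notation "regJ" => (19 : ℕ)
notation "regGo" => (20 : ℕ)
notation "regG" => (21 : ℕ)
notation "regMinB" => (22 : ℕ)
notation "regArgB" => (23 : ℕ)
notation "regCostB" => (24 : ℕ)
notation "regKept" => (25 : ℕ)
notation "regOut" => (26 : ℕ)
notation "regPrev" => (27 : ℕ)
notation "regHead" => (28 : ℕ)
notation "regU" => (29 : ℕ)

/-! Arrays: -/

notation "arrIn" => (0 : ℕ)
notation "arrOut" => (1 : ℕ)
notation "arrRk" => (2 : ℕ)
notation "arrSt" => (3 : ℕ)
notation "arrL" => (4 : ℕ)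
notation "arrR" => (5 : ℕ)
notation "arrHl" => (6 : ℕ)
notation "arrMk" => (7 : ℕ)
notation "arrSg" => (8 : ℕ)
notation "arrPt" => (9 : ℕ)
notation "arrMm" => (10 : ℕ)
notation "arrNx" => (11 : ℕ)
notation "arrLa" => (12 : ℕ)
notation "arrCn" => (13 : ℕ)
notation "arrCu" => (14 : ℕ)
notation "arrPos" => (15 : ℕ)
notation "arrCost" => (16 : ℕ)
notation "arrKp" => (17 : ℕ)

/-- Increase a register. -/
def inc (r c : ℕ) : Prog := assign r (reg r ∔ lit c)

/-- The mark at `1` separates the start position `0` from all ranks. Cell `1` of the output, the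
number of values kept, is filled in later. -/
def readHeader : Prog :=
  assign regN (get arrIn (lit 0)) ;; assign regD (get arrIn (lit 1)) ;;
  assign regLim (get arrIn (lit 2)) ;; assign regQ (reg regD ∔ lit 4) ;;
  store arrMk (lit 1) (lit 1) ;; store arrOut (lit 0) (reg regN) ;;
  store arrOut (lit 2) (reg regLim) ;; store arrOut (lit 3) (get arrIn (lit 3))

/-- Compute the ranks of the values. -/
def readValue : Prog :=
  store arrRk (get arrIn (reg regI ∔ lit 4)) (reg regI ∔ lit 1) ;; inc regI 1

def readValues : Prog := loop (reg regI ≺ reg regD) readValue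

/-- Read an interval. Segments end where intervals of domains with holes begin or end. -/
def readInterval : Prog :=
  store arrL (reg regT) (get arrRk (get arrIn (reg regQ))) ;;
  store arrR (reg regT) (get arrRk (get arrIn (reg regQ ∔ lit 1))) ;;
  store arrHl (reg regT) (reg regCnt ⊖ (reg regI ∔ lit 1)) ;;
  ite (lit 1 ≺ reg regCnt)
    (store arrMk (get arrL (reg regT)) (lit 1) ;;
      store arrMk (get arrR (reg regT) ∔ lit 1) (lit 1)) skip ;;
  inc regQ 2 ;; inc regT 1 ;; inc regI 1

def readDomHead : Prog :=
  assign regCnt (get arrIn (reg regQ)) ;; inc regQ 1 ;; store arrSt (reg regX) (reg regT) ;;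
  store arrPt (reg regX) (reg regT) ;; assign regI (lit 0)

def readDom : Prog :=
  readDomHead ;; loop (reg regI ≺ reg regCnt) readInterval ;; inc regX 1

def readDoms : Prog := loop (reg regX ≺ reg regN) readDom

def numberSegment : Prog :=
  store arrSg (reg regP ∔ lit 1) (get arrSg (reg regP) ∔ get arrMk (reg regP ∔ lit 1)) ;;
  inc regP 1

def numberSegments : Prog := loop (reg regP ≺ reg regD) numberSegment

/-! For every value, the array `arrMm` gets the first right ends of intervals. -/

def resetMm : Prog :=
  assign regP (lit 0) ;;
  loop (reg regP ≺ reg regD) (inc regP 1 ;; store arrMm (reg regP) (reg regD ∔ lit 1))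

/-- Advance the pointer to the current interval. -/
def movePtr : Prog :=
  ite (get arrR (reg regU) ≺ reg regV) (ite (get arrHl (reg regU)) (inc regU 1) skip) skip

/-- The current interval decides whether the domain contains the value. If not, a domain with holes
is entered into row `0` of `arrCu`; one without holes competes for the first right end at its left
end. -/
def scanVar : Prog :=
  assign regU (get arrPt (reg regX)) ;; movePtr ;; store arrPt (reg regX) (reg regU) ;;
  ite ((get arrL (reg regU) ≺ reg regV ∔ lit 1) ⊠ (reg regV ≺ get arrR (reg regU) ∔ lit 1))
    (assign regAny (lit 1))
    (assign regU (get arrSt (reg regX)) ;;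
      ite (get arrHl (reg regU)) (store arrCu (reg regH) (reg regU) ;; inc regH 1)
        (ite (get arrR (reg regU) ≺ get arrMm (get arrL (reg regU)))
          (store arrMm (get arrL (reg regU)) (get arrR (reg regU))) skip)) ;;
  inc regX 1

def scanVars : Prog :=
  (assign regX (lit 0) ;; assign regH (lit 0) ;; assign regAny (lit 0)) ;;
  loop (reg regX ≺ reg regN) scanVar

/-- The tables are filled from right to left, so the entries at `regG` are final when they are used.
-/
def jumpStep : Prog :=
  ite (get arrMm (reg regP) ≺ get arrNx (reg regP)) (assign regG (get arrMm (reg regP)))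
    (assign regG (get arrNx (reg regP))) ;;
  assign regP (reg regP ⊖ lit 1) ;; store arrNx (reg regP) (reg regG) ;;
  ite ((reg regG ≺ reg regD ∔ lit 1) ⊠ (get arrSg (reg regG) ≐ get arrSg (reg regP)))
    (store arrLa (reg regP) (get arrLa (reg regG)) ;;
      store arrCn (reg regP) (get arrCn (reg regG) ∔ lit 1))
    (store arrLa (reg regP) (reg regP) ;; store arrCn (reg regP) (lit 0))

def jumps : Prog :=
  (store arrNx (reg regD) (reg regD ∔ lit 1) ;; store arrLa (reg regD) (reg regD) ;;
    store arrCn (reg regD) (lit 0) ;; assign regP (reg regD)) ;;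
  loop (reg regP) jumpStep

/-! The search. A subproblem consists of a position, a cost, and of the sets that are listed in a
row of the array `arrCu`. -/

def minStep : Prog :=
  assign regU (get arrCu (reg regSlot ⊠ reg regH ∔ reg regJ)) ;;
  ite ((reg regPos ≺ get arrL (reg regU)) ⊠ (get arrR (reg regU) ≺ reg regMin))
    (assign regMin (get arrR (reg regU)) ;; assign regArg (reg regJ)) skip ;;
  inc regJ 1

/-- A tie between the table and a set with holes goes to the table: a right end of a domain without
holes is a forced pick. -/
def pickStep : Prog :=
  assign regG (get arrNx (reg regPos)) ;;
  ite (reg regMin ≺ reg regG)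
    (assign regG (reg regMin) ;;
      ite (get arrHl (get arrCu (reg regSlot ⊠ reg regH ∔ reg regArg)))
        (assign regGo (lit 0)) skip)
    (ite (reg regD ≺ reg regG) (assign regGo (lit 0)) skip) ;;
  ite (reg regGo)
    (assign regCost (reg regCost ∔ lit 1 ∔ get arrCn (reg regG)) ;;
      assign regPos (get arrLa (reg regG))) skip

def greedyStep : Prog :=
  (assign regMin (reg regD ∔ lit 1) ;; assign regJ (lit 0)) ;;
  loop (reg regJ ≺ reg regH) minStep ;; pickStep

/-- The greedy algorithm, up to the next position where a decision is necessary. -/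
def greedy : Prog :=
  (assign regPos (get arrPos (reg regSlot)) ;; assign regCost (get arrCost (reg regSlot)) ;;
    assign regGo (lit 1)) ;;
  loop (reg regGo) greedyStep ;;
  (store arrPos (reg regSlot) (reg regPos) ;; store arrCost (reg regSlot) (reg regCost))

def copyStep : Prog :=
  store arrCu ((reg regTop ∔ lit 1) ⊠ reg regH ∔ reg regJ)
    (get arrCu (reg regTop ⊠ reg regH ∔ reg regJ)) ;;
  inc regJ 1

/-- Forget the first interval of a set. -/
def forget (e : Exp) : Prog := store arrCu e (get arrCu e ∔ lit 1)

/-- The copy in the upper row picks the decision point, while the original row forgets the interval.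
-/
def split : Prog :=
  assign regJ (lit 0) ;; loop (reg regJ ≺ reg regH) copyStep ;;
  (store arrPos (reg regTop ∔ lit 1) (reg regMin) ;;
    store arrCost (reg regTop ∔ lit 1) (reg regCost ∔ lit 1) ;;
    forget (reg regTop ⊠ reg regH ∔ reg regArg))

/-- The registers with suffix `B` describe where the lower, forgetting row stopped; the others
describe the upper, picking row. -/
def prune : Prog :=
  ite ((reg regMin ≐ reg regMinB) ⊠ (reg regMin ≺ reg regD ∔ lit 1))
    (ite (reg regCostB ≺ reg regCost) (forget ((reg regTop ∔ lit 1) ⊠ reg regH ∔ reg regArg))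
      (forget (reg regTop ⊠ reg regH ∔ reg regArgB))) skip ;;
  inc regTop 2

def branch : Prog :=
  split ;; greedy ;;
  (assign regMinB (reg regMin) ;; assign regArgB (reg regArg) ;; assign regCostB (reg regCost) ;;
    assign regSlot (reg regTop ∔ lit 1)) ;;
  greedy ;; prune

def searchStep : Prog :=
  (assign regTop (reg regTop ⊖ lit 1) ;; assign regSlot (reg regTop)) ;; greedy ;;
  ite (reg regD ≺ reg regMin) (ite (reg regCost ≺ reg regLim) (assign regOk (lit 1)) skip) branch

def search : Prog :=
  (store arrPos (lit 0) (lit 0) ;; store arrCost (lit 0) (lit 0) ;; assign regOk (lit 0) ;;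
    assign regTop (lit 1)) ;;
  loop (reg regTop) searchStep

/-- If no domain contains the value, it is kept whatever the search has found. -/
def decideValue : Prog :=
  ite (reg regAny) skip (assign regOk (lit 1)) ;;
  ite (reg regOk)
    (store arrKp (reg regV) (lit 1) ;;
      store arrOut (reg regKept ∔ lit 4) (get arrIn (reg regV ∔ lit 3)) ;; inc regKept 1 ;;
      store arrOut (lit 1) (reg regKept))
    (store arrKp (reg regV) (lit 0))

def testValue : Prog :=
  inc regV 1 ;; resetMm ;; scanVars ;; jumps ;; search ;; decideValue

def testValues : Prog := loop (reg regV ≺ reg regD) testValue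

/-! The output. -/

/-- `regPrev` records whether the last kept value belongs to the domain. A removed value leaves it
unchanged, since it cannot create a hole in the new instance. -/
def writeStep : Prog :=
  inc regV 1 ;; movePtr ;;
  ite (get arrKp (reg regV))
    (ite ((get arrL (reg regU) ≺ reg regV ∔ lit 1) ⊠ (reg regV ≺ get arrR (reg regU) ∔ lit 1))
      (ite (reg regPrev) (store arrOut (reg regOut ⊖ lit 1) (get arrIn (reg regV ∔ lit 3)))
        (store arrOut (reg regOut) (get arrIn (reg regV ∔ lit 3)) ;;
          store arrOut (reg regOut ∔ lit 1) (get arrIn (reg regV ∔ lit 3)) ;; inc regOut 2 ;;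
          inc regCnt 1 ;; store arrOut (reg regHead) (reg regCnt) ;; assign regPrev (lit 1)))
      (assign regPrev (lit 0))) skip

def writeDomHead : Prog :=
  assign regHead (reg regOut) ;; store arrOut (reg regOut) (lit 0) ;; inc regOut 1 ;;
  assign regCnt (lit 0) ;; assign regU (get arrSt (reg regX)) ;; assign regPrev (lit 0) ;;
  assign regV (lit 0)

def writeDom : Prog :=
  writeDomHead ;; loop (reg regV ≺ reg regD) writeStep ;; inc regX 1

def writeDoms : Prog :=
  (assign regOut (reg regKept ∔ lit 4) ;; assign regX (lit 0)) ;;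
  loop (reg regX ≺ reg regN) writeDom

/-- The program that enforces hyper arc consistency. -/
def enforce : Prog :=
  readHeader ;; readValues ;; readDoms ;; numberSegments ;; testValues ;; writeDoms

/-! ## The greedy algorithm -/

/-- The registers and arrays of `s` contain the problem `Y`. -/
structure SysAt (Y : Sys) (s : State) : Prop where
  d : s.reg regD = Y.d
  H : s.reg regH = Y.H
  lim : s.reg regLim = Y.lim
  L : s.arr arrL = Y.L
  R : s.arr arrR = Y.R
  hl : s.arr arrHl = Y.hl
  nx : s.arr arrNx = Y.nx
  la : s.arr arrLa = Y.la
  cn : s.arr arrCn = Y.cn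

theorem SysAt.frame {Y : Sys} {p : Prog} {s s' : State} (h : SysAt Y s) (hf : Frame p s s')
    (hr : ([regD, regH, regLim].all fun r => !p.wr r) = true)
    (ha : ([arrL, arrR, arrHl, arrNx, arrLa, arrCn].all fun a => !p.wa a) = true) :
    SysAt Y s' := by
  obtain ⟨h1, h2⟩ := hf.congr hr ha
  simp only [List.forall_mem_cons, List.not_mem_nil, false_imp_iff, implies_true, and_true] at h1 h2
  obtain ⟨a1, a2, a3⟩ := h1
  obtain ⟨b1, b2, b3, b4, b5, b6⟩ := h2
  exact ⟨a1 ▸ h.d, a2 ▸ h.H, a3 ▸ h.lim, b1 ▸ h.L, b2 ▸ h.R, b3 ▸ h.hl, b4 ▸ h.nx, b5 ▸ h.la,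
    b6 ▸ h.cn⟩

/-- The row `t` of the array `arrCu`. -/
def row (Y : Sys) (s : State) (t j : ℕ) : ℕ := s.arr arrCu (t * Y.H + j)

/-- Admissible subproblems. -/
structure SubOK (Y : Sys) (p c : ℕ) (ts : ℕ → ℕ) : Prop where
  le : p ≤ Y.d
  cost : c ≤ p
  hv : ∀ j < Y.H, Y.hv (ts j)
  settled : Y.Settled p

end AtMostNValue

namespace AtMostNValue

open WordRAM Exp Prog

set_option linter.unusedSimpArgs false

namespace Sys

variable {Y : Sys}

/-- A pick together with the subsequent jump enters a later segment: either `p` is settled and `g`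
is its successor, or a left end of a set with holes lies between `p` and `g`. -/
theorem WF.sub_pick (hY : Y.WF) {p c g : ℕ} {ts : ℕ → ℕ} (h : SubOK Y p c ts) (hpg : p < g)
    (hgd : g ≤ Y.d) (hF : ∀ f ∈ Y.F, p < f.1 → g ≤ f.2)
    (hT : ∀ j < Y.H, p < Y.L (ts j) → g ≤ Y.R (ts j))
    (hg : g = Y.nx p ∨ ∃ j < Y.H, p < Y.L (ts j) ∧ Y.R (ts j) = g ∧ Y.hl (ts j) = 0) :
    SubOK Y (Y.la g) (c + 1 + Y.cn g) ts ∧ p ≤ Y.la g ∧ Y.sg p < Y.sg (Y.la g) ∧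
      (Y.Tot c p ts ↔ Y.Tot (c + 1 + Y.cn g) (Y.la g) ts) := by
  obtain ⟨a1, a2, a3, a4, a5, a6⟩ := hY.tot_jump h.hv g hgd
  have hc := h.cost
  refine ⟨⟨a2, by omega, h.hv, a4⟩, by omega, ?_, ?_⟩
  · rw [a3]
    rcases hg with rfl | ⟨j, hj, hp, rfl, -⟩
    · exact h.settled hgd
    · have hb := hY.bound _ (h.hv j hj)
      exact lt_of_lt_of_le (hY.sgL _ _ (h.hv j hj) hp) (hY.sg_mono _ _ hb.2.1 hb.2.2)
  · rw [← a6]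
    refine hY.tot_pick h.hv hpg.le hF hT ?_
    rcases hg with rfl | hg
    · obtain ⟨f, hf, h1, h2⟩ := hY.nx_mem p hgd h.le
      exact Or.inl ⟨f, hf, h1, h2⟩
    · exact Or.inr hg

end Sys

section

variable {B M : ℕ} (hB : (M + 10) ^ 8 < B) {Y : Sys}

include hB

theorem runs_minLoop {s : State} (hs : Bdd M s) (hHM : Y.H + 1 ≤ M)
    (hYs : SysAt Y s) (hj : s.reg regJ = 0) (hm : s.reg regMin = Y.d + 1) :
    Runs B M (loop (reg regJ ≺ reg regH) minStep) s (Y.H * 50 + 10) fun s' =>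
      s'.reg regMin ≤ Y.d + 1 ∧
      (∀ j < Y.H, s.reg regPos < Y.L (row Y s (s.reg regSlot) j) →
        s'.reg regMin ≤ Y.R (row Y s (s.reg regSlot) j)) ∧
      (s'.reg regMin ≤ Y.d → s'.reg regArg < Y.H ∧
        s.reg regPos < Y.L (row Y s (s.reg regSlot) (s'.reg regArg)) ∧
        Y.R (row Y s (s.reg regSlot) (s'.reg regArg)) = s'.reg regMin) := by
  refine (Runs.for hB (fun k s' => s'.reg regJ = k ∧ s'.reg regMin ≤ Y.d + 1 ∧
      (∀ j < k, s.reg regPos < Y.L (row Y s (s.reg regSlot) j) →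
        s'.reg regMin ≤ Y.R (row Y s (s.reg regSlot) j)) ∧
      (s'.reg regMin ≤ Y.d → s'.reg regArg < k ∧
        s.reg regPos < Y.L (row Y s (s.reg regSlot) (s'.reg regArg)) ∧
        Y.R (row Y s (s.reg regSlot) (s'.reg regArg)) = s'.reg regMin)) Y.H 40 rfl hs ?_ ?_ ?_
      le_rfl).mono ?_ ?_
  · exact ⟨hj, hm.le, fun j h => absurd h (Nat.not_lt_zero _), fun h => by omega⟩
  · rintro k s' hk hf ⟨h1, -⟩
    simp [h1, (hYs.frame hf rfl rfl).H]
  · rintro k s' hk hs' hf ⟨h1, h2, h3, h4⟩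
    have hY' := hYs.frame hf rfl rfl
    have hpos : s'.reg regPos = s.reg regPos := hf.1 _ rfl
    have hsl : s'.reg regSlot = s.reg regSlot := hf.1 _ rfl
    have hcu : s'.arr arrCu = s.arr arrCu := hf.2 _ rfl
    set u := row Y s (s.reg regSlot) k with hu
    have hu' : s'.arr arrCu (s'.reg regSlot * s'.reg regH + k) = u := by
      rw [hcu, hsl, hY'.H]; rfl
    have huM : u ≤ M := hu' ▸ hs'.2 _ _
    have hRM : Y.R u ≤ M := hY'.R ▸ hs'.2 _ _
    by_cases hc : Y.R u < s'.reg regMin ∧ s.reg regPos < Y.L u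
    · refine Runs.straight hB rfl (by decide) hs' ?_ ?_
      · simp [minStep, inc, hu', hY'.L, hY'.R, hpos, hc, h1, huM, hRM]
        omega
      · simp [minStep, inc, hu', hY'.L, hY'.R, hpos, hc, h1, ← hu]
        refine ⟨by omega, fun j hj hL => ?_⟩
        rcases Nat.eq_or_lt_of_le hj with rfl | hj
        · exact le_rfl
        · exact hc.1.le.trans (h3 j hj hL)
    · refine Runs.straight hB rfl (by decide) hs' ?_ ?_
      · simp [minStep, inc, hu', hY'.L, hY'.R, hpos, hc, h1, huM]
        omega
      · simp [minStep, inc, hu', hY'.L, hY'.R, hpos, hc, h1]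
        refine ⟨h2, fun j hj hL => ?_, fun h => ⟨(h4 h).1.le, (h4 h).2⟩⟩
        rcases Nat.eq_or_lt_of_le hj with rfl | hj
        · by_contra hlt
          exact hc ⟨not_le.1 hlt, hL⟩
        · exact h3 j hj hL
  · simp only [Exp.cost]; omega
  · rintro s' - - ⟨-, h⟩
    exact h

/-- The state of the greedy algorithm, started with the subproblem `c₀`, `p₀`, `ts`. -/
structure GreedyInv (Y : Sys) (c₀ p₀ : ℕ) (ts : ℕ → ℕ) (s : State) : Prop where
  sub : SubOK Y (s.reg regPos) (s.reg regCost) ts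
  le : p₀ ≤ s.reg regPos
  tot : Y.Tot c₀ p₀ ts ↔ Y.Tot (s.reg regCost) (s.reg regPos) ts
  halted : s.reg regGo = 0 → Y.Stop (s.reg regPos) ts (s.reg regMin) (s.reg regArg)

theorem runs_pickStep (hY : Y.WF) {s : State} (hs : Bdd M s) (hdM : Y.d + 1 ≤ M)
    (hYs : SysAt Y s) {c₀ p₀ : ℕ} {ts : ℕ → ℕ} (hts : ∀ j, row Y s (s.reg regSlot) j = ts j)
    (hgo : s.reg regGo ≠ 0) (hI : GreedyInv Y c₀ p₀ ts s) (h1 : s.reg regMin ≤ Y.d + 1)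
    (h2 : ∀ j < Y.H, s.reg regPos < Y.L (ts j) → s.reg regMin ≤ Y.R (ts j))
    (h3 : s.reg regMin ≤ Y.d → s.reg regArg < Y.H ∧ s.reg regPos < Y.L (ts (s.reg regArg)) ∧
        Y.R (ts (s.reg regArg)) = s.reg regMin) :
    Runs B M pickStep s 50 fun s' => GreedyInv Y c₀ p₀ ts s' ∧
      (s'.reg regGo = 0 ∨ Y.sg (s.reg regPos) < Y.sg (s'.reg regPos)) := by
  obtain ⟨hnx, hnx'⟩ := hY.nx_bound _ hI.sub.le
  have hu : s.arr arrCu (s.reg regSlot * s.reg regH + s.reg regArg) = ts (s.reg regArg) := by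
    rw [← hts, hYs.H]; rfl
  by_cases hc : s.reg regMin < Y.nx (s.reg regPos)
  · obtain ⟨a1, a2, a3⟩ := h3 (by omega)
    have hF : ∀ f ∈ Y.F, s.reg regPos < f.1 → s.reg regMin ≤ f.2 := fun f hf hp =>
      hc.le.trans (hY.nx_le _ hI.sub.le f hf hp)
    have hminM : s.reg regMin ≤ M := by omega
    by_cases hl : Y.hl (ts (s.reg regArg)) = 0
    · have hlt : s.reg regPos < s.reg regMin := by
        have := hY.bound _ (hI.sub.hv _ a1)
        omega
      obtain ⟨b1, b2, b3, b4⟩ := hY.sub_pick hI.sub hlt (by omega) hF h2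
        (Or.inr ⟨_, a1, a2, a3, hl⟩)
      have hcost := b1.cost
      have hle := b1.le
      refine Runs.straight hB rfl (by decide) hs ?_ ?_
      · simp [pickStep, hYs.nx, hYs.hl, hYs.la, hYs.cn, hYs.d, hc, hu, hl, hgo]
        omega
      · simp [pickStep, hYs.nx, hYs.hl, hYs.la, hYs.cn, hYs.d, hc, hu, hl, hgo]
        refine ⟨⟨?_, ?_, ?_, ?_⟩, ?_⟩ <;> try simp
        exacts [b1, hI.le.trans b2, hI.tot.trans b4, fun h => absurd h hgo, b3]
    · refine Runs.straight hB rfl (by decide) hs ?_ ?_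
      · simp [pickStep, hYs.nx, hYs.hl, hYs.la, hYs.cn, hYs.d, hc, hu, hl, hgo]
        omega
      · simp [pickStep, hYs.nx, hYs.hl, hYs.la, hYs.cn, hYs.d, hc, hu, hl, hgo]
        refine ⟨?_, ?_, ?_, ?_⟩ <;> simp
        exacts [hI.sub, hI.le, hI.tot, ⟨h1, hF, h2, fun _ => ⟨a1, a2, a3, by omega⟩⟩]
  -- Now `regMin` is at least the table entry; if that entry exceeds `d`, no set begins after the
  -- position.
  · by_cases hd : Y.d < Y.nx (s.reg regPos)
    · refine Runs.straight hB rfl (by decide) hs ?_ ?_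
      · simp [pickStep, hYs.nx, hYs.hl, hYs.la, hYs.cn, hYs.d, hc, hd, hgo]
        omega
      · simp [pickStep, hYs.nx, hYs.hl, hYs.la, hYs.cn, hYs.d, hc, hd, hgo]
        refine ⟨?_, ?_, ?_, ?_⟩ <;> simp
        exacts [hI.sub, hI.le, hI.tot, ⟨h1, fun f hf hp => by
          have := hY.nx_le _ hI.sub.le f hf hp
          omega, h2, fun h => by omega⟩]
    · obtain ⟨b1, b2, b3, b4⟩ := hY.sub_pick hI.sub hnx (not_lt.1 hd) (hY.nx_le _ hI.sub.le)
        (fun j hj hp => (not_lt.1 hc).trans (h2 j hj hp)) (Or.inl rfl)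
      have hcost := b1.cost
      have hle := b1.le
      refine Runs.straight hB rfl (by decide) hs ?_ ?_
      · simp [pickStep, hYs.nx, hYs.hl, hYs.la, hYs.cn, hYs.d, hc, hd, hgo]
        omega
      · simp [pickStep, hYs.nx, hYs.hl, hYs.la, hYs.cn, hYs.d, hc, hd, hgo]
        refine ⟨⟨?_, ?_, ?_, ?_⟩, ?_⟩ <;> try simp
        exacts [b1, hI.le.trans b2, hI.tot.trans b4, fun h => absurd h hgo, b3]

/-- The running time of the greedy algorithm. -/
def greedyTime (Y : Sys) : ℕ := (Y.sg Y.d + 1) * (Y.H * 50 + 100) + 20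

/-- Each round that does not halt enters a later segment, so the number of remaining segments serves
as the potential. -/
theorem runs_greedyLoop (hY : Y.WF) {s : State} (hs : Bdd M s) (hdM : Y.d + 1 ≤ M)
    (hHM : Y.H + 1 ≤ M) (hYs : SysAt Y s) {c₀ p₀ : ℕ} {ts : ℕ → ℕ}
    (hts : ∀ j, row Y s (s.reg regSlot) j = ts j) (hgo : s.reg regGo = 1)
    (hI : GreedyInv Y c₀ p₀ ts s) :
    Runs B M (loop (reg regGo) greedyStep) s ((Y.sg Y.d + 1) * (Y.H * 50 + 100) + 2) fun s' =>
      GreedyInv Y c₀ p₀ ts s' ∧ s'.reg regGo = 0 := by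
  refine (Runs.loop hB (GreedyInv Y c₀ p₀ ts)
    (fun s' => if s'.reg regGo = 0 then 0 else
      (Y.sg Y.d + 1 - Y.sg (s'.reg regPos)) * (Y.H * 50 + 100)) rfl hs hI ?_).mono ?_ ?_
  · intro s' hs' hf hI' hgo'
    have hgo' : s'.reg regGo ≠ 0 := hgo'
    have hY' := hYs.frame hf rfl rfl
    have hsl : s'.reg regSlot = s.reg regSlot := hf.1 _ rfl
    have hcu : s'.arr arrCu = s.arr arrCu := hf.2 _ rfl
    have hsg := hY.sg_mono _ _ hI'.sub.le le_rfl
    -- The loop test and the jump add `2`, for `Y.H * 50 + 100` per round.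
    refine ⟨Y.H * 50 + 98, ?_⟩
    refine Runs.seq (T₁ := 10) (T₂ := Y.H * 50 + 80)
      (R := fun s₁ => s₁.reg regMin = Y.d + 1 ∧ s₁.reg regJ = 0) ?_ (by omega) ?_
    · refine Runs.straight hB rfl (by decide) hs' ?_ ?_
      · simp [hY'.d]; omega
      · simp [hY'.d]
    · rintro s₁ hs₁ hf₁ ⟨e1, e2⟩
      have hY₁ := hY'.frame hf₁ rfl rfl
      have hrow : ∀ j, row Y s₁ (s₁.reg regSlot) j = ts j := by
        intro j
        rw [← hts, row, row, hf₁.2 arrCu rfl, hf₁.1 regSlot rfl, hcu, hsl]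
      have hp₁ : s₁.reg regPos = s'.reg regPos := hf₁.1 _ rfl
      refine Runs.seq (runs_minLoop hB hs₁ hHM hY₁ e2 e1) (T₂ := 50) (by omega) ?_
      rintro s₂ hs₂ hf₂ ⟨f1, f2, f3⟩
      simp only [hrow] at f2 f3
      have hY₂ := hY₁.frame hf₂ rfl rfl
      have hp₂ : s₂.reg regPos = s₁.reg regPos := hf₂.1 _ rfl
      have hc₂ : s₂.reg regCost = s'.reg regCost := (hf₂.1 _ rfl).trans (hf₁.1 _ rfl)
      have hg₂ : s₂.reg regGo = s'.reg regGo := (hf₂.1 _ rfl).trans (hf₁.1 _ rfl)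
      have hrow₂ : ∀ j, row Y s₂ (s₂.reg regSlot) j = ts j := by
        intro j
        rw [← hrow, row, row, hf₂.2 arrCu rfl, hf₂.1 regSlot rfl]
      have hI₂ : GreedyInv Y c₀ p₀ ts s₂ := by
        refine ⟨?_, ?_, ?_, fun h => absurd (hg₂ ▸ h) hgo'⟩ <;> rw [hp₂, hp₁]
        · rw [hc₂]; exact hI'.sub
        · exact hI'.le
        · rw [hc₂]; exact hI'.tot
      rw [← hp₂] at f2 f3
      refine (runs_pickStep hB hY hs₂ hdM hY₂ hrow₂ (hg₂ ▸ hgo') hI₂ f1 f2 f3).mono le_rfl ?_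
      rintro s₃ hs₃ - ⟨hI₃, h₃⟩
      refine ⟨hI₃, ?_⟩
      have hsg₃ := hY.sg_mono _ _ hI₃.sub.le le_rfl
      rw [hp₂, hp₁] at h₃
      simp only [Exp.cost, hgo', if_false]
      by_cases h0 : s₃.reg regGo = 0
      · simp only [h0, if_true]
        have : 1 * (Y.H * 50 + 100) ≤
            (Y.sg Y.d + 1 - Y.sg (s'.reg regPos)) * (Y.H * 50 + 100) :=
          Nat.mul_le_mul_right _ (by omega)
        omega
      · simp only [h0, if_false]
        have h₃ := h₃.resolve_left h0
        have : (Y.sg Y.d + 1 - Y.sg (s₃.reg regPos) + 1) * (Y.H * 50 + 100) ≤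
            (Y.sg Y.d + 1 - Y.sg (s'.reg regPos)) * (Y.H * 50 + 100) :=
          Nat.mul_le_mul_right _ (by omega)
        rw [Nat.add_mul] at this
        omega
  · simp only [hgo, Exp.cost]
    have : (Y.sg Y.d + 1 - Y.sg (s.reg regPos)) * (Y.H * 50 + 100) ≤
      (Y.sg Y.d + 1) * (Y.H * 50 + 100) := Nat.mul_le_mul_right _ (by omega)
    simp
  · rintro s' - - h
    exact h

theorem runs_greedy (hY : Y.WF) {s : State} (hs : Bdd M s) (hdM : Y.d + 1 ≤ M)
    (hHM : Y.H + 1 ≤ M) (hYs : SysAt Y s) {t : ℕ} (ht : s.reg regSlot = t)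
    (hsub : SubOK Y (s.arr arrPos t) (s.arr arrCost t) (row Y s t)) :
    Runs B M greedy s (greedyTime Y) fun s' => ∃ p c,
      SubOK Y p c (row Y s t) ∧ s.arr arrPos t ≤ p ∧
      (Y.Tot (s.arr arrCost t) (s.arr arrPos t) (row Y s t) ↔ Y.Tot c p (row Y s t)) ∧
      Y.Stop p (row Y s t) (s'.reg regMin) (s'.reg regArg) ∧ s'.reg regCost = c ∧
      s'.arr arrPos = Function.update (s.arr arrPos) t p ∧
      s'.arr arrCost = Function.update (s.arr arrCost) t c := by
  refine Runs.seq (T₁ := 10) (T₂ := (Y.sg Y.d + 1) * (Y.H * 50 + 100) + 10)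
    (R := fun s₁ => s₁.reg regPos = s.arr arrPos t ∧ s₁.reg regCost = s.arr arrCost t ∧
      s₁.reg regGo = 1) ?_ (by unfold greedyTime; omega) ?_
  · refine Runs.straight hB rfl (by decide) hs ?_ ?_
    · simp [hs.2]; omega
    · simp [ht]
  · rintro s₁ hs₁ hf₁ ⟨e1, e2, e3⟩
    have hY₁ := hYs.frame hf₁ rfl rfl
    have hrow : ∀ j, row Y s₁ (s₁.reg regSlot) j = row Y s t j := by
      intro j
      rw [row, row, hf₁.2 arrCu rfl, hf₁.1 regSlot rfl, ht]
    have hI : GreedyInv Y (s.arr arrCost t) (s.arr arrPos t) (row Y s t) s₁ := by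
      refine ⟨?_, ?_, ?_, fun h => ?_⟩
      · rw [e1, e2]; exact hsub
      · rw [e1]
      · rw [e1, e2]
      · omega
    refine Runs.seq (runs_greedyLoop hB hY hs₁ hdM hHM hY₁ hrow e3 hI) (T₂ := 8) (by omega) ?_
    rintro s₂ hs₂ hf₂ ⟨hI₂, hgo₂⟩
    have hsl : s₂.reg regSlot = t := (hf₂.1 _ rfl).trans ((hf₁.1 _ rfl).trans ht)
    have hpos : s₂.arr arrPos = s.arr arrPos := (hf₂.2 _ rfl).trans (hf₁.2 _ rfl)
    have hcost : s₂.arr arrCost = s.arr arrCost := (hf₂.2 _ rfl).trans (hf₁.2 _ rfl)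
    refine Runs.straight hB rfl (by decide) hs₂ ?_ ?_
    · simp [hs₂.1]
    · refine ⟨_, _, hI₂.sub, hI₂.le, hI₂.tot, ?_, ?_, ?_, ?_⟩
      · simpa using hI₂.halted hgo₂
      · simp
      · simp [hsl, hpos]
      · simp [hsl, hcost]

end

end AtMostNValue

/-! ## The search -/
namespace AtMostNValue

open WordRAM Exp Prog

set_option linter.unusedSimpArgs false

theorem SubOK.congr {Y : Sys} {p c : ℕ} {ts ts' : ℕ → ℕ} (h : SubOK Y p c ts)
    (he : ∀ j < Y.H, ts' j = ts j) : SubOK Y p c ts' :=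
  ⟨h.le, h.cost, fun j hj => he j hj ▸ h.hv j hj, h.settled⟩

namespace Sys

variable {Y : Sys}

theorem Stop.congr {p rm jm : ℕ} {ts ts' : ℕ → ℕ} (h : Y.Stop p ts rm jm)
    (he : ∀ j < Y.H, ts' j = ts j) : Y.Stop p ts' rm jm := by
  refine ⟨h.le, h.hF, fun j hj => ?_, fun hd => ?_⟩
  · rw [he j hj]
    exact h.hT j hj
  · have := h.hjm hd
    rwa [he jm this.1]

theorem WF.subOK_adv (hY : Y.WF) {p c j : ℕ} {ts : ℕ → ℕ} (h : SubOK Y p c ts) (hj : j < Y.H)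
    (hl : 0 < Y.hl (ts j)) : SubOK Y p c (adv ts j) :=
  ⟨h.le, h.cost, hY.hv_adv h.hv hj hl, h.settled⟩

/-- A subproblem is split into two, which are run to their next decisions and pruned. -/
theorem WF.branch_step (hY : Y.WF) {p c rm jm pA cA rA jA pB cB rB jB : ℕ}
    {ts tsA tsB : ℕ → ℕ} (h : SubOK Y p c ts) (hs : Y.Stop p ts rm jm) (hd : rm ≤ Y.d)
    (hA : SubOK Y pA cA ts) (hpA : rm ≤ pA) (htA : Y.Tot (c + 1) rm ts ↔ Y.Tot cA pA ts)
    (hsA : Y.Stop pA ts rA jA)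
    (hB : SubOK Y pB cB (adv ts jm)) (hpB : p ≤ pB)
    (htB : Y.Tot c p (adv ts jm) ↔ Y.Tot cB pB (adv ts jm)) (hsB : Y.Stop pB (adv ts jm) rB jB)
    (hcase : (rA = rB ∧ rA ≤ Y.d ∧ cB < cA ∧ tsA = adv ts jA ∧ tsB = adv ts jm) ∨
      (rA = rB ∧ rA ≤ Y.d ∧ ¬ cB < cA ∧ tsA = ts ∧ tsB = adv (adv ts jm) jB) ∨
      (¬ (rA = rB ∧ rA ≤ Y.d) ∧ tsA = ts ∧ tsB = adv ts jm)) :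
    SubOK Y pA cA tsA ∧ SubOK Y pB cB tsB ∧ (Y.Tot c p ts ↔ Y.Tot cB pB tsB ∨ Y.Tot cA pA tsA) ∧
      1 + pot (Y.rest pA tsA) + pot (Y.rest pB tsB) ≤ pot (Y.rest p ts) ∧
      Y.rest pA tsA + 1 ≤ Y.rest p ts ∧ Y.rest pB tsB + 1 ≤ Y.rest p ts := by
  obtain ⟨hj, hp, hR, hl⟩ := hs.hjm hd
  have hb := hY.bound _ (h.hv jm hj)
  have hv' := hY.hv_adv h.hv hj hl
  have hpos := hs.rest_pos hd
  have hrB := hY.rest_adv hj (h.hv jm hj) hp hl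
  have hrB' := rest_anti (Y := Y) hpB (adv ts jm)
  have hrA := rest_pick (Y := Y) hj (show p ≤ pA by omega) hp (by omega)
  have htot : Y.Tot c p ts ↔ Y.Tot cB pB (adv ts jm) ∨ Y.Tot cA pA ts := by
    rw [hY.tot_branch h.hv hs hd, htA, htB, or_comm]
  rcases hcase with ⟨rfl, hrd, hc, rfl, rfl⟩ | ⟨rfl, hrd, hc, rfl, rfl⟩ | ⟨hne, rfl, rfl⟩
  · obtain ⟨hjA, hpjA, hRA, hlA⟩ := hsA.hjm hrd
    have hradv := hY.rest_adv hjA (h.hv jA hjA) hpjA hlA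
    refine ⟨hY.subOK_adv hA hjA hlA, hB, ?_, ?_, by omega, by omega⟩
    -- The possibility being discarded, that the picking branch also picks `rA`, is covered by the
    -- forgetting branch with the same pick.
    · rw [htot, hY.tot_branch hA.hv hsA hrd]
      constructor
      · rintro (h1 | h1 | h1)
        · exact Or.inl h1
        · refine Or.inl ((hY.tot_branch hv' hsB hrd).2 (Or.inl ?_))
          exact hY.tot_prune_pick (h.hv jm hj) hl hc h1
        · exact Or.inr h1
      · rintro (h1 | h1)
        · exact Or.inl h1
        · exact Or.inr (Or.inr h1)
    · exact pot_branch hpos (by omega) (by omega) fun _ => Or.inl (by omega)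
  · obtain ⟨hjA, hpjA, hRA, hlA⟩ := hsA.hjm hrd
    obtain ⟨hjB, hpjB, hRB, hlB⟩ := hsB.hjm hrd
    have hbA := hY.bound _ (h.hv jA hjA)
    have hradv := hY.rest_adv hjB (hv' jB hjB) hpjB hlB
    refine ⟨hA, hY.subOK_adv hB hjB hlB, ?_, ?_, by omega, by omega⟩
    · rw [htot, hY.tot_branch hv' hsB hrd]
      constructor
      · rintro ((h1 | h1) | h1)
        · refine Or.inr ((hY.tot_branch h.hv hsA hrd).2 (Or.inl ?_))
          -- The set `jm` begins no later than `rA`: its left end is at most `rm ≤ pA`, and `pA`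
          -- precedes the interval that ends at `rA`.
          exact tot_prune_drop (by omega) (not_lt.1 hc) h1
        · exact Or.inl h1
        · exact Or.inr h1
      · rintro (h1 | h1)
        · exact Or.inl (Or.inr h1)
        · exact Or.inr h1
    · exact pot_branch hpos (by omega) (by omega) fun _ => Or.inr (by omega)
  · refine ⟨hA, hB, htot, ?_, by omega, by omega⟩
    refine pot_branch hpos (by omega) (by omega) fun h2 => ?_
    -- If each branch lost only one hole, both would stop at the same position, and the pruning
    -- would have applied.
    by_contra hcon
    push Not at hcon
    have heq := hY.stop_eq h.hv hs hd hpA hpB hsA hsB (by omega) (by omega) h2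
    exact hne ⟨heq, hY.stop_le_of_rest_pos h.hv hsA (by omega)⟩

end Sys

/-- Different rows of `arrCu` occupy disjoint cells. -/
theorem mul_add_inj {H i j i' j' : ℕ} (hj : j < H) (hj' : j' < H)
    (h : i * H + j = i' * H + j') : i = i' ∧ j = j' := by
  have h1 := congrArg (· / H) h
  have h2 := congrArg (· % H) h
  have hH : 0 < H := by omega
  simp only [mul_comm _ H, Nat.mul_add_div hH, Nat.div_eq_of_lt hj, Nat.div_eq_of_lt hj',
    Nat.mul_add_mod, Nat.mod_eq_of_lt hj, Nat.mod_eq_of_lt hj'] at h1 h2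
  omega

section

variable {B M : ℕ} (hB : (M + 10) ^ 8 < B) {Y : Sys}

include hB

theorem runs_split {s : State} (hs : Bdd M s) (hdM : Y.d + 1 ≤ M) (hHM : Y.H + 1 ≤ M)
    (hvM : ∀ t, Y.hv t → t + 1 ≤ M) (hYs : SysAt Y s) {τ p : ℕ} (hτ : s.reg regTop = τ)
    (hsub : SubOK Y p (s.reg regCost) (row Y s τ))
    (hst : Y.Stop p (row Y s τ) (s.reg regMin) (s.reg regArg)) (hmin : s.reg regMin ≤ Y.d) :
    Runs B M split s (Y.H * 50 + 50) fun s' =>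
      (∀ i < τ, ∀ j < Y.H, row Y s' i j = row Y s i j) ∧
      (∀ j < Y.H, row Y s' τ j = Sys.adv (row Y s τ) (s.reg regArg) j) ∧
      (∀ j < Y.H, row Y s' (τ + 1) j = row Y s τ j) ∧
      s'.arr arrPos = Function.update (s.arr arrPos) (τ + 1) (s.reg regMin) ∧
      s'.arr arrCost = Function.update (s.arr arrCost) (τ + 1) (s.reg regCost + 1) := by
  obtain ⟨ha, -, -, hl⟩ := hst.hjm hmin
  refine Runs.seq (T₁ := 5) (T₂ := Y.H * 50 + 45) (R := fun s₁ => s₁.reg regJ = 0) ?_ (by omega) ?_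
  · refine Runs.straight hB rfl (by decide) hs ?_ ?_ <;> simp
  intro s₁ hs₁ hf₁ hj₁
  have hrow₁ : ∀ i j, row Y s₁ i j = row Y s i j := fun i j => by
    rw [row, row, hf₁.2 arrCu rfl]
  have hτ₁ : s₁.reg regTop = τ := (hf₁.1 _ rfl).trans hτ
  refine Runs.seq (T₁ := Y.H * 50 + 5) (T₂ := 40) (R := fun s₂ =>
    (∀ i ≤ τ, ∀ j < Y.H, row Y s₂ i j = row Y s i j) ∧
    (∀ j < Y.H, row Y s₂ (τ + 1) j = row Y s τ j)) ?_ (by omega) ?_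
  · refine (Runs.for hB (fun k s₂ => s₂.reg regJ = k ∧
      (∀ i ≤ τ, ∀ j < Y.H, row Y s₂ i j = row Y s i j) ∧
      (∀ j < k, row Y s₂ (τ + 1) j = row Y s τ j)) Y.H 30 rfl hs₁ ?_ ?_ ?_ le_rfl).mono ?_ ?_
    · exact ⟨hj₁, fun i _ j _ => hrow₁ i j, fun j h => absurd h (Nat.not_lt_zero _)⟩
    · rintro k s₂ hk hf ⟨h1, -⟩
      simp [h1, (hf.1 regH rfl).trans ((hf₁.1 regH rfl).trans hYs.H)]
    · rintro k s₂ hk hs₂ hf ⟨h1, h2, h3⟩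
      have hH : s₂.reg regH = Y.H := (hf.1 _ rfl).trans ((hf₁.1 _ rfl).trans hYs.H)
      have hτ₂ : s₂.reg regTop = τ := (hf.1 _ rfl).trans hτ₁
      refine Runs.straight hB rfl (by decide) hs₂ ?_ ?_
      · simp [copyStep, inc, h1, hs₂.2]
        omega
      · simp only [copyStep, inc, row] at h2 h3 ⊢
        simp [h1, hH, hτ₂]
        refine ⟨fun i hi j hj => ?_, fun j hj => ?_⟩
        · rw [Function.update_of_ne, h2 i hi j hj]
          intro h
          have := (mul_add_inj hj hk h).1
          omega
        · rcases Nat.eq_or_lt_of_le hj with rfl | hj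
          · rw [Function.update_self, h2 τ le_rfl j hk]
          · rw [Function.update_of_ne, h3 j hj]
            intro h
            omega
    · simp only [Exp.cost]; omega
    · rintro s₂ - - ⟨-, h1, h2⟩
      exact ⟨h1, h2⟩
  rintro s₂ hs₂ hf₂ ⟨h1, h2⟩
  have hH : s₂.reg regH = Y.H := (hf₂.1 _ rfl).trans ((hf₁.1 _ rfl).trans hYs.H)
  have hτ₂ : s₂.reg regTop = τ := (hf₂.1 _ rfl).trans hτ₁
  have hmin₂ : s₂.reg regMin = s.reg regMin := (hf₂.1 _ rfl).trans (hf₁.1 _ rfl)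
  have hc₂ : s₂.reg regCost = s.reg regCost := (hf₂.1 _ rfl).trans (hf₁.1 _ rfl)
  have ha₂ : s₂.reg regArg = s.reg regArg := (hf₂.1 _ rfl).trans (hf₁.1 _ rfl)
  have hP₂ : s₂.arr arrPos = s.arr arrPos := (hf₂.2 _ rfl).trans (hf₁.2 _ rfl)
  have hC₂ : s₂.arr arrCost = s.arr arrCost := (hf₂.2 _ rfl).trans (hf₁.2 _ rfl)
  have hval : s₂.arr arrCu (τ * Y.H + s.reg regArg) = row Y s τ (s.reg regArg) := h1 τ le_rfl _ ha
  have hvle := hvM _ (hsub.hv _ ha)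
  have hcost := hsub.cost
  have hple := hsub.le
  refine Runs.straight hB rfl (by decide) hs₂ ?_ ?_
  · simp [forget, hmin₂, hc₂, hH, hτ₂, ha₂, hval]
    omega
  · simp only [row] at h1 h2 ⊢
    simp [forget, hmin₂, hc₂, hH, hτ₂, ha₂, hP₂, hC₂]
    refine ⟨fun i hi j hj => ?_, fun j hj => ?_, fun j hj => ?_⟩
    · rw [Function.update_of_ne, h1 i hi.le j hj]
      intro h
      have := (mul_add_inj hj ha h).1
      omega
    · simp only [Sys.adv, Function.update_apply]
      by_cases hja : j = s.reg regArg
      · subst hja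
        simp [row, h1 τ le_rfl _ ha]
      · simp [hja, row, h1 τ le_rfl j hj]
    · rw [Function.update_of_ne, h2 j hj]
      intro h
      have := (mul_add_inj hj ha h).1
      omega

theorem runs_prune {s : State} (hs : Bdd M s) (hvM : ∀ t, Y.hv t → t + 1 ≤ M)
    (hYs : SysAt Y s) {τ pA pB cA cB rA rB jA jB : ℕ} (hτ : s.reg regTop = τ) (hτM : τ + 2 ≤ M)
    (hA : SubOK Y pA cA (row Y s (τ + 1))) (hB' : SubOK Y pB cB (row Y s τ))
    (hsA : Y.Stop pA (row Y s (τ + 1)) rA jA) (hsB : Y.Stop pB (row Y s τ) rB jB)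
    (hrA : s.reg regMin = rA) (hjA : s.reg regArg = jA) (hcA : s.reg regCost = cA)
    (hrB : s.reg regMinB = rB) (hjB : s.reg regArgB = jB) (hcB : s.reg regCostB = cB) :
    Runs B M prune s 50 fun s' => s'.reg regTop = τ + 2 ∧
      (∀ i < τ, ∀ j < Y.H, row Y s' i j = row Y s i j) ∧
      ∃ tsA tsB, (∀ j < Y.H, row Y s' (τ + 1) j = tsA j) ∧ (∀ j < Y.H, row Y s' τ j = tsB j) ∧
        ((rA = rB ∧ rA ≤ Y.d ∧ cB < cA ∧ tsA = Sys.adv (row Y s (τ + 1)) jA ∧ tsB = row Y s τ) ∨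
        (rA = rB ∧ rA ≤ Y.d ∧ ¬ cB < cA ∧ tsA = row Y s (τ + 1) ∧
          tsB = Sys.adv (row Y s τ) jB) ∨
        (¬ (rA = rB ∧ rA ≤ Y.d) ∧ tsA = row Y s (τ + 1) ∧ tsB = row Y s τ)) := by
  by_cases hr : rA = rB ∧ rA ≤ Y.d
  · obtain ⟨rfl, hrd⟩ := hr
    have hrd' : rA < Y.d + 1 := by omega
    by_cases hc : cB < cA
    · have ha := (hsA.hjm hrd).1
      have hvle := hvM _ (hA.hv _ ha)
      refine Runs.straight hB rfl (by decide) hs ?_ ?_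
      · simp only [row] at hvle
        simp [prune, forget, inc, hrA, hjA, hcA, hrB, hjB, hcB, hYs.d, hYs.H, hτ, hrd', hc]
        omega
      · refine ⟨?_, ?_, _, _, ?_, ?_, Or.inl ⟨rfl, hrd, hc, rfl, rfl⟩⟩
        · simp [prune, forget, inc, hrA, hjA, hcA, hrB, hjB, hcB, hYs.d, hYs.H, hτ, hrd', hc]
        · intro i hi j hj
          simp [prune, forget, inc, hrA, hjA, hcA, hrB, hjB, hcB, hYs.d, hYs.H, hτ, hrd', hc, row]
          rw [Function.update_of_ne]
          intro h
          have := (mul_add_inj hj ha h).1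
          omega
        · intro j hj
          simp [prune, forget, inc, hrA, hjA, hcA, hrB, hjB, hcB, hYs.d, hYs.H, hτ, hrd', hc, row,
            Sys.adv, Function.update_apply]
        · intro j hj
          simp [prune, forget, inc, hrA, hjA, hcA, hrB, hjB, hcB, hYs.d, hYs.H, hτ, hrd', hc, row]
          rw [Function.update_of_ne]
          intro h
          have := (mul_add_inj hj ha h).1
          omega
    · have ha := (hsB.hjm hrd).1
      have hvle := hvM _ (hB'.hv _ ha)
      refine Runs.straight hB rfl (by decide) hs ?_ ?_
      · simp only [row] at hvle
        simp [prune, forget, inc, hrA, hjA, hcA, hrB, hjB, hcB, hYs.d, hYs.H, hτ, hrd', hc]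
        omega
      · refine ⟨?_, ?_, _, _, ?_, ?_, Or.inr (Or.inl ⟨rfl, hrd, hc, rfl, rfl⟩)⟩
        · simp [prune, forget, inc, hrA, hjA, hcA, hrB, hjB, hcB, hYs.d, hYs.H, hτ, hrd', hc]
        · intro i hi j hj
          simp [prune, forget, inc, hrA, hjA, hcA, hrB, hjB, hcB, hYs.d, hYs.H, hτ, hrd', hc, row]
          rw [Function.update_of_ne]
          intro h
          have := (mul_add_inj hj ha h).1
          omega
        · intro j hj
          simp [prune, forget, inc, hrA, hjA, hcA, hrB, hjB, hcB, hYs.d, hYs.H, hτ, hrd', hc, row]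
          rw [Function.update_of_ne]
          intro h
          have := (mul_add_inj hj ha h).1
          omega
        · intro j hj
          simp [prune, forget, inc, hrA, hjA, hcA, hrB, hjB, hcB, hYs.d, hYs.H, hτ, hrd', hc, row,
            Sys.adv, Function.update_apply]
  · have hr' : ¬ (rA ≤ Y.d ∧ rA = rB) := fun h => hr ⟨h.2, h.1⟩
    refine Runs.straight hB rfl (by decide) hs ?_ ?_
    · simp [prune, forget, inc, hrA, hrB, hYs.d, hYs.H, hτ, hr']
      exact hτM
    · refine ⟨?_, ?_, _, _, ?_, ?_, Or.inr (Or.inr ⟨hr, rfl, rfl⟩)⟩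
      · simp [prune, forget, inc, hrA, hrB, hYs.d, hYs.H, hτ, hr']
      all_goals intros; simp [prune, forget, inc, hrA, hrB, hYs.d, hYs.H, hτ, hr', row]

end

end AtMostNValue

namespace AtMostNValue

open WordRAM Exp Prog

set_option linter.unusedSimpArgs false

/-! ### The stack of subproblems -/

/-- The subproblem in the row `i`. -/
def SlotOK (Y : Sys) (s : State) (i : ℕ) : Prop :=
  SubOK Y (s.arr arrPos i) (s.arr arrCost i) (row Y s i)

/-- The subproblem in the row `i` has a solution. -/
def SlotTot (Y : Sys) (s : State) (i : ℕ) : Prop :=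
  Y.Tot (s.arr arrCost i) (s.arr arrPos i) (row Y s i)

/-- The number of holes of the subproblem in the row `i`. -/
def slotRest (Y : Sys) (s : State) (i : ℕ) : ℕ := Y.rest (s.arr arrPos i) (row Y s i)

/-- The subproblem in the row `i` is the same in both states. -/
def SameSlot (Y : Sys) (s s' : State) (i : ℕ) : Prop :=
  s'.arr arrPos i = s.arr arrPos i ∧ s'.arr arrCost i = s.arr arrCost i ∧
    ∀ j < Y.H, row Y s' i j = row Y s i j

namespace SameSlot

variable {Y : Sys} {s s' : State} {i : ℕ} (h : SameSlot Y s s' i)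

include h

theorem slotOK (h' : SlotOK Y s i) : SlotOK Y s' i := by
  unfold SlotOK
  rw [h.1, h.2.1]
  exact SubOK.congr h' h.2.2

theorem slotTot : SlotTot Y s' i ↔ SlotTot Y s i := by
  unfold SlotTot
  rw [h.1, h.2.1]
  exact Sys.tot_congr h.2.2

theorem slotRest : slotRest Y s' i = slotRest Y s i := by
  unfold AtMostNValue.slotRest
  rw [h.1]
  exact Sys.rest_congr h.2.2

theorem trans {s'' : State} (h' : SameSlot Y s' s'' i) : SameSlot Y s s'' i :=
  ⟨h'.1.trans h.1, h'.2.1.trans h.2.1, fun j hj => (h'.2.2 j hj).trans (h.2.2 j hj)⟩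

end SameSlot

/-- The running time of a step of the search. -/
def stepTime (Y : Sys) : ℕ := 3 * greedyTime Y + Y.H * 50 + 200

section

variable {B M : ℕ} (hB : (M + 10) ^ 8 < B) {Y : Sys}

include hB

theorem runs_branch (hY : Y.WF) {s : State} (hs : Bdd M s) (hdM : Y.d + 1 ≤ M)
    (hHM : Y.H + 1 ≤ M) (hvM : ∀ t, Y.hv t → t + 1 ≤ M) (hYs : SysAt Y s) {τ : ℕ}
    (hτ : s.reg regTop = τ) (hsl : s.reg regSlot = τ) (hτM : τ + 2 ≤ M) (hok : SlotOK Y s τ)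
    (hcost : s.reg regCost = s.arr arrCost τ)
    (hst : Y.Stop (s.arr arrPos τ) (row Y s τ) (s.reg regMin) (s.reg regArg))
    (hmin : s.reg regMin ≤ Y.d) :
    Runs B M branch s (2 * greedyTime Y + Y.H * 50 + 130) fun s' => s'.reg regTop = τ + 2 ∧
      (∀ i < τ, SameSlot Y s s' i) ∧ SlotOK Y s' τ ∧ SlotOK Y s' (τ + 1) ∧
      (SlotTot Y s τ ↔ SlotTot Y s' τ ∨ SlotTot Y s' (τ + 1)) ∧
      1 + pot (slotRest Y s' (τ + 1)) + pot (slotRest Y s' τ) ≤ pot (slotRest Y s τ) ∧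
      slotRest Y s' (τ + 1) + 1 ≤ slotRest Y s τ ∧ slotRest Y s' τ + 1 ≤ slotRest Y s τ := by
  obtain ⟨ha, hpa, hRa, hla⟩ := hst.hjm hmin
  have hsub : SubOK Y (s.arr arrPos τ) (s.arr arrCost τ) (row Y s τ) := hok
  have hva := hsub.hv _ ha
  have hba := hY.bound _ hva
  refine Runs.seq (runs_split hB hs hdM hHM hvM hYs hτ (hcost ▸ hsub) hst hmin)
    (T₂ := 2 * greedyTime Y + 80) (by omega) ?_
  rintro s₁ hs₁ hf₁ ⟨e1, e2, e3, e4, e5⟩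
  have hY₁ := hYs.frame hf₁ rfl rfl
  have hsubB : SubOK Y (s₁.arr arrPos τ) (s₁.arr arrCost τ) (row Y s₁ τ) := by
    rw [e4, e5, Function.update_of_ne (by omega), Function.update_of_ne (by omega)]
    exact (hY.subOK_adv hsub ha hla).congr e2
  refine Runs.seq (runs_greedy hB hY hs₁ hdM hHM hY₁ ((hf₁.1 regSlot rfl).trans hsl) hsubB)
    (T₂ := greedyTime Y + 80) (by omega) ?_
  rintro s₂ hs₂ hf₂ ⟨pB, cB, f1, f2, f3, f4, f5, f6, f7⟩
  have hY₂ := hY₁.frame hf₂ rfl rfl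
  have hτ₂ : s₂.reg regTop = τ := (hf₂.1 _ rfl).trans ((hf₁.1 _ rfl).trans hτ)
  refine Runs.seq (T₁ := 20) (T₂ := greedyTime Y + 60) (R := fun s₃ => s₃.reg regSlot = τ + 1 ∧
    s₃.reg regMinB = s₂.reg regMin ∧ s₃.reg regArgB = s₂.reg regArg ∧ s₃.reg regCostB = cB) ?_
    (by omega) ?_
  · refine Runs.straight hB rfl (by decide) hs₂ ?_ ?_
    · simp [hs₂.1, hτ₂]; omega
    · simp [hτ₂, f5]
  rintro s₃ hs₃ hf₃ ⟨g1, g2, g3, g4⟩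
  have hY₃ := hY₂.frame hf₃ rfl rfl
  have hrow₃ : ∀ i, row Y s₃ i = row Y s₁ i := fun i => by
    unfold row
    rw [hf₃.2 arrCu rfl, hf₂.2 arrCu rfl]
  have hpos₃ : s₃.arr arrPos = Function.update (s₁.arr arrPos) τ pB := (hf₃.2 _ rfl).trans f6
  have hcost₃ : s₃.arr arrCost = Function.update (s₁.arr arrCost) τ cB := (hf₃.2 _ rfl).trans f7
  have hposA : s₃.arr arrPos (τ + 1) = s.reg regMin := by
    rw [hpos₃, Function.update_of_ne (by omega), e4, Function.update_self]
  have hcostA : s₃.arr arrCost (τ + 1) = s.arr arrCost τ + 1 := by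
    rw [hcost₃, Function.update_of_ne (by omega), e5, Function.update_self, hcost]
  have hsubA : SubOK Y (s₃.arr arrPos (τ + 1)) (s₃.arr arrCost (τ + 1)) (row Y s₃ (τ + 1)) := by
    rw [hposA, hcostA, hrow₃]
    have hc := hsub.cost
    -- The new position is a right end of a set with holes, so a segment starts directly after it
    -- and the position is settled.
    refine SubOK.congr ⟨hmin, by omega, hsub.hv, fun hd => ?_⟩ e3
    rw [← hRa]
    refine hY.sgR _ _ hva ?_ (hRa ▸ hd)
    rw [hRa]
    exact (hY.nx_bound _ hmin).1
  refine Runs.seq (runs_greedy hB hY hs₃ hdM hHM hY₃ g1 hsubA) (T₂ := 60) (by omega) ?_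
  rintro s₄ hs₄ hf₄ ⟨pA, cA, h1, h2, h3, h4, h5, h6, h7⟩
  have hY₄ := hY₃.frame hf₄ rfl rfl
  have hrow₄ : ∀ i, row Y s₄ i = row Y s₁ i := fun i => by
    rw [← hrow₃]
    unfold row
    rw [hf₄.2 arrCu rfl]
  have hτ₄ : s₄.reg regTop = τ := (hf₄.1 _ rfl).trans ((hf₃.1 _ rfl).trans hτ₂)
  rw [hrow₃] at h1 h3 h4
  rw [hposA] at h2 h3
  rw [hcostA] at h3
  have hpos₁ : s₁.arr arrPos τ = s.arr arrPos τ := by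
    rw [e4, Function.update_of_ne (by omega)]
  have hcost₁ : s₁.arr arrCost τ = s.arr arrCost τ := by
    rw [e5, Function.update_of_ne (by omega)]
  rw [hpos₁] at f2 f3
  rw [hcost₁] at f3
  refine (runs_prune hB hs₄ hvM hY₄ hτ₄ hτM (hrow₄ (τ + 1) ▸ h1) (hrow₄ τ ▸ f1)
    (hrow₄ (τ + 1) ▸ h4) (hrow₄ τ ▸ f4) rfl rfl h5 ((hf₄.1 _ rfl).trans g2)
    ((hf₄.1 _ rfl).trans g3) ((hf₄.1 _ rfl).trans g4)).mono (by omega) ?_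
  rintro s₅ hs₅ hf₅ ⟨i1, i2, tsA, tsB, i3, i4, i5⟩
  rw [hrow₄, hrow₄] at i5
  have e2' : ∀ j < Y.H, Sys.adv (row Y s τ) (s.reg regArg) j = row Y s₁ τ j :=
    fun j hj => (e2 j hj).symm
  have e3' : ∀ j < Y.H, row Y s τ j = row Y s₁ (τ + 1) j := fun j hj => (e3 j hj).symm
  have hpos₅ : s₅.arr arrPos = Function.update (s₃.arr arrPos) (τ + 1) pA := (hf₅.2 _ rfl).trans h6
  have hcost₅ : s₅.arr arrCost = Function.update (s₃.arr arrCost) (τ + 1) cA :=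
    (hf₅.2 _ rfl).trans h7
  have hcongr : ∀ {f g : ℕ → ℕ} (k : ℕ), k < Y.H → (∀ j < Y.H, f j = g j) →
      ∀ j < Y.H, Sys.adv f k j = Sys.adv g k j := by
    intro f g k hk hfg j hj
    simp only [Sys.adv, Function.update_apply]
    split_ifs
    · rw [hfg k hk]
    · exact hfg j hj
  -- A row is meaningful for indices below `Y.H` only, so it is replaced by functions of exactly the
  -- form that `Sys.WF.branch_step` requires.
  obtain ⟨tsA', tsB', hA', hB', hcase⟩ : ∃ tsA' tsB', (∀ j < Y.H, tsA j = tsA' j) ∧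
      (∀ j < Y.H, tsB j = tsB' j) ∧
      ((s₄.reg regMin = s₂.reg regMin ∧ s₄.reg regMin ≤ Y.d ∧ cB < cA ∧
        tsA' = Sys.adv (row Y s τ) (s₄.reg regArg) ∧
        tsB' = Sys.adv (row Y s τ) (s.reg regArg)) ∨
      (s₄.reg regMin = s₂.reg regMin ∧ s₄.reg regMin ≤ Y.d ∧ ¬ cB < cA ∧ tsA' = row Y s τ ∧
        tsB' = Sys.adv (Sys.adv (row Y s τ) (s.reg regArg)) (s₂.reg regArg)) ∨
      (¬ (s₄.reg regMin = s₂.reg regMin ∧ s₄.reg regMin ≤ Y.d) ∧ tsA' = row Y s τ ∧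
        tsB' = Sys.adv (row Y s τ) (s.reg regArg))) := by
    rcases i5 with ⟨q1, q2, q3, rfl, rfl⟩ | ⟨q1, q2, q3, rfl, rfl⟩ | ⟨q1, rfl, rfl⟩
    · exact ⟨_, _, hcongr _ (h4.hjm q2).1 e3, e2, Or.inl ⟨q1, q2, q3, rfl, rfl⟩⟩
    · exact ⟨_, _, e3, hcongr _ (f4.hjm (q1 ▸ q2)).1 e2, Or.inr (Or.inl ⟨q1, q2, q3, rfl, rfl⟩)⟩
    · exact ⟨_, _, e3, e2, Or.inr (Or.inr ⟨q1, rfl, rfl⟩)⟩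
  obtain ⟨k1, k2, k3, k4, k5, k6⟩ := hY.branch_step hsub hst hmin (h1.congr e3') h2
    ((Sys.tot_congr e3').trans (h3.trans (Sys.tot_congr e3').symm)) (h4.congr e3')
    (f1.congr e2') f2 ((Sys.tot_congr e2').trans (f3.trans (Sys.tot_congr e2').symm))
    (f4.congr e2') hcase
  have hA : ∀ j < Y.H, row Y s₅ (τ + 1) j = tsA' j := fun j hj => (i3 j hj).trans (hA' j hj)
  have hBB : ∀ j < Y.H, row Y s₅ τ j = tsB' j := fun j hj => (i4 j hj).trans (hB' j hj)
  have p1 : s₅.arr arrPos (τ + 1) = pA := by rw [hpos₅, Function.update_self]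
  have p2 : s₅.arr arrCost (τ + 1) = cA := by rw [hcost₅, Function.update_self]
  have p3 : s₅.arr arrPos τ = pB := by
    rw [hpos₅, Function.update_of_ne (by omega), hpos₃, Function.update_self]
  have p4 : s₅.arr arrCost τ = cB := by
    rw [hcost₅, Function.update_of_ne (by omega), hcost₃, Function.update_self]
  refine ⟨i1, fun i hi => ⟨?_, ?_, fun j hj => ?_⟩, ?_, ?_, ?_, ?_, ?_, ?_⟩
  · rw [hpos₅, Function.update_of_ne (by omega), hpos₃, Function.update_of_ne (by omega), e4,
      Function.update_of_ne (by omega)]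
  · rw [hcost₅, Function.update_of_ne (by omega), hcost₃, Function.update_of_ne (by omega), e5,
      Function.update_of_ne (by omega)]
  · rw [i2 i hi j hj, hrow₄, e1 i hi j hj]
  · unfold SlotOK
    rw [p3, p4]
    exact k2.congr hBB
  · unfold SlotOK
    rw [p1, p2]
    exact k1.congr hA
  · unfold SlotTot
    rw [p1, p2, p3, p4, Sys.tot_congr hA, Sys.tot_congr hBB]
    exact k3
  all_goals
    unfold slotRest
    try rw [p1, Sys.rest_congr hA]
    try rw [p3, Sys.rest_congr hBB]
    assumption

/-- The invariant of the search. -/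
structure SearchInv (Y : Sys) (G : Prop) (k₀ : ℕ) (s : State) : Prop where
  ok : ∀ i < s.reg regTop, SlotOK Y s i
  rest : ∀ i < s.reg regTop, slotRest Y s i + i ≤ k₀
  iff : G ↔ s.reg regOk ≠ 0 ∨ ∃ i < s.reg regTop, SlotTot Y s i

/-- The sum of the potentials on the stack bounds the number of steps still to come. The invariant
that holes plus row number are at most `k₀` bounds the height of the stack. -/
theorem runs_searchStep (hY : Y.WF) {s : State} (hs : Bdd M s) (hdM : Y.d + 1 ≤ M)
    (hHM : Y.H + 1 ≤ M) (hvM : ∀ t, Y.hv t → t + 1 ≤ M) (hYs : SysAt Y s) {k₀ : ℕ}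
    (hkM : k₀ + 1 ≤ M) {G : Prop} (hI : SearchInv Y G k₀ s) (htop : s.reg regTop ≠ 0) :
    Runs B M searchStep s (3 * greedyTime Y + Y.H * 50 + 160) fun s' => SearchInv Y G k₀ s' ∧
      1 + ∑ i ∈ Finset.range (s'.reg regTop), pot (slotRest Y s' i) ≤
        ∑ i ∈ Finset.range (s.reg regTop), pot (slotRest Y s i) := by
  obtain ⟨τ, hτ⟩ := Nat.exists_eq_succ_of_ne_zero htop
  rw [Nat.succ_eq_add_one] at hτ
  refine Runs.seq (T₁ := 10) (T₂ := 3 * greedyTime Y + Y.H * 50 + 150)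
    (R := fun s₁ => s₁.reg regTop = τ ∧ s₁.reg regSlot = τ) ?_ (by omega) ?_
  · refine Runs.straight hB rfl (by decide) hs ?_ ?_
    · have := hs.1 regTop
      simp; omega
    · simp [hτ]
  rintro s₁ hs₁ hf₁ ⟨e1, e2⟩
  have hY₁ := hYs.frame hf₁ rfl rfl
  have hsame₁ : ∀ i, SameSlot Y s s₁ i := fun i => by
    refine ⟨by rw [hf₁.2 arrPos rfl], by rw [hf₁.2 arrCost rfl], fun j _ => ?_⟩
    unfold row
    rw [hf₁.2 arrCu rfl]
  have hok₁ : SlotOK Y s₁ τ := (hsame₁ τ).slotOK (hI.ok τ (by omega))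
  have hrest₁ := hI.rest τ (by omega)
  rw [← (hsame₁ τ).slotRest] at hrest₁
  refine Runs.seq (runs_greedy hB hY hs₁ hdM hHM hY₁ e2 hok₁)
    (T₂ := 2 * greedyTime Y + Y.H * 50 + 150) (by omega) ?_
  rintro s₂ hs₂ hf₂ ⟨p, c, f1, f2, f3, f4, f5, f6, f7⟩
  have hY₂ := hY₁.frame hf₂ rfl rfl
  have hτ₂ : s₂.reg regTop = τ := (hf₂.1 _ rfl).trans e1
  have hok₂ : s₂.reg regOk = s.reg regOk := (hf₂.1 _ rfl).trans (hf₁.1 _ rfl)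
  have hrow₂ : ∀ i, row Y s₂ i = row Y s₁ i := fun i => by
    unfold row
    rw [hf₂.2 arrCu rfl]
  have hsame₂ : ∀ i < τ, SameSlot Y s s₂ i := fun i hi => by
    refine (hsame₁ i).trans ⟨?_, ?_, fun j _ => by rw [hrow₂]⟩
    · rw [f6, Function.update_of_ne (by omega)]
    · rw [f7, Function.update_of_ne (by omega)]
  have hpos₂ : s₂.arr arrPos τ = p := by rw [f6, Function.update_self]
  have hcost₂ : s₂.arr arrCost τ = c := by rw [f7, Function.update_self]
  have hslot₂ : SlotOK Y s₂ τ := by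
    unfold SlotOK
    rw [hpos₂, hcost₂, hrow₂]
    exact f1
  have htot₂ : SlotTot Y s τ ↔ SlotTot Y s₂ τ := by
    rw [← (hsame₁ τ).slotTot]
    unfold SlotTot
    rw [hpos₂, hcost₂, hrow₂]
    exact f3
  have hrest₂ : slotRest Y s₂ τ ≤ slotRest Y s τ := by
    rw [← (hsame₁ τ).slotRest]
    unfold slotRest
    rw [hpos₂, hrow₂]
    exact Sys.rest_anti f2 _
  have hiff : G ↔ (s.reg regOk ≠ 0 ∨ SlotTot Y s₂ τ) ∨ ∃ i < τ, SlotTot Y s i := by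
    rw [hI.iff, or_assoc]
    refine or_congr_right ?_
    rw [← htot₂, hτ]
    constructor
    · rintro ⟨i, hi, h⟩
      rcases Nat.lt_succ_iff_lt_or_eq.1 hi with hi | rfl
      · exact Or.inr ⟨i, hi, h⟩
      · exact Or.inl h
    · rintro (h | ⟨i, hi, h⟩)
      · exact ⟨τ, by omega, h⟩
      · exact ⟨i, by omega, h⟩
  have hM1 : 1 ≤ M := by omega
  refine Runs.ite hB rfl hs₂ (T' := 2 * greedyTime Y + Y.H * 50 + 140)
    (by simp only [Exp.cost]; omega) ?_ ?_
  · intro hcond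
    have hd : Y.d < s₂.reg regMin := by
      simp only [Exp.eval, Op.eval, hY₂.d] at hcond
      by_contra h
      simp [h] at hcond
    have hfin : SlotTot Y s₂ τ ↔ c < Y.lim := by
      unfold SlotTot
      rw [hpos₂, hcost₂, hrow₂]
      exact hY.tot_finish f1.hv f4 (by omega)
    have key : ∀ s₃ : State, s₃.reg regTop = τ → (∀ i < τ, SameSlot Y s s₃ i) →
        (s₃.reg regOk ≠ 0 ↔ s.reg regOk ≠ 0 ∨ SlotTot Y s₂ τ) → SearchInv Y G k₀ s₃ ∧
        1 + ∑ i ∈ Finset.range (s₃.reg regTop), pot (slotRest Y s₃ i) ≤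
          ∑ i ∈ Finset.range (s.reg regTop), pot (slotRest Y s i) := by
      intro s₃ h1 h2 h3
      refine ⟨⟨?_, ?_, ?_⟩, ?_⟩ <;> rw [h1]
      · exact fun i hi => (h2 i hi).slotOK (hI.ok i (by omega))
      · exact fun i hi => (h2 i hi).slotRest ▸ hI.rest i (by omega)
      · rw [hiff, h3]
        refine or_congr_right (exists_congr fun i => and_congr_right fun hi => ?_)
        rw [(h2 i hi).slotTot]
      · rw [hτ, Finset.sum_range_succ, Finset.sum_congr rfl
          (fun i hi => by rw [(h2 i (Finset.mem_range.1 hi)).slotRest])]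
        have := one_le_pot (slotRest Y s τ)
        omega
    by_cases hc : c < Y.lim
    · refine Runs.straight hB rfl ?_ hs₂ ?_ ?_
      · exact le_trans (show _ ≤ 20 by decide) (by omega)
      · simp [f5, hY₂.lim, hc]; omega
      · refine key _ ?_ ?_ ?_
        · simp [f5, hY₂.lim, hc, hτ₂]
        · intro i hi
          have := hsame₂ i hi
          unfold SameSlot row at this ⊢
          simpa [f5, hY₂.lim, hc] using this
        · simp [f5, hY₂.lim, hc, hfin]
    · refine Runs.straight hB rfl ?_ hs₂ ?_ ?_
      · exact le_trans (show _ ≤ 20 by decide) (by omega)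
      · simp [f5, hY₂.lim, hc]
      · refine key _ ?_ ?_ ?_
        · simp [f5, hY₂.lim, hc, hτ₂]
        · intro i hi
          have := hsame₂ i hi
          unfold SameSlot row at this ⊢
          simpa [f5, hY₂.lim, hc] using this
        · simp [f5, hY₂.lim, hc, hfin, hok₂]
  · intro hcond
    have hd : s₂.reg regMin ≤ Y.d := by
      simp only [Exp.eval, Op.eval, hY₂.d] at hcond
      by_contra h
      simp [not_le.1 h] at hcond
    have hst₂ : Y.Stop (s₂.arr arrPos τ) (row Y s₂ τ) (s₂.reg regMin) (s₂.reg regArg) := by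
      rw [hpos₂, hrow₂]
      exact f4
    have hpos := hst₂.rest_pos hd
    -- A hole left in row `τ` gives `τ + 1 ≤ k₀`, so the stack has room for one more row.
    have hpos' : 1 ≤ slotRest Y s₂ τ := hpos
    rw [(hsame₁ τ).slotRest] at hrest₁
    refine (runs_branch hB hY hs₂ hdM hHM hvM hY₂ hτ₂ ((hf₂.1 _ rfl).trans e2) (by omega) hslot₂
      (f5.trans hcost₂.symm) hst₂ hd).mono (by omega) ?_
    rintro s₃ hs₃ hf₃ ⟨h1, h2, h3, h4, h5, h6, h7, h8⟩
    have h2' : ∀ i < τ, SameSlot Y s s₃ i := fun i hi => (hsame₂ i hi).trans (h2 i hi)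
    have hcases : ∀ i, i < τ + 2 → i < τ ∨ i = τ ∨ i = τ + 1 := fun i hi => by omega
    refine ⟨⟨?_, ?_, ?_⟩, ?_⟩ <;> rw [h1]
    · intro i hi
      rcases hcases i hi with hi | rfl | rfl
      · exact (h2' i hi).slotOK (hI.ok i (by omega))
      · exact h3
      · exact h4
    · intro i hi
      rcases hcases i hi with hi | rfl | rfl
      · exact (h2' i hi).slotRest ▸ hI.rest i (by omega)
      · omega
      · omega
    · rw [hiff, hf₃.1 regOk rfl, hok₂, h5, or_assoc]
      refine or_congr_right ?_
      constructor
      · rintro ((h | h) | ⟨i, hi, h⟩)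
        · exact ⟨τ, by omega, h⟩
        · exact ⟨τ + 1, by omega, h⟩
        · exact ⟨i, by omega, (h2' i hi).slotTot.2 h⟩
      · rintro ⟨i, hi, h⟩
        rcases hcases i hi with hi | rfl | rfl
        · exact Or.inr ⟨i, hi, (h2' i hi).slotTot.1 h⟩
        · exact Or.inl (Or.inl h)
        · exact Or.inl (Or.inr h)
    · rw [hτ, Finset.sum_range_succ, Finset.sum_range_succ, Finset.sum_range_succ,
        Finset.sum_congr rfl (fun i hi => by rw [(h2' i (Finset.mem_range.1 hi)).slotRest])]
      have := pot_mono hrest₂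
      omega

theorem runs_search (hY : Y.WF) {s : State} (hs : Bdd M s) (hdM : Y.d + 1 ≤ M)
    (hHM : Y.H + 1 ≤ M) (hvM : ∀ t, Y.hv t → t + 1 ≤ M) (hYs : SysAt Y s)
    {ts : ℕ → ℕ} (hts : ∀ j, s.arr arrCu j = ts j) (hv : ∀ j < Y.H, Y.hv (ts j))
    (hsg : Y.Settled 0) (hkM : Y.rest 0 ts + 1 ≤ M) :
    Runs B M search s (pot (Y.rest 0 ts) * stepTime Y + 30) fun s' =>
      (s'.reg regOk ≠ 0 ↔ Y.Tot 0 0 ts) := by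
  refine Runs.seq (T₁ := 20) (T₂ := pot (Y.rest 0 ts) * stepTime Y + 2)
    (R := fun s₁ => s₁.arr arrPos 0 = 0 ∧ s₁.arr arrCost 0 = 0 ∧ s₁.reg regOk = 0 ∧
      s₁.reg regTop = 1) ?_ (by omega) ?_
  · refine Runs.straight hB rfl (by decide) hs ?_ ?_
    · simp; omega
    · simp
  rintro s₁ hs₁ hf₁ ⟨e1, e2, e3, e4⟩
  have hY₁ := hYs.frame hf₁ rfl rfl
  have hrow : row Y s₁ 0 = ts := by
    funext j
    rw [row, hf₁.2 arrCu rfl, Nat.zero_mul, Nat.zero_add, hts]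
  have hrest : slotRest Y s₁ 0 = Y.rest 0 ts := by rw [slotRest, e1, hrow]
  have hI : SearchInv Y (Y.Tot 0 0 ts) (Y.rest 0 ts) s₁ := by
    refine ⟨?_, ?_, ?_⟩ <;> rw [e4]
    · intro i hi
      obtain rfl : i = 0 := by omega
      unfold SlotOK
      rw [e1, e2, hrow]
      exact ⟨Nat.zero_le _, le_rfl, hv, hsg⟩
    · intro i hi
      obtain rfl : i = 0 := by omega
      rw [hrest]
      exact le_rfl
    · constructor
      · intro h
        refine Or.inr ⟨0, by omega, ?_⟩
        unfold SlotTot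
        rwa [e1, e2, hrow]
      · rintro (h | ⟨i, hi, h⟩)
        · exact absurd e3 h
        · obtain rfl : i = 0 := by omega
          unfold SlotTot at h
          rwa [e1, e2, hrow] at h
  refine (Runs.loop hB (SearchInv Y (Y.Tot 0 0 ts) (Y.rest 0 ts))
    (fun s' => (∑ i ∈ Finset.range (s'.reg regTop), pot (slotRest Y s' i)) * stepTime Y) rfl
    hs₁ hI ?_).mono ?_ ?_
  · intro s' hs' hf' hI' htop
    have hY' := hY₁.frame hf' rfl rfl
    refine ⟨_, (runs_searchStep hB hY hs' hdM hHM hvM hY' hkM hI' htop).mono le_rfl ?_⟩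
    rintro s'' - - ⟨h1, h2⟩
    refine ⟨h1, ?_⟩
    have := Nat.mul_le_mul_right (stepTime Y) h2
    rw [Nat.add_mul] at this
    have : stepTime Y = 3 * greedyTime Y + Y.H * 50 + 200 := rfl
    simp only [Exp.cost]
    omega
  · simp only [e4, Finset.sum_range_one, hrest, Exp.cost]
    omega
  · rintro s' - - ⟨h1, h2⟩
    have h2 : s'.reg regTop = 0 := h2
    rw [h1.iff, h2]
    simp

end

end AtMostNValue

/-! ## The problem of a value -/
namespace AtMostNValue

open WordRAM Exp Prog

set_option linter.unusedSimpArgs false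

/-- The tables that the program computes from the input. -/
structure Tab where
  st : ℕ → ℕ
  L : ℕ → ℕ
  R : ℕ → ℕ
  hl : ℕ → ℕ
  sg : ℕ → ℕ

/-- The tables are correct. -/
structure Tab.WF (T : Tab) (I : Instance) (M : ℕ) : Prop where
  parsed : I.Parsed T.st T.L T.R T.hl
  sg_mono : ∀ p q, p ≤ q → q ≤ I.D.card → T.sg p ≤ T.sg q
  sg_pos : ∀ p, 1 ≤ p → p ≤ I.D.card → T.sg 0 < T.sg p
  sgL : ∀ (x : Fin I.n) (i p : ℕ), 0 < T.hl (T.st x) → i ≤ T.hl (T.st x) → p < T.L (T.st x + i) →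
    T.sg p < T.sg (T.L (T.st x + i))
  sgR : ∀ (x : Fin I.n) (i p : ℕ), 0 < T.hl (T.st x) → i ≤ T.hl (T.st x) → T.R (T.st x + i) < p →
    p ≤ I.D.card → T.sg (T.R (T.st x + i)) < T.sg p
  sg_le : T.sg I.D.card ≤ 4 * I.holes + 1
  idx : ∀ (x : Fin I.n) (i : ℕ), i ≤ T.hl (T.st x) → T.st x + i + 1 ≤ M

/-- The state contains the input and the tables. -/
structure EnvAt (I : Instance) (T : Tab) (s : State) : Prop where
  n : s.reg regN = I.n
  d : s.reg regD = I.D.card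
  lim : s.reg regLim = I.N.toNat
  input : Holds (s.arr arrIn) 0 I.encode
  st : s.arr arrSt = T.st
  L : s.arr arrL = T.L
  R : s.arr arrR = T.R
  hl : s.arr arrHl = T.hl
  sg : s.arr arrSg = T.sg

theorem EnvAt.frame {I : Instance} {T : Tab} {p : Prog} {s s' : State} (h : EnvAt I T s)
    (hf : Frame p s s') (hr : ([regN, regD, regLim].all fun r => !p.wr r) = true)
    (ha : ([arrIn, arrSt, arrL, arrR, arrHl, arrSg].all fun a => !p.wa a) = true) :
    EnvAt I T s' := by
  obtain ⟨h1, h2⟩ := hf.congr hr ha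
  simp only [List.forall_mem_cons, List.not_mem_nil, false_imp_iff, implies_true, and_true] at h1 h2
  obtain ⟨a1, a2, a3⟩ := h1
  obtain ⟨b1, b2, b3, b4, b5, b6⟩ := h2
  exact ⟨a1 ▸ h.n, a2 ▸ h.d, a3 ▸ h.lim, b1 ▸ h.input, b2 ▸ h.st, b3 ▸ h.L, b4 ▸ h.R, b5 ▸ h.hl,
    b6 ▸ h.sg⟩

/-! ### Pointers into the domains while the tested value increases -/

/-- `u` is the last interval of the `x`-th domain, or the first one that does not end before `v`. -/
def PtrOK (I : Instance) (T : Tab) (x : Fin I.n) (v u : ℕ) : Prop :=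
  ∃ i ≤ T.hl (T.st x), u = T.st x + i ∧ (∀ j < i, T.R (T.st x + j) < v) ∧
    (v ≤ T.R u ∨ i = T.hl (T.st x))

theorem ptrOK_zero (I : Instance) (T : Tab) (x : Fin I.n) : PtrOK I T x 0 (T.st x) :=
  ⟨0, Nat.zero_le _, rfl, fun _ h => absurd h (Nat.not_lt_zero _), Or.inl (Nat.zero_le _)⟩

section

variable {I : Instance} {T : Tab} {M : ℕ} (hI : I.IsInput) (hT : T.WF I M)

include hI hT

theorem Tab.WF.hl_add (x : Fin I.n) {i : ℕ} (hi : i ≤ T.hl (T.st x)) :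
    T.hl (T.st x + i) + i = T.hl (T.st x) := by
  have h1 := hT.parsed.hl_st hI x
  have h2 := hT.parsed.hl_eq x i (by omega)
  omega

/-- Earlier intervals end before `v`; if there are later ones, they begin after the end of `u`,
which is then at least `v`. -/
theorem PtrOK.mem_dom_iff {x : Fin I.n} {v u : ℕ} (h : PtrOK I T x v u) (hv : 1 ≤ v)
    (hv' : v ≤ I.D.card) : val I.D v ∈ I.dom x ↔ T.L u < v + 1 ∧ v < T.R u + 1 := by
  obtain ⟨i, hi, rfl, h1, h2⟩ := h
  rw [hT.parsed.mem_dom_iff hI x hv hv']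
  constructor
  · rintro ⟨j, hj, h3, h4⟩
    rcases lt_trichotomy j i with hji | rfl | hji
    · have := h1 j hji
      omega
    · omega
    · have := hT.parsed.R_lt_L hI x i j hji hj
      omega
  · rintro ⟨h3, h4⟩
    exact ⟨i, hi, by omega, by omega⟩

/-- One move per value is enough: the interval `u` must end exactly at `v`, and its successor is
non-empty and lies beyond `v`. -/
theorem PtrOK.move {x : Fin I.n} {v u : ℕ} (h : PtrOK I T x v u)
    (hR : T.R u < v + 1) (hl : T.hl u ≠ 0) : PtrOK I T x (v + 1) (u + 1) := by
  obtain ⟨i, hi, rfl, h1, h2⟩ := h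
  have h3 := hT.hl_add hI x hi
  have hlt := hT.parsed.R_lt_L hI x i (i + 1) (by omega) (by omega)
  have hb := hT.parsed.bound hI x (i + 1) (by omega)
  refine ⟨i + 1, by omega, by omega, fun j hj => ?_, Or.inl ?_⟩
  · rcases Nat.lt_succ_iff_lt_or_eq.1 hj with hj | rfl
    · have := h1 j hj
      omega
    · exact hR
  · rw [add_assoc]
    omega

theorem PtrOK.stay {x : Fin I.n} {v u : ℕ} (h : PtrOK I T x v u)
    (hn : ¬ (T.R u < v + 1 ∧ T.hl u ≠ 0)) : PtrOK I T x (v + 1) u := by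
  obtain ⟨i, hi, rfl, h1, h2⟩ := h
  have h3 := hT.hl_add hI x hi
  refine ⟨i, hi, rfl, fun j hj => (h1 j hj).trans (by omega), ?_⟩
  by_contra hc
  push Not at hc
  exact hn ⟨by omega, by omega⟩

end

section

variable {B M : ℕ} (hB : (M + 10) ^ 8 < B) {I : Instance} (hI : I.IsInput) {T : Tab}
  (hT : T.WF I M)

include hB

include hI hT in
theorem runs_movePtr {s : State} (hs : Bdd M s) (hE : EnvAt I T s) {x : Fin I.n} {v : ℕ}
    (hv : s.reg regV = v + 1) (hp : PtrOK I T x v (s.reg regU)) :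
    Runs B M movePtr s 20 fun s' => PtrOK I T x (v + 1) (s'.reg regU) := by
  by_cases hc : T.R (s.reg regU) < v + 1 ∧ T.hl (s.reg regU) ≠ 0
  · have hm := hp.move hI hT hc.1 hc.2
    refine Runs.straight hB rfl (by decide) hs ?_ ?_
    · obtain ⟨i, hi, h1, -⟩ := hp
      have := hT.idx x i hi
      simp [movePtr, inc, hE.R, hE.hl, hv, hc.1, hc.2]
      omega
    · simpa [movePtr, inc, hE.R, hE.hl, hv, hc.1, hc.2] using hm
  · have hm := hp.stay hI hT hc
    by_cases hR : T.R (s.reg regU) < v + 1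
    · have h0 : T.hl (s.reg regU) = 0 := by
        by_contra h
        exact hc ⟨hR, h⟩
      refine Runs.straight hB rfl (by decide) hs ?_ ?_
      · simp [movePtr, inc, hE.R, hE.hl, hv, hR, h0]
      · simpa [movePtr, inc, hE.R, hE.hl, hv, hR, h0] using hm
    · refine Runs.straight hB rfl (by decide) hs ?_ ?_
      · simp [movePtr, inc, hE.R, hE.hl, hv, hR]
      · simpa [movePtr, inc, hE.R, hE.hl, hv, hR] using hm

theorem runs_resetMm {s : State} (hs : Bdd M s) {d : ℕ} (hd : s.reg regD = d) (hdM : d + 1 ≤ M) :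
    Runs B M resetMm s (d * 50 + 50) fun s' => ∀ p, 1 ≤ p → p ≤ d → s'.arr arrMm p = d + 1 := by
  refine Runs.seq (T₁ := 5) (T₂ := d * 50 + 40) (R := fun s₁ => s₁.reg regP = 0) ?_ (by omega) ?_
  · refine Runs.straight hB rfl (by decide) hs ?_ ?_ <;> simp
  intro s₁ hs₁ hf₁ h1
  refine (Runs.for hB (fun k s₂ => s₂.reg regP = k ∧
    ∀ p, 1 ≤ p → p ≤ k → s₂.arr arrMm p = d + 1) d 30 rfl hs₁ ?_ ?_ ?_ le_rfl).mono ?_ ?_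
  · exact ⟨h1, fun p h h' => by omega⟩
  · rintro k s₂ hk hf ⟨h2, -⟩
    have hd₂ : s₂.reg regD = d := (hf.1 _ rfl).trans ((hf₁.1 _ rfl).trans hd)
    simp [h2, hd₂]
  · rintro k s₂ hk hs₂ hf ⟨h2, h3⟩
    have hd₂ : s₂.reg regD = d := (hf.1 _ rfl).trans ((hf₁.1 _ rfl).trans hd)
    refine Runs.straight hB rfl (by decide) hs₂ ?_ ?_
    · simp [inc, h2, hd₂]; omega
    · simp [inc, h2, hd₂, Function.update_apply]
      intro p hp hp' hne
      exact h3 p hp (by omega)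
  · simp only [Exp.cost]; omega
  · rintro s₂ - - ⟨-, h⟩
    exact h

/-- The domains with numbers less than `k` have been taken into account. -/
structure ScanInv (I : Instance) (T : Tab) (v k : ℕ) (s : State) : Prop where
  x : s.reg regX = k
  ptr : ∀ x : Fin I.n, (x : ℕ) < k → PtrOK I T x (v + 1) (s.arr arrPt x)
  ptr' : ∀ x : Fin I.n, k ≤ (x : ℕ) → PtrOK I T x v (s.arr arrPt x)
  any : s.reg regAny ≠ 0 ↔ ∃ x : Fin I.n, (x : ℕ) < k ∧ val I.D (v + 1) ∈ I.dom x
  H : s.reg regH ≤ k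
  mem : ∀ x : Fin I.n, (x : ℕ) < k → 0 < T.hl (T.st x) → val I.D (v + 1) ∉ I.dom x →
    ∃ j < s.reg regH, s.arr arrCu j = T.st x
  of_lt : ∀ j < s.reg regH, ∃ x : Fin I.n, 0 < T.hl (T.st x) ∧ val I.D (v + 1) ∉ I.dom x ∧
    s.arr arrCu j = T.st x
  sum : ∑ j ∈ Finset.range (s.reg regH), T.hl (s.arr arrCu j) ≤
    ∑ x ∈ Finset.univ.filter (fun x : Fin I.n => (x : ℕ) < k), T.hl (T.st x)
  mm_bound : ∀ p, 1 ≤ p → p ≤ I.D.card → p ≤ s.arr arrMm p ∧ s.arr arrMm p ≤ I.D.card + 1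
  mm_le : ∀ x : Fin I.n, (x : ℕ) < k → T.hl (T.st x) = 0 → val I.D (v + 1) ∉ I.dom x →
    s.arr arrMm (T.L (T.st x)) ≤ T.R (T.st x)
  mm_mem : ∀ p, 1 ≤ p → p ≤ I.D.card → s.arr arrMm p ≤ I.D.card → ∃ x : Fin I.n,
    T.hl (T.st x) = 0 ∧ val I.D (v + 1) ∉ I.dom x ∧ T.L (T.st x) = p ∧
      T.R (T.st x) = s.arr arrMm p

include hI hT in
theorem runs_scanVar {s : State} (hs : Bdd M s) (hE : EnvAt I T s) {v k : ℕ}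
    (hv : s.reg regV = v + 1) (hvd : v < I.D.card) (hk : k < I.n) (hnM : I.n + 1 ≤ M)
    (hS : ScanInv I T v k s) : Runs B M scanVar s 150 (ScanInv I T v (k + 1)) := by
  set x : Fin I.n := ⟨k, hk⟩ with hx
  have hlt : ∀ y : Fin I.n, (y : ℕ) < k + 1 ↔ (y : ℕ) < k ∨ y = x := fun y => by
    rw [Fin.ext_iff]
    exact Nat.lt_succ_iff_lt_or_eq
  have hne : ∀ y : Fin I.n, k + 1 ≤ (y : ℕ) → (y : ℕ) ≠ k := fun y h => by omega
  have hfil : Finset.univ.filter (fun y : Fin I.n => (y : ℕ) < k + 1) =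
      insert x (Finset.univ.filter (fun y : Fin I.n => (y : ℕ) < k)) := by
    ext y
    rw [Finset.mem_insert, Finset.mem_filter, Finset.mem_filter, hlt, or_comm]
    simp
  have hxn : x ∉ Finset.univ.filter (fun y : Fin I.n => (y : ℕ) < k) := by simp [hx]
  have hst := hT.parsed.bound hI x 0 (Nat.zero_le _)
  rw [add_zero] at hst
  refine Runs.seq (T₁ := 10) (T₂ := 130) (R := fun s₁ => s₁.reg regU = s.arr arrPt k) ?_
    (by omega) ?_
  · refine Runs.straight hB rfl (by decide) hs ?_ ?_
    · simp [hs.2]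
    · simp [hS.x]
  intro s₁ hs₁ hf₁ h1
  refine Runs.seq (runs_movePtr hB hI hT hs₁ (hE.frame hf₁ rfl rfl) (x := x) (v := v)
    ((hf₁.1 _ rfl).trans hv) (h1 ▸ hS.ptr' x le_rfl)) (T₂ := 105) (by omega) ?_
  intro s₂ hs₂ hf₂ hptr
  have hE₂ := (hE.frame hf₁ rfl rfl).frame hf₂ rfl rfl
  have hv₂ : s₂.reg regV = v + 1 := (hf₂.1 _ rfl).trans ((hf₁.1 _ rfl).trans hv)
  have hX₂ : s₂.reg regX = k := (hf₂.1 _ rfl).trans ((hf₁.1 _ rfl).trans hS.x)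
  have hH₂ : s₂.reg regH = s.reg regH := (hf₂.1 _ rfl).trans (hf₁.1 _ rfl)
  have hany₂ : s₂.reg regAny = s.reg regAny := (hf₂.1 _ rfl).trans (hf₁.1 _ rfl)
  have hpt₂ : s₂.arr arrPt = s.arr arrPt := (hf₂.2 _ rfl).trans (hf₁.2 _ rfl)
  have hcu₂ : s₂.arr arrCu = s.arr arrCu := (hf₂.2 _ rfl).trans (hf₁.2 _ rfl)
  have hmm₂ : s₂.arr arrMm = s.arr arrMm := (hf₂.2 _ rfl).trans (hf₁.2 _ rfl)
  have hmem := hptr.mem_dom_iff hI hT (by omega) (by omega)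
  have hUM := hs₂.1 regU
  have hstM : T.st k ≤ M := hE₂.st ▸ hs₂.2 _ _
  have hRM : T.R (T.st k) ≤ M := hE₂.R ▸ hs₂.2 _ _
  have hHk := hS.H
  -- The paths through the program differ only in which cell they update, so the invariant is
  -- derived once from a description of the possible updates.
  have hstep : ∀ s₃ : State, s₃.reg regX = k + 1 →
      s₃.arr arrPt = Function.update (s.arr arrPt) k (s₂.reg regU) →
      (s₃.reg regAny ≠ 0 ↔ s.reg regAny ≠ 0 ∨ val I.D (v + 1) ∈ I.dom x) →
      (s₃.reg regH = s.reg regH ∧ s₃.arr arrCu = s.arr arrCu ∧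
          (0 < T.hl (T.st x) → val I.D (v + 1) ∈ I.dom x) ∨
        s₃.reg regH = s.reg regH + 1 ∧
          s₃.arr arrCu = Function.update (s.arr arrCu) (s.reg regH) (T.st x) ∧
          0 < T.hl (T.st x) ∧ val I.D (v + 1) ∉ I.dom x) →
      (s₃.arr arrMm = s.arr arrMm ∧ (T.hl (T.st x) = 0 → val I.D (v + 1) ∉ I.dom x →
          s.arr arrMm (T.L (T.st x)) ≤ T.R (T.st x)) ∨
        s₃.arr arrMm = Function.update (s.arr arrMm) (T.L (T.st x)) (T.R (T.st x)) ∧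
          T.hl (T.st x) = 0 ∧ val I.D (v + 1) ∉ I.dom x ∧
          T.R (T.st x) < s.arr arrMm (T.L (T.st x))) → ScanInv I T v (k + 1) s₃ := by
    intro s₃ a1 a2 a3 a4 a5
    refine ⟨a1, ?_, ?_, ?_, ?_, ?_, ?_, ?_, ?_, ?_, ?_⟩
    · intro y hy
      rw [a2]
      rcases (hlt y).1 hy with hy | rfl
      · rw [Function.update_of_ne hy.ne]
        exact hS.ptr y hy
      · rw [show ((x : Fin I.n) : ℕ) = k from rfl, Function.update_self]
        exact hptr
    · intro y hy
      rw [a2, Function.update_of_ne (hne y hy)]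
      exact hS.ptr' y (by omega)
    · rw [a3, hS.any]
      constructor
      · rintro (⟨y, hy, h⟩ | h)
        · exact ⟨y, by omega, h⟩
        · exact ⟨x, Nat.lt_succ_self k, h⟩
      · rintro ⟨y, hy, h⟩
        rcases (hlt y).1 hy with hy | rfl
        · exact Or.inl ⟨y, hy, h⟩
        · exact Or.inr h
    · rcases a4 with ⟨a4, -⟩ | ⟨a4, -⟩ <;> omega
    · intro y hy h h'
      rcases a4 with ⟨b1, b2, b3⟩ | ⟨b1, b2, b3⟩
      · rw [b1, b2]
        rcases (hlt y).1 hy with hy | rfl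
        · exact hS.mem y hy h h'
        · exact absurd (b3 h) h'
      · rw [b1, b2]
        rcases (hlt y).1 hy with hy | rfl
        · obtain ⟨j, hj, hj'⟩ := hS.mem y hy h h'
          exact ⟨j, by omega, by rw [Function.update_of_ne (by omega), hj']⟩
        · exact ⟨_, Nat.lt_succ_self _, Function.update_self _ _ _⟩
    · intro j hj
      rcases a4 with ⟨b1, b2, b3⟩ | ⟨b1, b2, b3⟩
      · rw [b1] at hj
        rw [b2]
        exact hS.of_lt j hj
      · rw [b1] at hj
        rw [b2]
        rcases Nat.lt_succ_iff_lt_or_eq.1 hj with hj | rfl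
        · rw [Function.update_of_ne (by omega)]
          exact hS.of_lt j hj
        · rw [Function.update_self]
          exact ⟨x, b3.1, b3.2, rfl⟩
    · rw [hfil, Finset.sum_insert hxn]
      rcases a4 with ⟨b1, b2, b3⟩ | ⟨b1, b2, b3⟩
      · rw [b1, b2]
        exact hS.sum.trans (Nat.le_add_left _ _)
      · rw [b1, b2, Finset.sum_range_succ, Function.update_self, add_comm]
        refine Nat.add_le_add_left (le_trans (le_of_eq ?_) hS.sum) _
        refine Finset.sum_congr rfl fun j hj => ?_
        rw [Function.update_of_ne (Finset.mem_range.1 hj).ne]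
    · intro p hp hp'
      rcases a5 with ⟨b1, -⟩ | ⟨b1, -⟩
      · rw [b1]
        exact hS.mm_bound p hp hp'
      · rw [b1, Function.update_apply]
        split_ifs with h
        · omega
        · exact hS.mm_bound p hp hp'
    · intro y hy h h'
      rcases a5 with ⟨b1, b2⟩ | ⟨b1, b2, b3, b4⟩
      · rw [b1]
        rcases (hlt y).1 hy with hy | rfl
        · exact hS.mm_le y hy h h'
        · exact b2 h h'
      · rw [b1, Function.update_apply]
        rcases (hlt y).1 hy with hy | rfl
        · have := hS.mm_le y hy h h'
          split_ifs with he
          · rw [he] at this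
            omega
          · exact this
        · simp
    · intro p hp hp'
      rcases a5 with ⟨b1, -⟩ | ⟨b1, b2, b3, -⟩
      · rw [b1]
        exact hS.mm_mem p hp hp'
      · rw [b1, Function.update_apply]
        split_ifs with h
        · exact fun _ => ⟨x, b2, b3, h.symm, rfl⟩
        · exact hS.mm_mem p hp hp'
  have hxk : ((x : Fin I.n) : ℕ) = k := rfl
  rw [hxk] at hstep
  by_cases hin : T.L (s₂.reg regU) < v + 1 + 1 ∧ v + 1 < T.R (s₂.reg regU) + 1
  · refine Runs.straight hB rfl (by decide) hs₂ ?_ (hstep _ ?_ ?_ ?_ ?_ ?_)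
    all_goals simp [inc, hE₂.L, hE₂.R, hE₂.hl, hE₂.st, hv₂, hX₂, hH₂, hin, hpt₂, hcu₂, hmm₂]
    · omega
    · exact Or.inr (hmem.2 hin)
    · exact fun _ => hmem.2 hin
    · exact Or.inl fun _ h => absurd (hmem.2 hin) h
  · have hin' : ¬ (v + 1 < T.R (s₂.reg regU) + 1 ∧ T.L (s₂.reg regU) < v + 1 + 1) :=
      fun h => hin h.symm
    have hin'' : ¬ (v + 1 ≤ T.R (s₂.reg regU) ∧ T.L (s₂.reg regU) ≤ v + 1) :=
      fun h => hin ⟨by omega, by omega⟩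
    have hin3 : ¬ (v < T.R (s₂.reg regU) ∧ T.L (s₂.reg regU) ≤ v + 1) :=
      fun h => hin ⟨by omega, by omega⟩
    have hnm := fun h => hin (hmem.1 h)
    by_cases h0 : T.hl (T.st k) = 0
    · by_cases hR : T.R (T.st k) < s.arr arrMm (T.L (T.st k))
      · refine Runs.straight hB rfl (by decide) hs₂ ?_ (hstep _ ?_ ?_ ?_ ?_ ?_)
        all_goals simp [inc, hE₂.L, hE₂.R, hE₂.hl, hE₂.st, hv₂, hX₂, hH₂, hin', hin'', hin3, h0, hR,
          hpt₂, hcu₂, hmm₂, hany₂]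
        · omega
        · exact fun h => absurd h hnm
        · exact Or.inr hnm
      · refine Runs.straight hB rfl (by decide) hs₂ ?_ (hstep _ ?_ ?_ ?_ ?_ ?_)
        all_goals simp [inc, hE₂.L, hE₂.R, hE₂.hl, hE₂.st, hv₂, hX₂, hH₂, hin', hin'', hin3, h0, hR,
          hpt₂, hcu₂, hmm₂, hany₂]
        · omega
        · exact fun h => absurd h hnm
        · exact fun _ => not_lt.1 hR
    · refine Runs.straight hB rfl (by decide) hs₂ ?_ (hstep _ ?_ ?_ ?_ ?_ ?_)
      all_goals simp [inc, hE₂.L, hE₂.R, hE₂.hl, hE₂.st, hv₂, hX₂, hH₂, hin', hin'', hin3, h0,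
          hpt₂, hcu₂, hmm₂, hany₂]
      · omega
      · exact fun h => absurd h hnm
      · exact ⟨by omega, hnm⟩

include hI hT in
theorem runs_scanVars {s : State} (hs : Bdd M s) (hE : EnvAt I T s) {v : ℕ}
    (hv : s.reg regV = v + 1) (hvd : v < I.D.card) (hnM : I.n + 1 ≤ M)
    (hptr : ∀ x : Fin I.n, PtrOK I T x v (s.arr arrPt x))
    (hmm : ∀ p, 1 ≤ p → p ≤ I.D.card → s.arr arrMm p = I.D.card + 1) :
    Runs B M scanVars s (I.n * 200 + 50) (ScanInv I T v I.n) := by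
  refine Runs.seq (T₁ := 20) (T₂ := I.n * 200 + 30) (R := fun s₁ => s₁.reg regX = 0 ∧
    s₁.reg regH = 0 ∧ s₁.reg regAny = 0) ?_ (by omega) ?_
  · refine Runs.straight hB rfl (by decide) hs ?_ ?_ <;> simp
  rintro s₁ hs₁ hf₁ ⟨h1, h2, h3⟩
  have hE₁ := hE.frame hf₁ rfl rfl
  refine Runs.for hB (ScanInv I T v) I.n 150 rfl hs₁ ?_ ?_ ?_ (by simp only [Exp.cost]; omega)
  · refine ⟨h1, fun x h => absurd h (Nat.not_lt_zero _), fun x _ => ?_, ?_, by omega,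
      fun x h => absurd h (Nat.not_lt_zero _), fun j h => by omega, by simp [h2], fun p hp hp' => ?_,
      fun x h => absurd h (Nat.not_lt_zero _), fun p hp hp' h => ?_⟩
    · rw [hf₁.2 arrPt rfl]
      exact hptr x
    · simp [h3]
    · rw [hf₁.2 arrMm rfl, hmm p hp hp']
      omega
    · rw [hf₁.2 arrMm rfl, hmm p hp hp'] at h
      omega
  · intro k s₂ hk hf h
    simp [h.x, (hE₁.frame hf rfl rfl).n]
  · intro k s₂ hk hs₂ hf h
    exact runs_scanVar hB hI hT hs₂ (hE₁.frame hf rfl rfl)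
      ((hf.1 _ rfl).trans ((hf₁.1 _ rfl).trans hv)) hvd hk hnM h

/-! ### The jump tables -/

/-- The tables `nx`, `la`, and `cn` are correct at `p`. -/
structure JumpOK (F : Set (ℕ × ℕ)) (sg : ℕ → ℕ) (d : ℕ) (nx la cn : ℕ → ℕ) (p : ℕ) : Prop where
  bound : p < nx p ∧ nx p ≤ d + 1
  le : ∀ f ∈ F, p < f.1 → nx p ≤ f.2
  mem : nx p ≤ d → ∃ f ∈ F, p < f.1 ∧ f.2 = nx p
  chain : (la p = p ∧ cn p = 0 ∧ (nx p ≤ d → sg p < sg (nx p))) ∨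
    (nx p ≤ d ∧ sg (nx p) = sg p ∧ la p = la (nx p) ∧ cn p = cn (nx p) + 1)
  small : cn p + p ≤ d ∧ la p ≤ d

omit hB in
theorem JumpOK.congr {F : Set (ℕ × ℕ)} {sg nx la cn nx' la' cn' : ℕ → ℕ} {d p : ℕ}
    (h : JumpOK F sg d nx la cn p) (hn : ∀ q, p ≤ q → nx' q = nx q)
    (hl : ∀ q, p ≤ q → la' q = la q) (hc : ∀ q, p ≤ q → cn' q = cn q) :
    JumpOK F sg d nx' la' cn' p := by
  obtain ⟨h1, h2, h3, h4, h5⟩ := h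
  have hb := h1.1.le
  constructor
  · rwa [hn p le_rfl]
  · rwa [hn p le_rfl]
  · rwa [hn p le_rfl]
  · rwa [hn p le_rfl, hl p le_rfl, hc p le_rfl, hl _ hb, hc _ hb]
  · rwa [hl p le_rfl, hc p le_rfl]

/-- An interval that begins after `p` begins at `p + 1`, where `arrMm` knows its first right end, or
later, where `nx (p + 1)` does. So `nx p` is the minimum of the two. -/
theorem runs_jumps {s : State} (hs : Bdd M s) {d : ℕ} (hd : s.reg regD = d) (hdM : d + 1 ≤ M)
    {F : Set (ℕ × ℕ)} (hsg : ∀ p q, p ≤ q → q ≤ d → s.arr arrSg p ≤ s.arr arrSg q)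
    (hFb : ∀ f ∈ F, 1 ≤ f.1 ∧ f.1 ≤ d)
    (hb : ∀ p, 1 ≤ p → p ≤ d → p ≤ s.arr arrMm p ∧ s.arr arrMm p ≤ d + 1)
    (hle : ∀ f ∈ F, s.arr arrMm f.1 ≤ f.2)
    (hmem : ∀ p, 1 ≤ p → p ≤ d → s.arr arrMm p ≤ d → ∃ f ∈ F, f.1 = p ∧ f.2 = s.arr arrMm p) :
    Runs B M jumps s (d * 100 + 100) fun s' => ∀ p ≤ d,
      JumpOK F (s.arr arrSg) d (s'.arr arrNx) (s'.arr arrLa) (s'.arr arrCn) p := by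
  refine Runs.seq (T₁ := 40) (T₂ := d * 100 + 60) (R := fun s₁ => s₁.reg regP = d ∧
    JumpOK F (s.arr arrSg) d (s₁.arr arrNx) (s₁.arr arrLa) (s₁.arr arrCn) d) ?_ (by omega) ?_
  · refine Runs.straight hB rfl (by decide) hs ?_ ?_
    · simp [hd]; omega
    · refine ⟨by simp [hd], ?_⟩
      constructor
      · simp [hd]
      · intro f hf h
        have := (hFb f hf).2
        omega
      · simp [hd]
      · simp [hd]
      · simp [hd]
  rintro s₁ hs₁ hf₁ ⟨h1, h2⟩
  refine (Runs.for hB (fun k s₂ => s₂.reg regP = d - k ∧ ∀ p, d - k ≤ p → p ≤ d →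
    JumpOK F (s.arr arrSg) d (s₂.arr arrNx) (s₂.arr arrLa) (s₂.arr arrCn) p) d 90 rfl hs₁
    ?_ ?_ ?_ le_rfl).mono ?_ ?_
  · refine ⟨h1, fun p hp hp' => ?_⟩
    obtain rfl : p = d := by omega
    exact h2
  · rintro k s₂ hk hf ⟨h3, -⟩
    simp [h3]
    omega
  · rintro k s₂ hk hs₂ hf ⟨h3, h4⟩
    have hd₂ : s₂.reg regD = d := (hf.1 _ rfl).trans ((hf₁.1 _ rfl).trans hd)
    have hmm₂ : s₂.arr arrMm = s.arr arrMm := (hf.2 _ rfl).trans (hf₁.2 _ rfl)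
    have hsg₂ : s₂.arr arrSg = s.arr arrSg := (hf.2 _ rfl).trans (hf₁.2 _ rfl)
    obtain ⟨p, hp⟩ : ∃ p, d - k = p + 1 := ⟨d - k - 1, by omega⟩
    have hp' : d - (k + 1) = p := by omega
    rw [hp] at h3 h4
    rw [hp']
    have hJ := h4 (p + 1) le_rfl (by omega)
    have hbp := hb (p + 1) (by omega) (by omega)
    have hJb := hJ.bound
    refine Runs.seq (T₁ := 20) (T₂ := 70)
      (R := fun s₃ => s₃.reg regG = min (s.arr arrMm (p + 1)) (s₂.arr arrNx (p + 1))) ?_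
      (by omega) ?_
    · by_cases hc : s.arr arrMm (p + 1) < s₂.arr arrNx (p + 1)
      · refine Runs.straight hB rfl (by decide) hs₂ ?_ ?_
        · simp [h3, hmm₂, hc]; omega
        · simp [h3, hmm₂, hc, hc.le]
      · refine Runs.straight hB rfl (by decide) hs₂ ?_ ?_
        · simp [h3, hmm₂, hc]; omega
        · simp [h3, hmm₂, hc, not_lt.1 hc]
    intro s₃ hs₃ hf₃ hG
    have hd₃ : s₃.reg regD = d := (hf₃.1 _ rfl).trans hd₂
    have hP₃ : s₃.reg regP = p + 1 := (hf₃.1 _ rfl).trans h3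
    have hsg₃ : s₃.arr arrSg = s.arr arrSg := (hf₃.2 _ rfl).trans hsg₂
    have hnx₃ : s₃.arr arrNx = s₂.arr arrNx := hf₃.2 _ rfl
    have hla₃ : s₃.arr arrLa = s₂.arr arrLa := hf₃.2 _ rfl
    have hcn₃ : s₃.arr arrCn = s₂.arr arrCn := hf₃.2 _ rfl
    set g := min (s.arr arrMm (p + 1)) (s₂.arr arrNx (p + 1)) with hg
    have hgb : p < g ∧ g ≤ d + 1 := by omega
    have hgle : ∀ f ∈ F, p < f.1 → g ≤ f.2 := by
      intro f hf hpf
      rcases Nat.eq_or_lt_of_le (show p + 1 ≤ f.1 from hpf) with he | hl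
      · have := hle f hf
        rw [← he] at this
        exact (min_le_left _ _).trans this
      · exact (min_le_right _ _).trans (hJ.le f hf hl)
    have hgmem : g ≤ d → ∃ f ∈ F, p < f.1 ∧ f.2 = g := by
      intro hgd
      rcases min_choice (s.arr arrMm (p + 1)) (s₂.arr arrNx (p + 1)) with hc | hc
      · obtain ⟨f, hf, h5, h6⟩ := hmem (p + 1) (by omega) (by omega) (by omega)
        exact ⟨f, hf, by omega, by omega⟩
      · obtain ⟨f, hf, h5, h6⟩ := hJ.mem (by omega)
        exact ⟨f, hf, by omega, by omega⟩
    have hfin : ∀ s₄ : State, s₄.reg regP = p →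
        s₄.arr arrNx = Function.update (s₂.arr arrNx) p g →
        (∃ a c, s₄.arr arrLa = Function.update (s₂.arr arrLa) p a ∧
          s₄.arr arrCn = Function.update (s₂.arr arrCn) p c ∧
          ((a = p ∧ c = 0 ∧ (g ≤ d → s.arr arrSg p < s.arr arrSg g)) ∨
            (g ≤ d ∧ s.arr arrSg g = s.arr arrSg p ∧ a = s₂.arr arrLa g ∧
              c = s₂.arr arrCn g + 1))) →
        s₄.reg regP = p ∧ ∀ q, p ≤ q → q ≤ d →
          JumpOK F (s.arr arrSg) d (s₄.arr arrNx) (s₄.arr arrLa) (s₄.arr arrCn) q := by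
      rintro s₄ a1 a2 ⟨a, c, a3, a4, a5⟩
      refine ⟨a1, fun q hq hqd => ?_⟩
      rw [a2, a3, a4]
      rcases Nat.eq_or_lt_of_le hq with rfl | hq
      · constructor
        · simpa using hgb
        · simpa using hgle
        · simpa using hgmem
        · simp only [Function.update_self]
          rw [Function.update_of_ne (by omega), Function.update_of_ne (by omega)]
          exact a5
        · simp only [Function.update_self]
          rcases a5 with ⟨rfl, rfl, -⟩ | ⟨hgd, -, rfl, rfl⟩
          · omega
          · have := (h4 g (by omega) hgd).small
            omega
      · refine (h4 q hq hqd).congr ?_ ?_ ?_ <;>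
        · intro r hr
          rw [Function.update_of_ne (by omega)]
    by_cases hc : g ≤ d ∧ s.arr arrSg g = s.arr arrSg p
    · have hsm := (h4 g (by omega) hc.1).small
      have hc1 : g < d + 1 := by omega
      refine Runs.straight hB rfl (by decide) hs₃ ?_ (hfin _ ?_ ?_ ⟨_, _, ?_, ?_,
        Or.inr ⟨hc.1, hc.2, rfl, rfl⟩⟩)
      all_goals simp [hG, hP₃, hd₃, hsg₃, hnx₃, hla₃, hcn₃, hc, hc1]
      omega
    · have hc1 : ¬ (g < d + 1 ∧ s.arr arrSg g = s.arr arrSg p) := fun h => hc ⟨by omega, h.2⟩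
      have hc2 : ¬ (s.arr arrSg g = s.arr arrSg p ∧ g ≤ d) := fun h => hc h.symm
      refine Runs.straight hB rfl (by decide) hs₃ ?_ (hfin _ ?_ ?_ ⟨_, _, ?_, ?_,
        Or.inl ⟨rfl, rfl, fun hgd => ?_⟩⟩)
      -- Segment numbers are monotone, so a different number at `g` is a greater one.
      case refine_6 =>
        have := hsg p g hgb.1.le hgd
        by_contra hn
        exact hc ⟨hgd, by omega⟩
      all_goals simp [hG, hP₃, hd₃, hsg₃, hnx₃, hla₃, hcn₃, hc, hc1, hc2]
      omega
  · simp only [Exp.cost]; omega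
  · rintro s₂ - - ⟨-, h⟩ p hp
    exact h p (by omega) hp

end

end AtMostNValue

/-! ## The decision about a value -/
namespace AtMostNValue

open WordRAM Exp Prog

set_option linter.unusedSimpArgs false

theorem holds_encode_header {I : Instance} {a : ℕ → ℕ} (h : Holds a 0 I.encode) :
    a 0 = I.n ∧ a 1 = I.D.card ∧ a 2 = I.N.toNat ∧ a 3 = (-I.N).toNat := by
  rw [Instance.encode_eq, List.append_assoc, holds_append] at h
  exact ⟨h.1 0 (by simp), h.1 1 (by simp), h.1 2 (by simp), h.1 3 (by simp)⟩

theorem holds_encode_val {I : Instance} {a : ℕ → ℕ} (h : Holds a 0 I.encode) {p : ℕ} (h₁ : 1 ≤ p)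
    (h₂ : p ≤ I.D.card) : a (p + 3) = val I.D p := by
  rw [Instance.encode_eq, holds_append, holds_append] at h
  have := h.1.2 (p - 1) (by rw [Finset.length_sort]; omega)
  rw [val_eq h₁ h₂, ← this]
  congr 1
  simp
  omega

section

variable {I : Instance} {T : Tab} {M : ℕ}

/-- The domains without holes that do not contain the value of rank `v`. -/
def Tab.flat (T : Tab) (I : Instance) (v : ℕ) : Set (ℕ × ℕ) :=
  {f | ∃ x : Fin I.n, T.hl (T.st x) = 0 ∧ val I.D v ∉ I.dom x ∧ f = (T.L (T.st x), T.R (T.st x))}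

/-- The problem of the value of rank `v`. -/
abbrev Tab.sys (T : Tab) (I : Instance) (v H : ℕ) (nx la cn : ℕ → ℕ) : Sys :=
  I.sys v H T.st T.L T.R T.hl T.sg nx la cn

theorem Tab.WF.sys_wf (hT : T.WF I M) (hI : I.IsInput) {v H : ℕ} {nx la cn : ℕ → ℕ}
    (hJ : ∀ p ≤ I.D.card, JumpOK (T.flat I v) T.sg I.D.card nx la cn p) :
    (T.sys I v H nx la cn).WF where
  bound := by
    rintro t ⟨x, i, h0, hi, rfl⟩
    exact hT.parsed.bound hI x i hi
  succ := by
    rintro t ⟨x, i, h0, hi, rfl⟩ (h : 0 < T.hl (T.st x + i))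
    have h1 := hT.hl_add hI x hi
    have h2 := hT.hl_add hI x (i := i + 1) (by omega)
    refine ⟨⟨x, i + 1, h0, by omega, rfl⟩, ?_, hT.parsed.R_lt_L hI x i (i + 1) (by omega) (by omega)⟩
    change T.hl (T.st x + (i + 1)) + 1 = T.hl (T.st x + i)
    omega
  sgL := by
    rintro t p ⟨x, i, h0, hi, rfl⟩ h
    exact hT.sgL x i p h0 hi h
  sgR := by
    rintro t p ⟨x, i, h0, hi, rfl⟩ h h'
    exact hT.sgR x i p h0 hi h h'
  sg_mono := hT.sg_mono
  Fbound := by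
    rintro f ⟨x, h0, hx, rfl⟩
    exact hT.parsed.bound hI x 0 (Nat.zero_le _)
  nx_bound := fun p hp => (hJ p hp).bound
  nx_le := fun p hp => (hJ p hp).le
  nx_mem := fun p h hp => (hJ p hp).mem h
  chain := fun p hp => (hJ p hp).chain

/-- The extra mark at rank `1` leaves position `0` alone in its segment. -/
theorem Tab.WF.settled_zero (hT : T.WF I M) {v H : ℕ} {nx la cn : ℕ → ℕ}
    (hJ : JumpOK (T.flat I v) T.sg I.D.card nx la cn 0) :
    (T.sys I v H nx la cn).Settled 0 :=
  fun h => hT.sg_pos _ hJ.bound.1 h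

/-- `hl (st x)` is the number of intervals of the domain minus one, which is at most its number of
holes. -/
theorem Tab.WF.sum_hl_le (hT : T.WF I M) (hI : I.IsInput) :
    ∑ x : Fin I.n, T.hl (T.st x) ≤ I.holes := by
  refine Finset.sum_le_sum fun x _ => ?_
  have h1 := hT.parsed.hl_st hI x
  have h2 := Instance.length_iv_le hI x
  omega

/-- A bound on the time of a step of the search. -/
def stepBound (k : ℕ) : ℕ := 3 * ((4 * k + 2) * (k * 50 + 100) + 20) + k * 50 + 200

/-- The values of rank at most `v` have been tested. -/
structure TestInv (I : Instance) (T : Tab) (v : ℕ) (s : State) : Prop where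
  env : EnvAt I T s
  rank : s.reg regV = v
  ptr : ∀ x : Fin I.n, PtrOK I T x v (s.arr arrPt x)
  kp : ∀ p, 1 ≤ p → p ≤ v → (s.arr arrKp p ≠ 0 ↔ val I.D p ∈ I.enforceHAC.D)
  kept : s.reg regKept = (pre I.D I.enforceHAC.D v).card
  out : Holds (s.arr arrOut) 0 ([I.n, s.reg regKept, I.N.toNat, (-I.N).toNat] ++
    (pre I.D I.enforceHAC.D v).sort (· ≤ ·))

theorem enforceHAC_D_subset (I : Instance) : I.enforceHAC.D ⊆ I.D := by
  classical exact Finset.filter_subset _ _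

variable {B : ℕ} (hB : (M + 10) ^ 8 < B) (hI : I.IsInput)
  (hT : T.WF I M)

include hB

theorem runs_decideValue {s : State} (hs : Bdd M s) (hE : EnvAt I T s) {v : ℕ}
    (hv : s.reg regV = v + 1) (hvd : v < I.D.card) (hdM : I.D.card + 1 ≤ M)
    (hany : s.reg regAny ≠ 0 ↔ ∃ x, val I.D (v + 1) ∈ I.dom x)
    (hok : s.reg regOk ≠ 0 ↔ I.Good (val I.D (v + 1)))
    (hptr : ∀ x : Fin I.n, PtrOK I T x (v + 1) (s.arr arrPt x))
    (hkp : ∀ p, 1 ≤ p → p ≤ v → (s.arr arrKp p ≠ 0 ↔ val I.D p ∈ I.enforceHAC.D))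
    (hkept : s.reg regKept = (pre I.D I.enforceHAC.D v).card)
    (hout : Holds (s.arr arrOut) 0 ([I.n, s.reg regKept, I.N.toNat, (-I.N).toNat] ++
      (pre I.D I.enforceHAC.D v).sort (· ≤ ·))) :
    Runs B M decideValue s 60 (TestInv I T (v + 1)) := by
  -- The implication is what the first test of the program computes into `regOk`.
  have hmem : val I.D (v + 1) ∈ I.enforceHAC.D ↔ (s.reg regAny ≠ 0 → s.reg regOk ≠ 0) := by
    rw [Instance.mem_enforceHAC_D, hany, hok]
    exact and_iff_right (val_mem (by omega) (by omega))
  have hsub := enforceHAC_D_subset I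
  have hval := holds_encode_val hE.input (p := v + 1) (by omega) (by omega)
  have hcard : s.reg regKept + 1 ≤ M := by
    have := card_pre_le hsub v
    omega
  have hkp' : ∀ (f : ℕ → ℕ) (b : ℕ), (b ≠ 0 ↔ val I.D (v + 1) ∈ I.enforceHAC.D) →
      f = Function.update (s.arr arrKp) (v + 1) b →
      ∀ p, 1 ≤ p → p ≤ v + 1 → (f p ≠ 0 ↔ val I.D p ∈ I.enforceHAC.D) := by
    rintro f b hb rfl p hp hp'
    by_cases h : p = v + 1
    · rw [h, Function.update_self, hb]
    · rw [Function.update_of_ne h]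
      exact hkp p hp (by omega)
  refine Runs.seq (T₁ := 10) (T₂ := 50) (R := fun s₁ => s₁.reg regOk ≠ 0 ↔
    val I.D (v + 1) ∈ I.enforceHAC.D) ?_ (by omega) ?_
  · by_cases h0 : s.reg regAny = 0
    · refine Runs.straight hB rfl (by decide) hs ?_ ?_
      · simp [h0]; omega
      · rw [hmem]; simp [h0]
    · refine Runs.straight hB rfl (by decide) hs ?_ ?_
      · simp [h0]
      · rw [hmem]; simp [h0]
  intro s₁ hs₁ hf₁ hok₁
  have hE₁ := hE.frame hf₁ rfl rfl
  have hv₁ : s₁.reg regV = v + 1 := (hf₁.1 _ rfl).trans hv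
  have hK₁ : s₁.reg regKept = s.reg regKept := hf₁.1 _ rfl
  have hkp₁ : s₁.arr arrKp = s.arr arrKp := hf₁.2 _ rfl
  have hout₁ : s₁.arr arrOut = s.arr arrOut := hf₁.2 _ rfl
  have hpt₁ : s₁.arr arrPt = s.arr arrPt := hf₁.2 _ rfl
  by_cases h0 : s₁.reg regOk = 0
  · have hn : val I.D (v + 1) ∉ I.enforceHAC.D := fun h => hok₁.2 h h0
    have hpre := pre_succ_of_notMem hsub hn
    refine Runs.straight hB rfl (by decide) hs₁ ?_ ⟨?_, ?_, ?_, ?_, ?_, ?_⟩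
    · simp [h0]
    · exact ⟨by simp [h0, hE₁.n], by simp [h0, hE₁.d], by simp [h0, hE₁.lim],
        by simp [h0, hE₁.input], by simp [h0, hE₁.st], by simp [h0, hE₁.L], by simp [h0, hE₁.R],
        by simp [h0, hE₁.hl], by simp [h0, hE₁.sg]⟩
    · simp [h0, hv₁]
    · simpa [h0, hpt₁] using hptr
    · exact hkp' _ 0 (by simp [hn]) (by simp [h0, hv₁, hkp₁])
    · simp [h0, hK₁, hkept, hpre]
    · rw [hpre]
      simpa [h0, hK₁, hout₁] using hout
  · have hm : val I.D (v + 1) ∈ I.enforceHAC.D := hok₁.1 h0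
    have hpre := pre_succ_of_mem hsub hvd hm
    have hlt := lt_of_mem_pre hsub hvd
    have hnm : val I.D (v + 1) ∉ pre I.D I.enforceHAC.D v := fun h => lt_irrefl _ (hlt _ h)
    refine Runs.straight hB rfl (by decide) hs₁ ?_ ⟨?_, ?_, ?_, ?_, ?_, ?_⟩
    · have := hs₁.2 arrIn (v + 1 + 3)
      simp [inc, h0, hv₁, hK₁]
      omega
    · exact ⟨by simp [inc, h0, hE₁.n], by simp [inc, h0, hE₁.d], by simp [inc, h0, hE₁.lim],
        by simp [inc, h0, hE₁.input], by simp [inc, h0, hE₁.st], by simp [inc, h0, hE₁.L],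
        by simp [inc, h0, hE₁.R], by simp [inc, h0, hE₁.hl], by simp [inc, h0, hE₁.sg]⟩
    · simp [inc, h0, hv₁]
    · simpa [inc, h0, hpt₁] using hptr
    · exact hkp' _ 1 (by simp [hm]) (by simp [inc, h0, hv₁, hkp₁])
    · simp [inc, h0, hK₁, hkept, hpre, hnm]
    · rw [hpre, sort_insert_max hlt, ← List.append_assoc, holds_append]
      have hlen : ([I.n, s.reg regKept + 1, I.N.toNat, (-I.N).toNat] ++
          (pre I.D I.enforceHAC.D v).sort (· ≤ ·)).length = s.reg regKept + 4 := by
        simp [hkept]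
      have hreg : (Prog.step ((ite (reg regOk)
        (store arrKp (reg regV) (lit 1) ;;
          store arrOut (reg regKept ∔ lit 4) (get arrIn (reg regV ∔ lit 3)) ;; inc regKept 1 ;;
          store arrOut (lit 1) (reg regKept))
        (store arrKp (reg regV) (lit 0)))) s₁).reg regKept = s.reg regKept + 1 := by
        simp [inc, h0, hK₁]
      have harr : (Prog.step ((ite (reg regOk)
        (store arrKp (reg regV) (lit 1) ;;
          store arrOut (reg regKept ∔ lit 4) (get arrIn (reg regV ∔ lit 3)) ;; inc regKept 1 ;;
          store arrOut (lit 1) (reg regKept))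
        (store arrKp (reg regV) (lit 0)))) s₁).arr arrOut =
          Function.update (Function.update (s.arr arrOut) (s.reg regKept + 4) (val I.D (v + 1))) 1
            (s.reg regKept + 1) := by
        simp [inc, h0, hK₁, hv₁, hout₁, hE₁.input]
        rw [← holds_encode_val hE₁.input (p := v + 1) (by omega) (by omega)]
      rw [hreg, harr, hlen]
      constructor
      · intro i hi
        rw [hlen] at hi
        rcases eq_or_ne i 1 with rfl | h1
        · simp
        · rw [Nat.zero_add, Function.update_of_ne h1, Function.update_of_ne (by omega)]
          have := hout i (by simp [← hkept]; omega)
          rw [Nat.zero_add] at this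
          rw [this]
          match i, h1 with
          | 0, _ => rfl
          | i + 2, _ => rfl
      · intro i hi
        obtain rfl : i = 0 := by simpa using hi
        simp

include hI hT in
theorem runs_testValue {s : State} (hs : Bdd M s) {v : ℕ} (hvd : v < I.D.card)
    (hdM : I.D.card + 1 ≤ M) (hnM : I.n + 1 ≤ M) (hkM : I.holes + 1 ≤ M)
    (h : TestInv I T v s) :
    Runs B M testValue s
      (I.D.card * 150 + I.n * 200 + pot I.holes * stepBound I.holes + 400)
      (TestInv I T (v + 1)) := by
  refine Runs.seq (T₁ := 5) (R := fun s₁ => s₁.reg regV = v + 1)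
    (T₂ := I.D.card * 150 + I.n * 200 + pot I.holes * stepBound I.holes + 390) ?_ (by omega) ?_
  · refine Runs.straight hB rfl (by decide) hs ?_ ?_
    · simp [inc, h.rank]; omega
    · simp [inc, h.rank]
  intro s₁ hs₁ hf₁ hv₁
  have hE₁ := h.env.frame hf₁ rfl rfl
  refine Runs.seq (runs_resetMm hB hs₁ hE₁.d hdM)
    (T₂ := I.D.card * 100 + I.n * 200 + pot I.holes * stepBound I.holes + 340) (by omega) ?_
  intro s₂ hs₂ hf₂ hmm
  have hE₂ := hE₁.frame hf₂ rfl rfl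
  have hpt₂ : s₂.arr arrPt = s.arr arrPt := (hf₂.2 _ rfl).trans (hf₁.2 _ rfl)
  refine Runs.seq (runs_scanVars hB hI hT hs₂ hE₂ ((hf₂.1 _ rfl).trans hv₁) hvd hnM
    (fun x => by rw [hpt₂]; exact h.ptr x) hmm)
    (T₂ := I.D.card * 100 + pot I.holes * stepBound I.holes + 290) (by omega) ?_
  intro s₃ hs₃ hf₃ hS
  have hE₃ := hE₂.frame hf₃ rfl rfl
  have hJ := runs_jumps hB hs₃ hE₃.d hdM (F := T.flat I (v + 1))
    (fun p q h h' => by rw [hE₃.sg]; exact hT.sg_mono p q h h')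
    (fun f hf => by
      obtain ⟨x, h0, hx, rfl⟩ := hf
      have := hT.parsed.bound hI x 0 (Nat.zero_le _)
      rw [add_zero] at this
      exact ⟨this.1, this.2.1.trans this.2.2⟩)
    hS.mm_bound
    (fun f hf => by
      obtain ⟨x, h0, hx, rfl⟩ := hf
      exact hS.mm_le x x.2 h0 hx)
    (fun p h h' h'' => by
      obtain ⟨x, h0, hx, h1, h2⟩ := hS.mm_mem p h h' h''
      exact ⟨_, ⟨x, h0, hx, rfl⟩, h1, h2⟩)
  refine Runs.seq hJ (T₂ := pot I.holes * stepBound I.holes + 190) (by omega) ?_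
  intro s₄ hs₄ hf₄ hJ
  have hE₄ := hE₃.frame hf₄ rfl rfl
  rw [hE₃.sg] at hJ
  set ts := s₄.arr arrCu with hts
  have hts₃ : ts = s₃.arr arrCu := hf₄.2 _ rfl
  have hH₄ : s₄.reg regH = s₃.reg regH := hf₄.1 _ rfl
  set H := s₃.reg regH with hH
  set Y := T.sys I (v + 1) H (s₄.arr arrNx) (s₄.arr arrLa) (s₄.arr arrCn) with hY
  have hof := hS.of_lt
  rw [← hts₃] at hof
  have htracks : I.Tracks (v + 1) H T.st T.hl ts := by
    refine ⟨fun x h0 hx => ?_, hof⟩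
    rw [hts₃]
    exact hS.mem x x.2 h0 hx
  have hsum : ∑ j ∈ Finset.range H, T.hl (ts j) ≤ I.holes := by
    have h1 := hS.sum
    rw [Finset.filter_true_of_mem fun x _ => x.2] at h1
    rw [hts₃]
    exact h1.trans (hT.sum_hl_le hI)
  -- Every listed set has a hole, so the length of a row is at most the number of holes.
  have hHk : H ≤ I.holes := by
    refine le_trans ?_ hsum
    calc H = ∑ j ∈ Finset.range H, 1 := by simp
      _ ≤ _ := Finset.sum_le_sum fun j hj => by
        obtain ⟨x, h0, -, h1⟩ := hof j (Finset.mem_range.1 hj)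
        rw [h1]
        exact h0
  have hrest : Y.rest 0 ts ≤ I.holes := by
    refine le_trans (Finset.sum_le_sum fun j _ => ?_) hsum
    split_ifs
    · exact le_rfl
    · exact Nat.zero_le _
  have hvY : ∀ j < Y.H, Y.hv (ts j) := by
    intro j hj
    obtain ⟨x, h0, -, h1⟩ := hof j hj
    exact ⟨x, 0, h0, Nat.zero_le _, h1⟩
  have hSys : SysAt Y s₄ := ⟨hE₄.d, hH₄, hE₄.lim, hE₄.L, hE₄.R, hE₄.hl, rfl, rfl, rfl⟩
  have hsearch : Runs B M search s₄ (pot (Y.rest 0 ts) * stepTime Y + 30) fun s' =>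
      (s'.reg regOk ≠ 0 ↔ Y.Tot 0 0 ts) := runs_search hB (hT.sys_wf hI hJ) hs₄ hdM (show H + 1 ≤ M by omega)
    (by rintro t ⟨x, i, h0, hi, rfl⟩; exact hT.idx x i hi) hSys (fun j => rfl) hvY
    (hT.settled_zero (hJ 0 (Nat.zero_le _))) (show Y.rest 0 ts + 1 ≤ M by omega)
  -- A linear number of segments times a linear row length makes each search step quadratic in the
  -- number of holes.
  have hstep : stepTime Y ≤ stepBound I.holes := by
    have h1 : (T.sg I.D.card + 1) * (H * 50 + 100) ≤ (4 * I.holes + 2) * (I.holes * 50 + 100) :=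
      Nat.mul_le_mul (by have := hT.sg_le; omega) (by omega)
    change 3 * ((T.sg I.D.card + 1) * (H * 50 + 100) + 20) + H * 50 + 200 ≤ _
    unfold stepBound
    omega
  have htime := Nat.mul_le_mul (pot_mono hrest) hstep
  refine Runs.seq hsearch (T₂ := 60) (by omega) ?_
  intro s₅ hs₅ hf₅ hok
  rw [I.tot_iff_good hI hT.parsed htracks] at hok
  have hE₅ := hE₄.frame hf₅ rfl rfl
  have hK₅ : s₅.reg regKept = s.reg regKept :=
    (hf₅.1 _ rfl).trans ((hf₄.1 _ rfl).trans ((hf₃.1 _ rfl).trans ((hf₂.1 _ rfl).trans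
      (hf₁.1 _ rfl))))
  have hkp₅ : s₅.arr arrKp = s.arr arrKp :=
    (hf₅.2 _ rfl).trans ((hf₄.2 _ rfl).trans ((hf₃.2 _ rfl).trans ((hf₂.2 _ rfl).trans
      (hf₁.2 _ rfl))))
  have hout₅ : s₅.arr arrOut = s.arr arrOut :=
    (hf₅.2 _ rfl).trans ((hf₄.2 _ rfl).trans ((hf₃.2 _ rfl).trans ((hf₂.2 _ rfl).trans
      (hf₁.2 _ rfl))))
  have hv₅ : s₅.reg regV = v + 1 :=
    (hf₅.1 _ rfl).trans ((hf₄.1 _ rfl).trans ((hf₃.1 _ rfl).trans ((hf₂.1 _ rfl).trans hv₁)))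
  have hpt₅ : s₅.arr arrPt = s₃.arr arrPt := (hf₅.2 _ rfl).trans (hf₄.2 _ rfl)
  have hany₅ : s₅.reg regAny = s₃.reg regAny := (hf₅.1 _ rfl).trans (hf₄.1 _ rfl)
  refine runs_decideValue hB hs₅ hE₅ hv₅ hvd hdM ?_ hok ?_ ?_ ?_ ?_
  · rw [hany₅, hS.any]
    exact ⟨fun ⟨x, _, h⟩ => ⟨x, h⟩, fun ⟨x, h⟩ => ⟨x, x.2, h⟩⟩
  · intro x
    rw [hpt₅]
    exact hS.ptr x x.2
  · rw [hkp₅]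
    exact h.kp
  · rw [hK₅]
    exact h.kept
  · rw [hK₅, hout₅]
    exact h.out

include hI hT in
theorem runs_testValues {s : State} (hs : Bdd M s) (hdM : I.D.card + 1 ≤ M) (hnM : I.n + 1 ≤ M)
    (hkM : I.holes + 1 ≤ M) (h : TestInv I T 0 s) :
    Runs B M testValues s
      (I.D.card * (I.D.card * 150 + I.n * 200 + pot I.holes * stepBound I.holes + 410) + 10)
      (TestInv I T I.D.card) := by
  refine Runs.for hB (TestInv I T) I.D.card
    (I.D.card * 150 + I.n * 200 + pot I.holes * stepBound I.holes + 400) rfl hs h ?_ ?_ ?_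
  · intro k s₁ hk hf h
    simp [h.rank, h.env.d]
  · intro k s₁ hk hs₁ hf h
    exact runs_testValue hB hI hT hs₁ hk hdM hnM hkM h
  · simp only [Exp.cost]
    rw [add_assoc (I.D.card * _) (1 + 1 + 1) 1]
    exact Nat.add_le_add (Nat.mul_le_mul_left _ (by omega)) (by norm_num)

end

end AtMostNValue

/-! ## The output -/
namespace AtMostNValue

open WordRAM Exp Prog

set_option linter.unusedSimpArgs false

theorem length_flatMap_pair (A : List (ℕ × ℕ)) :
    (A.flatMap fun p => [p.1, p.2]).length = 2 * A.length := by
  simp [List.length_flatMap, mul_comm]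

/-- The two endpoints are appended behind the list, and the count at its head is overwritten. -/
theorem Holds.push_interval {a : ℕ → ℕ} {l : List ℕ} {A : List (ℕ × ℕ)} {o v : ℕ}
    (h : Holds a 0 (l ++ A.length :: A.flatMap fun p => [p.1, p.2]))
    (ho : o = l.length + 1 + 2 * A.length) :
    Holds (Function.update (Function.update (Function.update a o v) (o + 1) v) l.length
      (A.length + 1)) 0
      (l ++ (A ++ [(v, v)]).length :: (A ++ [(v, v)]).flatMap fun p => [p.1, p.2]) := by
  have hA := length_flatMap_pair A
  rw [holds_append, holds_cons, Nat.zero_add] at h ⊢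
  rw [List.flatMap_append, holds_append, List.flatMap_singleton, holds_cons, holds_cons, hA]
  refine ⟨?_, ?_, ?_, ?_, ?_, holds_nil _ _⟩
  · exact ((h.1.update (Or.inr (by omega))).update (Or.inr (by omega))).update (Or.inr (by omega))
  · simp
  · exact ((h.2.2.update (Or.inr (by omega))).update (Or.inr (by omega))).update (Or.inl (by omega))
  · rw [Function.update_of_ne (by omega), Function.update_of_ne (by omega), ho,
      Function.update_self]
  · rw [Function.update_of_ne (by omega), ho, Function.update_self]

/-- Since `o` is the next free cell, `o - 1` holds the right endpoint of the last interval. -/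
theorem Holds.extend_interval {a : ℕ → ℕ} {l : List ℕ} {A : List (ℕ × ℕ)} {o u y v : ℕ}
    (h : Holds a 0 (l ++ (A ++ [(u, y)]).length :: (A ++ [(u, y)]).flatMap fun p => [p.1, p.2]))
    (ho : o = l.length + 1 + 2 * (A ++ [(u, y)]).length) :
    Holds (Function.update a (o - 1) v) 0
      (l ++ (A ++ [(u, v)]).length :: (A ++ [(u, v)]).flatMap fun p => [p.1, p.2]) := by
  have hA := length_flatMap_pair A
  simp only [List.length_append, List.length_singleton] at ho h ⊢
  rw [holds_append, holds_cons, Nat.zero_add, List.flatMap_append, holds_append,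
    List.flatMap_singleton, holds_cons, holds_cons, hA] at h ⊢
  refine ⟨?_, ?_, ?_, ?_, ?_, holds_nil _ _⟩
  · exact h.1.update (Or.inr (by omega))
  · rw [Function.update_of_ne (by omega), h.2.1]
  · exact h.2.2.1.update (Or.inr (by omega))
  · rw [Function.update_of_ne (by omega), h.2.2.2.1]
  · rw [show o - 1 = l.length + 1 + 2 * A.length + 1 by omega, Function.update_self]

theorem length_intervals_le {D S : Finset ℕ} (hS : S ⊆ D) : (intervals D S).length ≤ S.card := by
  rw [(intervalsSpec hS).length]
  exact Finset.card_le_card (Finset.filter_subset _ _)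

/-- The domain `x` has been written as far as values of rank at most `p` are concerned; `l` is the
output before. -/
structure WriteInv (I : Instance) (T : Tab) (x : Fin I.n) (l : List ℕ) (p : ℕ) (s : State) :
    Prop where
  rank : s.reg regV = p
  ptr : PtrOK I T x p (s.reg regU)
  head : s.reg regHead = l.length
  cnt : s.reg regCnt = (intervals (pre I.D I.enforceHAC.D p)
    (pre I.D (I.enforceHAC.dom x) p)).length
  out : s.reg regOut = l.length + 1 + 2 * s.reg regCnt
  holds : Holds (s.arr arrOut) 0 (l ++ encodeDom (pre I.D I.enforceHAC.D p)
    (pre I.D (I.enforceHAC.dom x) p))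
  old : s.reg regPrev ≠ 0 → ∃ y ∈ pre I.D (I.enforceHAC.dom x) p,
    ∀ z ∈ pre I.D I.enforceHAC.D p, z ≤ y
  new : s.reg regPrev = 0 → ∀ u ∈ pre I.D (I.enforceHAC.dom x) p,
    ∃ z ∈ pre I.D I.enforceHAC.D p \ pre I.D (I.enforceHAC.dom x) p, u < z

section

variable {I : Instance} {T : Tab} {M B : ℕ} (hB : (M + 10) ^ 8 < B) (hI : I.IsInput)
  (hT : T.WF I M)

include hB hI hT

/-- Ranks refer to the old values, whereas holes are relative to the kept ones. A kept value opens
an interval, extends the last one, or is itself missing from the domain; these are the three lemmas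
on appending a largest value. -/
theorem runs_writeStep {s : State} (hs : Bdd M s) (hE : EnvAt I T s)
    (hkp : ∀ p, 1 ≤ p → p ≤ I.D.card → (s.arr arrKp p ≠ 0 ↔ val I.D p ∈ I.enforceHAC.D))
    {x : Fin I.n} {l : List ℕ} {p : ℕ} (hp : p < I.D.card)
    (hlM : l.length + 1 + 2 * I.D.card + 1 ≤ M) (h : WriteInv I T x l p s) :
    Runs B M writeStep s 120 (WriteInv I T x l (p + 1)) := by
  have hdomD : I.enforceHAC.dom x ⊆ I.D := by
    rw [Instance.enforceHAC_dom hI]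
    exact Finset.inter_subset_left.trans (hI.2 x).2
  have hdomD' : I.enforceHAC.dom x ⊆ I.enforceHAC.D := by
    rw [Instance.enforceHAC_dom hI]
    exact Finset.inter_subset_right
  have hD' := enforceHAC_D_subset I
  have hlt := lt_of_mem_pre hD' hp
  have hsub : pre I.D (I.enforceHAC.dom x) p ⊆ pre I.D I.enforceHAC.D p := pre_subset_pre hdomD' p
  have hspec := intervalsSpec hsub
  have hlen : s.reg regCnt ≤ p := by
    rw [h.cnt]
    exact (length_intervals_le hsub).trans (card_pre_le hdomD p)
  have hout := h.out
  refine Runs.seq (T₁ := 5) (R := fun s₁ => s₁.reg regV = p + 1) (T₂ := 115) ?_ (by omega) ?_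
  · refine Runs.straight hB rfl (by decide) hs ?_ ?_
    · simp [inc, h.rank]; omega
    · simp [inc, h.rank]
  intro s₁ hs₁ hf₁ hv₁
  have hU₁ : s₁.reg regU = s.reg regU := hf₁.1 _ rfl
  refine Runs.seq (runs_movePtr hB hI hT hs₁ (hE.frame hf₁ rfl rfl) (x := x) (v := p) hv₁
    (hU₁ ▸ h.ptr)) (T₂ := 95) (by omega) ?_
  intro s₂ hs₂ hf₂ hptr
  have hE₂ := (hE.frame hf₁ rfl rfl).frame hf₂ rfl rfl
  have hv₂ : s₂.reg regV = p + 1 := (hf₂.1 _ rfl).trans hv₁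
  have hH₂ : s₂.reg regHead = s.reg regHead := (hf₂.1 _ rfl).trans (hf₁.1 _ rfl)
  have hC₂ : s₂.reg regCnt = s.reg regCnt := (hf₂.1 _ rfl).trans (hf₁.1 _ rfl)
  have hO₂ : s₂.reg regOut = s.reg regOut := (hf₂.1 _ rfl).trans (hf₁.1 _ rfl)
  have hP₂ : s₂.reg regPrev = s.reg regPrev := (hf₂.1 _ rfl).trans (hf₁.1 _ rfl)
  have ho₂ : s₂.arr arrOut = s.arr arrOut := (hf₂.2 _ rfl).trans (hf₁.2 _ rfl)
  have hk₂ : s₂.arr arrKp = s.arr arrKp := (hf₂.2 _ rfl).trans (hf₁.2 _ rfl)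
  have hkp' := hkp (p + 1) (by omega) (by omega)
  have hmem := hptr.mem_dom_iff hI hT (by omega) (by omega)
  have hvalM : val I.D (p + 1) ≤ M := by
    rw [← holds_encode_val hE.input (by omega) (by omega)]
    exact hs.2 _ _
  have hval : s₂.arr arrIn (p + 4) = val I.D (p + 1) :=
    holds_encode_val hE₂.input (by omega) (by omega)
  set w := val I.D (p + 1) with hw
  by_cases hk : s.arr arrKp (p + 1) = 0
  · have hn : w ∉ I.enforceHAC.D := fun h => hkp'.2 h hk
    have e1 := pre_succ_of_notMem hD' hn
    have e2 := pre_succ_of_notMem hdomD (fun h => hn (hdomD' h))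
    refine Runs.straight hB rfl (by decide) hs₂ ?_ ⟨?_, ?_, ?_, ?_, ?_, ?_, ?_, ?_⟩
    · simp [hk₂, hv₂, hk]
    · simp [hk₂, hv₂, hk]
    · simpa [hk₂, hv₂, hk] using hptr
    · simpa [hk₂, hv₂, hk, hH₂] using h.head
    · rw [e1, e2]; simpa [hk₂, hv₂, hk, hC₂] using h.cnt
    · simpa [hk₂, hv₂, hk, hO₂, hC₂] using h.out
    · rw [e1, e2]; simpa [hk₂, hv₂, hk, ho₂] using h.holds
    · rw [e1, e2]; simpa [hk₂, hv₂, hk, hP₂] using h.old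
    · rw [e1, e2]; simpa [hk₂, hv₂, hk, hP₂] using h.new
  have hkD : w ∈ I.enforceHAC.D := hkp'.1 hk
  have e1 : pre I.D I.enforceHAC.D (p + 1) = insert w (pre I.D I.enforceHAC.D p) :=
    pre_succ_of_mem hD' hp hkD
  by_cases hin : T.L (s₂.reg regU) < p + 1 + 1 ∧ p + 1 < T.R (s₂.reg regU) + 1
  · have hx : w ∈ I.enforceHAC.dom x := by
      rw [Instance.enforceHAC_dom hI, Finset.mem_inter]
      exact ⟨hmem.2 hin, hkD⟩
    have e2 : pre I.D (I.enforceHAC.dom x) (p + 1) =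
      insert w (pre I.D (I.enforceHAC.dom x) p) := pre_succ_of_mem hdomD hp hx
    have hin1 : T.L (s₂.reg regU) ≤ p + 1 := by omega
    have hin2 : p + 1 ≤ T.R (s₂.reg regU) := by omega
    have hold : ∃ y ∈ insert w (pre I.D (I.enforceHAC.dom x) p),
        ∀ z ∈ insert w (pre I.D I.enforceHAC.D p), z ≤ y := by
      refine ⟨w, Finset.mem_insert_self _ _, fun z hz => ?_⟩
      rcases Finset.mem_insert.1 hz with rfl | hz
      · exact le_rfl
      · exact (hlt z hz).le
    by_cases hprev : s.reg regPrev = 0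
    · have e3 := intervals_insert_new hlt hsub hspec.card (h.new hprev)
      have hholds := Holds.push_interval (v := w) h.holds (h.cnt ▸ h.out)
      rw [← h.cnt, ← h.head] at hholds
      refine Runs.straight hB rfl (by decide) hs₂ ?_ ⟨?_, ?_, ?_, ?_, ?_, ?_, ?_, ?_⟩
      · simp [inc, hk₂, hv₂, hk, hE₂.L, hE₂.R, hin1, hin2, hin, hP₂, hprev, hO₂, hC₂, hval]
        omega
      · simp [inc, hk₂, hv₂, hk, hE₂.L, hE₂.R, hin1, hin2, hin, hP₂, hprev]
      · simpa [inc, hk₂, hv₂, hk, hE₂.L, hE₂.R, hin1, hin2, hin, hP₂, hprev] using hptr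
      · simpa [inc, hk₂, hv₂, hk, hE₂.L, hE₂.R, hin1, hin2, hin, hP₂, hprev, hH₂] using h.head
      · rw [e1, e2, e3]
        simpa [inc, hk₂, hv₂, hk, hE₂.L, hE₂.R, hin1, hin2, hin, hP₂, hprev, hC₂] using h.cnt
      · simp [inc, hk₂, hv₂, hk, hE₂.L, hE₂.R, hin1, hin2, hin, hP₂, hprev, hC₂, hO₂]
        omega
      · rw [e1, e2, encodeDom, e3]
        simpa [inc, hk₂, hv₂, hk, hE₂.L, hE₂.R, hin1, hin2, hin, hP₂, hprev, hC₂, hO₂, hH₂, hval,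
          ho₂] using hholds
      · rw [e1, e2]
        exact fun _ => hold
      · simp [inc, hk₂, hv₂, hk, hE₂.L, hE₂.R, hin1, hin2, hin, hP₂, hprev]
    · obtain ⟨y, hyS, hy⟩ := h.old hprev
      obtain ⟨A, u, e3, e4⟩ := intervals_insert_ext hlt hsub hyS hy hspec.card
      have hholds := h.holds
      rw [encodeDom, e3] at hholds
      have hcnt := h.cnt
      rw [e3] at hcnt
      have hholds := hholds.extend_interval (v := w) (hcnt ▸ h.out)
      refine Runs.straight hB rfl (by decide) hs₂ ?_ ⟨?_, ?_, ?_, ?_, ?_, ?_, ?_, ?_⟩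
      · simp [inc, hk₂, hv₂, hk, hE₂.L, hE₂.R, hin1, hin2, hin, hP₂, hprev, hO₂, hC₂, hval]
        omega
      · simp [inc, hk₂, hv₂, hk, hE₂.L, hE₂.R, hin1, hin2, hin, hP₂, hprev]
      · simpa [inc, hk₂, hv₂, hk, hE₂.L, hE₂.R, hin1, hin2, hin, hP₂, hprev] using hptr
      · simpa [inc, hk₂, hv₂, hk, hE₂.L, hE₂.R, hin1, hin2, hin, hP₂, hprev, hH₂] using h.head
      · rw [e1, e2, e4]
        simpa [inc, hk₂, hv₂, hk, hE₂.L, hE₂.R, hin1, hin2, hin, hP₂, hprev, hC₂] using hcnt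
      · simpa [inc, hk₂, hv₂, hk, hE₂.L, hE₂.R, hin1, hin2, hin, hP₂, hprev, hC₂, hO₂] using h.out
      · rw [e1, e2, encodeDom, e4]
        simpa [inc, hk₂, hv₂, hk, hE₂.L, hE₂.R, hin1, hin2, hin, hP₂, hprev, hC₂, hO₂, hH₂, hval,
          ho₂] using hholds
      · rw [e1, e2]
        exact fun _ => hold
      · simp [inc, hk₂, hv₂, hk, hE₂.L, hE₂.R, hin1, hin2, hin, hP₂, hprev]
  · have hx : w ∉ I.enforceHAC.dom x := by
      rw [Instance.enforceHAC_dom hI, Finset.mem_inter]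
      exact fun h => hin (hmem.1 h.1)
    have e2 : pre I.D (I.enforceHAC.dom x) (p + 1) = pre I.D (I.enforceHAC.dom x) p :=
      pre_succ_of_notMem hdomD hx
    have e3 := intervals_insert_of_notMem hlt hsub
    have hin1 : ¬ (p + 1 < T.R (s₂.reg regU) + 1 ∧ T.L (s₂.reg regU) < p + 1 + 1) :=
      fun h => hin h.symm
    have hin2 : ¬ (p + 1 ≤ T.R (s₂.reg regU) ∧ T.L (s₂.reg regU) ≤ p + 1) :=
      fun h => hin ⟨by omega, by omega⟩
    have hin3 : ¬ (p < T.R (s₂.reg regU) ∧ T.L (s₂.reg regU) ≤ p + 1) :=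
      fun h => hin ⟨by omega, by omega⟩
    refine Runs.straight hB rfl (by decide) hs₂ ?_ ⟨?_, ?_, ?_, ?_, ?_, ?_, ?_, ?_⟩
    · simp [inc, hk₂, hv₂, hk, hE₂.L, hE₂.R, hin1, hin2, hin3, hin]
    · simp [inc, hk₂, hv₂, hk, hE₂.L, hE₂.R, hin1, hin2, hin3, hin]
    · simpa [inc, hk₂, hv₂, hk, hE₂.L, hE₂.R, hin1, hin2, hin3, hin] using hptr
    · simpa [inc, hk₂, hv₂, hk, hE₂.L, hE₂.R, hin1, hin2, hin3, hin, hH₂] using h.head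
    · rw [e1, e2, e3]
      simpa [inc, hk₂, hv₂, hk, hE₂.L, hE₂.R, hin1, hin2, hin3, hin, hC₂] using h.cnt
    · simpa [inc, hk₂, hv₂, hk, hE₂.L, hE₂.R, hin1, hin2, hin3, hin, hC₂, hO₂] using h.out
    · have := h.holds
      rw [encodeDom] at this
      rw [e1, e2, encodeDom, e3]
      simpa [inc, hk₂, hv₂, hk, hE₂.L, hE₂.R, hin1, hin2, hin3, hin, ho₂] using this
    · simp [inc, hk₂, hv₂, hk, hE₂.L, hE₂.R, hin1, hin2, hin3, hin]
    · rw [e1, e2]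
      intro _ u hu
      refine ⟨w, Finset.mem_sdiff.2 ⟨Finset.mem_insert_self _ _, fun h => ?_⟩, hlt u (hsub hu)⟩
      exact lt_irrefl _ (hlt w (hsub h))

theorem runs_writeDom {s : State} (hs : Bdd M s) (hE : EnvAt I T s)
    (hkp : ∀ p, 1 ≤ p → p ≤ I.D.card → (s.arr arrKp p ≠ 0 ↔ val I.D p ∈ I.enforceHAC.D))
    (x : Fin I.n) (hx : s.reg regX = x) (hnM : I.n ≤ M) {l : List ℕ} (hl : s.reg regOut = l.length)
    (hlM : l.length + 1 + 2 * I.D.card + 1 ≤ M) (h : Holds (s.arr arrOut) 0 l) :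
    Runs B M writeDom s (I.D.card * 130 + 60) fun s' =>
      s'.reg regX = x + 1 ∧
      s'.reg regOut = (l ++ encodeDom I.enforceHAC.D (I.enforceHAC.dom x)).length ∧
      Holds (s'.arr arrOut) 0 (l ++ encodeDom I.enforceHAC.D (I.enforceHAC.dom x)) ∧
      (encodeDom I.enforceHAC.D (I.enforceHAC.dom x)).length ≤ 1 + 2 * I.D.card := by
  have hdomD : I.enforceHAC.dom x ⊆ I.D := by
    rw [Instance.enforceHAC_dom hI]
    exact Finset.inter_subset_left.trans (hI.2 x).2
  have hdomD' : I.enforceHAC.dom x ⊆ I.enforceHAC.D := by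
    rw [Instance.enforceHAC_dom hI]
    exact Finset.inter_subset_right
  refine Runs.seq (T₁ := 40) (T₂ := I.D.card * 130 + 20) (R := WriteInv I T x l 0) ?_ (by omega) ?_
  · refine Runs.straight hB rfl (by decide) hs ?_ ⟨?_, ?_, ?_, ?_, ?_, ?_, ?_, ?_⟩
    · have := hs.2 arrSt x
      simp [writeDomHead, inc, hl, hx]
      omega
    · simp [writeDomHead, inc]
    · simpa [writeDomHead, inc, hx, hE.st] using ptrOK_zero I T x
    · simp [writeDomHead, inc, hl]
    · simp [writeDomHead, inc, pre_zero, intervals_empty]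
    · simp [writeDomHead, inc, hl]
    · rw [holds_append]
      constructor
      · simpa [writeDomHead, inc, hl] using h.update (Or.inr (by omega))
      · simp [writeDomHead, inc, hl, pre_zero, encodeDom, intervals_empty, holds_cons, holds_nil]
    · simp [writeDomHead, inc]
    · simp [writeDomHead, inc, pre_zero]
  intro s₁ hs₁ hf₁ h₁
  refine Runs.seq (T₁ := I.D.card * 130 + 10) (T₂ := 10) (R := WriteInv I T x l I.D.card) ?_
    (by omega) ?_
  · refine Runs.for hB (WriteInv I T x l) I.D.card 120 rfl hs₁ h₁ ?_ ?_ ?_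
    · intro k s₂ hk hf h₂
      simp [h₂.rank, ((hE.frame hf₁ rfl rfl).frame hf rfl rfl).d]
    · intro k s₂ hk hs₂ hf h₂
      refine runs_writeStep hB hI hT hs₂ ((hE.frame hf₁ rfl rfl).frame hf rfl rfl) ?_ hk hlM h₂
      rw [hf.2 arrKp rfl, hf₁.2 arrKp rfl]
      exact hkp
    · simp only [Exp.cost]
      omega
  intro s₂ hs₂ hf₂ h₂
  have hx₂ : s₂.reg regX = x := (hf₂.1 _ rfl).trans ((hf₁.1 _ rfl).trans hx)
  have hholds := h₂.holds
  have hcnt := h₂.cnt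
  have hout := h₂.out
  rw [pre_card hdomD, pre_card (enforceHAC_D_subset I)] at hholds hcnt
  have hlen := Instance.length_encodeDom I.enforceHAC.D (I.enforceHAC.dom x)
  have hle := (length_intervals_le hdomD').trans (Finset.card_le_card hdomD)
  have := x.2
  refine Runs.straight hB rfl (by decide) hs₂ ?_ ⟨?_, ?_, ?_, ?_⟩
  · simp [inc, hx₂]; omega
  · simp [inc, hx₂]
  · simp [inc, hlen]; omega
  · simpa [inc] using hholds
  · omega

theorem runs_writeDoms {s : State} (hs : Bdd M s) (h : TestInv I T I.D.card s)
    (hM : 10 + I.D.card + (I.n + 1) * (1 + 2 * I.D.card) ≤ M) :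
    Runs B M writeDoms s (I.n * (I.D.card * 130 + 70) + 30) fun s' =>
      s'.HasOutput I.enforceHAC.encode := by
  have hnM : I.n ≤ M := by nlinarith
  have hsort : ((I.enforceHAC.D).sort (· ≤ ·)).length = s.reg regKept := by
    rw [h.kept, pre_card (enforceHAC_D_subset I), Finset.length_sort]
  have hkept : s.reg regKept ≤ I.D.card := by
    rw [h.kept]
    exact card_pre_le (enforceHAC_D_subset I) _
  have hout := h.out
  rw [pre_card (enforceHAC_D_subset I)] at hout
  set hd := [I.n, s.reg regKept, I.N.toNat, (-I.N).toNat] ++ (I.enforceHAC.D).sort (· ≤ ·) with hhd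
  have hhdl : hd.length = s.reg regKept + 4 := by
    rw [hhd, List.length_append, hsort]
    simp [add_comm]
  refine Runs.seq (T₁ := 20) (T₂ := I.n * (I.D.card * 130 + 70) + 10) (R := fun s₁ =>
    s₁.reg regOut = hd.length ∧ s₁.reg regX = 0) ?_ (by omega) ?_
  · refine Runs.straight hB rfl (by decide) hs ?_ ?_
    · simp; nlinarith
    · simp [hhdl]
  rintro s₁ hs₁ hf₁ ⟨h1, h2⟩
  have hE₁ := h.env.frame hf₁ rfl rfl
  have hdoms : ∀ {k : ℕ} (hk : k < I.n), hd ++ I.enforceHAC.encodeDoms (k + 1) =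
      hd ++ I.enforceHAC.encodeDoms k ++
        encodeDom I.enforceHAC.D (I.enforceHAC.dom (⟨k, hk⟩ : Fin I.n)) := by
    intro k hk
    rw [Instance.encodeDoms_succ I.enforceHAC hk]
    exact (List.append_assoc hd _ _).symm
  refine (Runs.for hB (fun k s₂ => s₂.reg regX = k ∧
    s₂.reg regOut = (hd ++ I.enforceHAC.encodeDoms k).length ∧
    Holds (s₂.arr arrOut) 0 (hd ++ I.enforceHAC.encodeDoms k) ∧
    (hd ++ I.enforceHAC.encodeDoms k).length ≤ 4 + I.D.card + k * (1 + 2 * I.D.card)) I.n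
    (I.D.card * 130 + 60) rfl hs₁ ?_ ?_ ?_ (T := I.n * (I.D.card * 130 + 70) + 10) ?_).mono le_rfl
    ?_
  · refine ⟨h2, ?_, ?_, ?_⟩ <;> rw [Instance.encodeDoms_zero, List.append_nil]
    · exact h1
    · rw [hf₁.2 arrOut rfl]
      exact hout
    · omega
  · rintro k s₂ hk hf ⟨h3, -⟩
    simp [h3, (hE₁.frame hf rfl rfl).n]
  · rintro k s₂ hk hs₂ hf ⟨h3, h4, h5, h6⟩
    have hkn : (k + 1) * (1 + 2 * I.D.card) ≤ (I.n + 1) * (1 + 2 * I.D.card) :=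
      Nat.mul_le_mul_right _ (by omega)
    rw [Nat.add_mul k 1, Nat.one_mul] at hkn
    refine (runs_writeDom hB hI hT hs₂ (hE₁.frame hf rfl rfl) ?_ (⟨k, hk⟩ : Fin I.n) h3 hnM h4
      (by omega) h5).mono le_rfl ?_
    · rw [hf.2 arrKp rfl, hf₁.2 arrKp rfl]
      exact h.kp
    · rintro s₃ - - ⟨a1, a2, a3, a4⟩
      rw [hdoms hk]
      refine ⟨a1, a2, a3, ?_⟩
      rw [List.length_append, Nat.add_mul k 1, Nat.one_mul]
      omega
  · simp only [Exp.cost]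
    rw [add_assoc (I.n * _) (1 + 1 + 1) 1]
    exact Nat.add_le_add (Nat.mul_le_mul_left _ (by omega)) (by norm_num)
  · rintro s₂ - - ⟨-, -, h3, -⟩ i hi
    have he : I.enforceHAC.encode = hd ++ I.enforceHAC.encodeDoms I.n := by
      rw [Instance.encode_eq, hhd, ← hsort, Finset.length_sort]
      rfl
    have := h3 i (he ▸ hi)
    rw [Nat.zero_add] at this
    rw [this]
    simp only [he]

end

end AtMostNValue

/-! ## The input -/
namespace AtMostNValue

open WordRAM Exp Prog

set_option linter.unusedSimpArgs false

theorem sum_update_one_le (f : ℕ → ℕ) (a m : ℕ) :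
    ∑ q ∈ Finset.range m, Function.update f a 1 q ≤ ∑ q ∈ Finset.range m, f q + 1 := by
  calc ∑ q ∈ Finset.range m, Function.update f a 1 q
      ≤ ∑ q ∈ Finset.range m, (f q + if q = a then 1 else 0) := by
        refine Finset.sum_le_sum fun q _ => ?_
        rw [Function.update_apply]
        split_ifs <;> omega
    _ ≤ _ := by
        rw [Finset.sum_add_distrib, Finset.sum_ite_eq']
        split_ifs <;> omega

theorem filter_val_lt_succ {n k : ℕ} (hk : k < n) :
    Finset.univ.filter (fun y : Fin n => (y : ℕ) < k + 1) =
      insert ⟨k, hk⟩ (Finset.univ.filter (fun y : Fin n => (y : ℕ) < k)) := by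
  ext y
  simp only [Finset.mem_filter, Finset.mem_univ, true_and, Finset.mem_insert, Fin.ext_iff]
  omega

theorem length_iv_le_card {I : Instance} (hI : I.IsInput) (x : Fin I.n) :
    (I.iv x).length ≤ I.D.card :=
  (length_intervals_le (hI.2 x).2).trans (Finset.card_le_card (hI.2 x).2)

/-- The first `m` intervals of the `x`-th domain have been read. -/
structure Stored (I : Instance) (x : Fin I.n) (m : ℕ) (s : State) : Prop where
  hl : ∀ i < m, s.arr arrHl (s.arr arrSt x + i) + i + 1 = (I.iv x).length
  L : ∀ i (h : i < (I.iv x).length), i < m → s.arr arrL (s.arr arrSt x + i) = rk I.D (I.iv x)[i].1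
  R : ∀ i (h : i < (I.iv x).length), i < m → s.arr arrR (s.arr arrSt x + i) = rk I.D (I.iv x)[i].2
  mark : 1 < (I.iv x).length → ∀ i < m, s.arr arrMk (s.arr arrL (s.arr arrSt x + i)) = 1 ∧
    s.arr arrMk (s.arr arrR (s.arr arrSt x + i) + 1) = 1
  pt : s.arr arrPt x = s.arr arrSt x
  bound : s.arr arrSt x + m ≤ s.reg regT

/-- What has been read occupies cells below `regT`, and marks are only ever set, so later reading
preserves it. -/
theorem Stored.step {I : Instance} {x : Fin I.n} {m : ℕ} {s s' : State} (h : Stored I x m s)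
    (hst : s'.arr arrSt x = s.arr arrSt x) (hpt : s'.arr arrPt x = s.arr arrPt x)
    (hL : ∀ t < s.reg regT, s'.arr arrL t = s.arr arrL t)
    (hR : ∀ t < s.reg regT, s'.arr arrR t = s.arr arrR t)
    (hhl : ∀ t < s.reg regT, s'.arr arrHl t = s.arr arrHl t)
    (hmk : ∀ q, s.arr arrMk q = 1 → s'.arr arrMk q = 1) (hT : s.reg regT ≤ s'.reg regT) :
    Stored I x m s' := by
  have hb := h.bound
  refine ⟨fun i hi => ?_, fun i hi hi' => ?_, fun i hi hi' => ?_, fun h1 i hi => ?_, ?_, ?_⟩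
  · rw [hst, hhl _ (by omega)]
    exact h.hl i hi
  · rw [hst, hL _ (by omega)]
    exact h.L i hi hi'
  · rw [hst, hR _ (by omega)]
    exact h.R i hi hi'
  · rw [hst, hL _ (by omega), hR _ (by omega)]
    exact ⟨hmk _ (h.mark h1 i hi).1, hmk _ (h.mark h1 i hi).2⟩
  · rw [hpt, hst]
    exact h.pt
  · omega

theorem Stored.succ {I : Instance} {x : Fin I.n} {m : ℕ} {s : State} (h : Stored I x m s)
    (hm : m < (I.iv x).length) (hhl : s.arr arrHl (s.arr arrSt x + m) = (I.iv x).length - (m + 1))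
    (hL : s.arr arrL (s.arr arrSt x + m) = rk I.D (I.iv x)[m].1)
    (hR : s.arr arrR (s.arr arrSt x + m) = rk I.D (I.iv x)[m].2)
    (hmk : 1 < (I.iv x).length → s.arr arrMk (rk I.D (I.iv x)[m].1) = 1 ∧
      s.arr arrMk (rk I.D (I.iv x)[m].2 + 1) = 1)
    (hb : s.arr arrSt x + (m + 1) ≤ s.reg regT) : Stored I x (m + 1) s := by
  refine ⟨fun i hi => ?_, fun i hi hi' => ?_, fun i hi hi' => ?_, fun h1 i hi => ?_, h.pt, hb⟩
  · rcases Nat.lt_succ_iff_lt_or_eq.1 hi with hi | rfl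
    · exact h.hl i hi
    · omega
  · rcases Nat.lt_succ_iff_lt_or_eq.1 hi' with hi' | rfl
    · exact h.L i hi hi'
    · exact hL
  · rcases Nat.lt_succ_iff_lt_or_eq.1 hi' with hi' | rfl
    · exact h.R i hi hi'
    · exact hR
  · rcases Nat.lt_succ_iff_lt_or_eq.1 hi with hi | rfl
    · exact h.mark h1 i hi
    · rw [hL, hR]
      exact hmk h1

/-- What does not change while the domains are read. -/
structure HeadAt (I : Instance) (s : State) : Prop where
  n : s.reg regN = I.n
  d : s.reg regD = I.D.card
  input : Holds (s.arr arrIn) 0 I.encode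
  rk : ∀ v ∈ I.D, s.arr arrRk v = rk I.D v

theorem HeadAt.frame {I : Instance} {p : Prog} {s s' : State} (h : HeadAt I s)
    (hf : Frame p s s') (hr : ([regN, regD].all fun r => !p.wr r) = true)
    (ha : ([arrIn, arrRk].all fun a => !p.wa a) = true) : HeadAt I s' := by
  obtain ⟨h1, h2⟩ := hf.congr hr ha
  simp only [List.forall_mem_cons, List.not_mem_nil, false_imp_iff, implies_true, and_true] at h1 h2
  exact ⟨h1.1 ▸ h.n, h1.2 ▸ h.d, h2.1 ▸ h.input, h2.2 ▸ h.rk⟩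

/-- The marks delimit at most `m` segments. -/
structure MarksAt (I : Instance) (m : ℕ) (s : State) : Prop where
  le : ∀ q, s.arr arrMk q ≤ 1
  one : s.arr arrMk 1 = 1
  sum : ∑ q ∈ Finset.range (I.D.card + 2), s.arr arrMk q ≤ m

theorem MarksAt.mono {I : Instance} {m m' : ℕ} {s s' : State} (h : MarksAt I m s)
    (hs : s'.arr arrMk = s.arr arrMk) (hm : m ≤ m') : MarksAt I m' s' :=
  ⟨hs ▸ h.le, hs ▸ h.one, hs ▸ h.sum.trans hm⟩

theorem MarksAt.update {I : Instance} {m : ℕ} {s s' : State} {a b : ℕ} (h : MarksAt I m s)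
    (hs : s'.arr arrMk = Function.update (Function.update (s.arr arrMk) a 1) b 1) :
    MarksAt I (m + 2) s' := by
  refine ⟨fun q => ?_, ?_, ?_⟩
  · rw [hs, Function.update_apply, Function.update_apply]
    have := h.le q
    split_ifs <;> omega
  · rw [hs, Function.update_apply, Function.update_apply]
    have := h.one
    split_ifs <;> omega
  · rw [hs]
    refine (sum_update_one_le _ _ _).trans ?_
    have h1 := sum_update_one_le (s.arr arrMk) a (I.D.card + 2)
    have h2 := h.sum
    omega

/-- The domains with numbers less than `k` have been read. -/
structure ReadInv (I : Instance) (k : ℕ) (s : State) : Prop where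
  x : s.reg regX = k
  q : s.reg regQ = 4 + I.D.card + (I.encodeDoms k).length
  t : s.reg regT ≤ k * I.D.card
  stored : ∀ x : Fin I.n, (x : ℕ) < k → Stored I x (I.iv x).length s
  marks : MarksAt I (1 + 4 * ∑ x ∈ Finset.univ.filter (fun x : Fin I.n => (x : ℕ) < k),
    numHoles I.D (I.dom x)) s

/-- Moreover, the first `i` intervals of the domain `x` have been read. -/
structure ReadDomInv (I : Instance) (x : Fin I.n) (i : ℕ) (s : State) : Prop where
  var : s.reg regX = x
  cnt : s.reg regCnt = (I.iv x).length
  idx : s.reg regI = i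
  q : s.reg regQ = 4 + I.D.card + (I.encodeDoms x).length + 1 + 2 * i
  st : s.arr arrSt x + i = s.reg regT
  t : s.reg regT ≤ x * I.D.card + i
  stored : ∀ y : Fin I.n, (y : ℕ) < x → Stored I y (I.iv y).length s
  stored' : Stored I x i s
  marks : MarksAt I (1 + 4 * ∑ y ∈ Finset.univ.filter (fun y : Fin I.n => (y : ℕ) < x),
    numHoles I.D (I.dom y) + if 1 < (I.iv x).length then 2 * i else 0) s

section

variable {I : Instance} {M B : ℕ} (hB : (M + 10) ^ 8 < B) (hI : I.IsInput)

include hB hI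

theorem runs_readInterval {s : State} (hs : Bdd M s) (hE : HeadAt I s) {x : Fin I.n} {i : ℕ}
    (hi : i < (I.iv x).length) (hM : (I.n + 1) * (1 + 2 * I.D.card) + 10 ≤ M) (hsM : I.size + 2 ≤ M)
    (h : ReadDomInv I x i s) :
    Runs B M readInterval s 100 (ReadDomInv I x (i + 1)) := by
  have hholds := (holds_cons.1 (Instance.holds_encodeDom I hE.input x.2)).2
  have hget := holds_flatMap_iff hholds hi
  have hiv := (intervalsSpec (hI.2 x).2).mem _ (List.getElem_mem hi)
  change s.arr arrIn _ = (I.iv x)[i].1 ∧ s.arr arrIn _ = (I.iv x)[i].2 at hget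
  change (I.iv x)[i].1 ∈ I.dom x ∧ (I.iv x)[i].2 ∈ I.dom x ∧ _ at hiv
  rw [← h.q] at hget
  have hr1 := hE.rk _ ((hI.2 x).2 hiv.1)
  have hr2 := hE.rk _ ((hI.2 x).2 hiv.2.1)
  have hb1 := rk_le ((hI.2 x).2 hiv.1)
  have hb2 := rk_le ((hI.2 x).2 hiv.2.1)
  have hlen := length_iv_le_card hI x
  have hcM := hs.1 regCnt
  rw [h.cnt] at hcM
  have hxd : (x + 1 : ℕ) * I.D.card ≤ I.n * I.D.card := Nat.mul_le_mul_right _ x.2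
  have hnd : (I.n + 1) * (1 + 2 * I.D.card) = 2 * (I.n * I.D.card) + I.n + 2 * I.D.card + 1 := by
    ring
  rw [Nat.add_mul, Nat.one_mul] at hxd
  have hq : s.reg regQ + 2 ≤ I.size + 1 := by
    have h1 := Instance.length_encodeDoms_mono I (show (x : ℕ) + 1 ≤ I.n from x.2)
    rw [Instance.encodeDoms_succ I x.2, List.length_append, Instance.length_encodeDom] at h1
    change _ + (1 + 2 * (I.iv x).length) ≤ _ at h1
    have h2 := I.size_eq
    rw [h.q]
    omega
  have ht := h.t
  have hstep : ∀ s' : State, s'.reg regX = x → s'.reg regCnt = (I.iv x).length →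
      s'.reg regI = i + 1 → s'.reg regQ = s.reg regQ + 2 → s'.reg regT = s.reg regT + 1 →
      s'.arr arrSt = s.arr arrSt → s'.arr arrPt = s.arr arrPt →
      s'.arr arrL = Function.update (s.arr arrL) (s.reg regT) (rk I.D (I.iv x)[i].1) →
      s'.arr arrR = Function.update (s.arr arrR) (s.reg regT) (rk I.D (I.iv x)[i].2) →
      s'.arr arrHl = Function.update (s.arr arrHl) (s.reg regT) ((I.iv x).length - (i + 1)) →
      (s'.arr arrMk = if 1 < (I.iv x).length then Function.update (Function.update (s.arr arrMk)
        (rk I.D (I.iv x)[i].1) 1) (rk I.D (I.iv x)[i].2 + 1) 1 else s.arr arrMk) →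
      ReadDomInv I x (i + 1) s' := by
    intro s' a1 a2 a3 a4 a5 a6 a7 a8 a9 a10 a11
    have hst : ∀ (y : Fin I.n) m, Stored I y m s → Stored I y m s' := by
      intro y m hy
      refine hy.step (by rw [a6]) (by rw [a7]) ?_ ?_ ?_ ?_ (by omega)
      · intro t ht
        rw [a8, Function.update_of_ne ht.ne]
      · intro t ht
        rw [a9, Function.update_of_ne ht.ne]
      · intro t ht
        rw [a10, Function.update_of_ne ht.ne]
      · intro q hq
        rw [a11]
        split_ifs
        · rw [Function.update_apply, Function.update_apply]
          split_ifs
          exacts [rfl, rfl, hq]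
        · exact hq
    refine ⟨a1, a2, a3, ?_, ?_, ?_, fun y hy => hst _ _ (h.stored y hy), ?_, ?_⟩
    · rw [a4, h.q]
      ring
    · rw [a5, a6, ← h.st]
      ring
    · omega
    · refine (hst _ _ h.stored').succ hi ?_ ?_ ?_ ?_ ?_
      · rw [a6, a10, h.st, Function.update_self]
      · rw [a6, a8, h.st, Function.update_self]
      · rw [a6, a9, h.st, Function.update_self]
      · intro h1
        rw [a11, if_pos h1]
        refine ⟨?_, Function.update_self _ _ _⟩
        rw [Function.update_apply]
        split_ifs
        · rfl
        · exact Function.update_self _ _ _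
      · rw [a6, a5, ← h.st]
        omega
    · by_cases h1 : 1 < (I.iv x).length
      · rw [if_pos h1] at a11 ⊢
        have h2 := h.marks
        rw [if_pos h1] at h2
        exact h2.update a11
      · rw [if_neg h1] at a11 ⊢
        have h2 := h.marks
        rw [if_neg h1] at h2
        exact h2.mono a11 le_rfl
  have hget2 := hget.2
  by_cases h1 : 1 < (I.iv x).length
  · refine Runs.straight hB rfl (by decide) hs ?_ (hstep _ ?_ ?_ ?_ ?_ ?_ ?_ ?_ ?_ ?_ ?_ ?_)
    all_goals simp [readInterval, inc, hget.1, hget2, hr1, hr2, h.cnt, h.idx, h1, h.var]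
    omega
  · refine Runs.straight hB rfl (by decide) hs ?_ (hstep _ ?_ ?_ ?_ ?_ ?_ ?_ ?_ ?_ ?_ ?_ ?_)
    all_goals simp [readInterval, inc, hget.1, hget2, hr1, hr2, h.cnt, h.idx, h1, h.var]
    omega

theorem runs_readDom {s : State} (hs : Bdd M s) (hE : HeadAt I s) {k : ℕ} (hk : k < I.n)
    (hM : (I.n + 1) * (1 + 2 * I.D.card) + 10 ≤ M) (hsM : I.size + 2 ≤ M) (h : ReadInv I k s) :
    Runs B M readDom s (I.D.card * 110 + 60) (ReadInv I (k + 1)) := by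
  set x : Fin I.n := ⟨k, hk⟩ with hx
  have hcnt : s.arr arrIn (s.reg regQ) = (I.iv x).length := by
    rw [h.q]
    exact (holds_cons.1 (Instance.holds_encodeDom I hE.input hk)).1
  have hlen := length_iv_le_card hI x
  have hle : 4 + I.D.card + (I.encodeDoms k).length + 1 + 2 * (I.iv x).length ≤ I.size := by
    have h1 := Instance.length_encodeDoms_mono I (show k + 1 ≤ I.n from hk)
    rw [Instance.encodeDoms_succ I hk, List.length_append, Instance.length_encodeDom] at h1
    change _ + (1 + 2 * (I.iv x).length) ≤ _ at h1
    have h2 := I.size_eq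
    omega
  have hq := h.q
  have htM := hs.1 regT
  have hnM : I.n + 1 ≤ M := by nlinarith
  refine Runs.seq (T₁ := 30) (T₂ := I.D.card * 110 + 30) (R := ReadDomInv I x 0) ?_ (by omega) ?_
  · have hst : ∀ (y : Fin I.n) (hy : (y : ℕ) < k), Stored I y (I.iv y).length
        (readDomHead.step s) := by
      intro y hy
      refine (h.stored y hy).step ?_ ?_ ?_ ?_ ?_ ?_ ?_
      all_goals simp [readDomHead, inc, h.x, hy.ne]
    refine Runs.straight hB rfl (by decide) hs ?_ ⟨?_, ?_, ?_, ?_, ?_, ?_, hst, ?_, ?_⟩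
    · simp [readDomHead, inc, hcnt]
      omega
    · simp [readDomHead, inc, h.x, hx]
    · simp [readDomHead, inc, hcnt]
    · simp [readDomHead, inc]
    · simp [readDomHead, inc, h.q, hx]
    · simp [readDomHead, inc, h.x, hx]
    · simpa [readDomHead, inc, hx] using h.t
    · refine ⟨fun i hi => by omega, fun i _ hi => by omega, fun i _ hi => by omega,
        fun _ i hi => by omega, ?_, ?_⟩
      · simp [readDomHead, inc, h.x, hx]
      · simp [readDomHead, inc, h.x, hx]
    · refine h.marks.mono (by simp [readDomHead, inc]) ?_
      simp [hx]
  intro s₁ hs₁ hf₁ h₁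
  have hE₁ := hE.frame hf₁ rfl rfl
  refine Runs.seq (T₁ := I.D.card * 110 + 10) (T₂ := 10) (R := ReadDomInv I x (I.iv x).length) ?_
    (by omega) ?_
  · refine Runs.for hB (ReadDomInv I x) (I.iv x).length 100 rfl hs₁ h₁ ?_ ?_ ?_
    · intro i s₂ hi hf h₂
      simp [h₂.idx, h₂.cnt]
    · intro i s₂ hi hs₂ hf h₂
      exact runs_readInterval hB hI hs₂ (hE₁.frame hf rfl rfl) hi hM hsM h₂
    · simp only [Exp.cost]
      omega
  intro s₂ hs₂ hf₂ h₂
  have hxn : x ∉ Finset.univ.filter (fun y : Fin I.n => (y : ℕ) < k) := by simp [hx]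
  have hiv := Instance.length_iv_le hI x
  have hst : ∀ (y : Fin I.n) m, Stored I y m s₂ → Stored I y m ((inc regX 1).step s₂) := by
    intro y m hy
    refine hy.step ?_ ?_ ?_ ?_ ?_ ?_ ?_
    all_goals simp [inc]
  refine Runs.straight hB rfl (by decide) hs₂ ?_ ⟨?_, ?_, ?_, ?_, ?_⟩
  · simp [inc, h₂.var, hx]
    omega
  · simp [inc, h₂.var, hx]
  · rw [Instance.encodeDoms_succ I hk, List.length_append, Instance.length_encodeDom]
    change _ = _ + (_ + (1 + 2 * (I.iv x).length))
    have := h₂.q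
    simp [inc, this, hx]
    ring
  · have := h₂.t
    rw [Nat.add_mul, Nat.one_mul]
    simp [inc]
    change _ ≤ k * _ + _ at this
    omega
  · intro y hy
    rcases Nat.lt_succ_iff_lt_or_eq.1 hy with hy | hy
    · exact hst _ _ (h₂.stored y hy)
    · obtain rfl : y = x := Fin.ext hy
      exact hst _ _ h₂.stored'
  -- A domain with `h` holes has at most `h + 1` intervals. It sets marks only if it has at least
  -- two intervals, so that `h ≥ 1`; then two marks per interval amount to at most `4 * h`.
  · refine h₂.marks.mono (by simp [inc]) ?_
    rw [filter_val_lt_succ hk, Finset.sum_insert hxn]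
    change 1 + 4 * ∑ y ∈ Finset.univ.filter (fun y : Fin I.n => (y : ℕ) < k), _ + _ ≤
      1 + 4 * (numHoles I.D (I.dom x) + _)
    split_ifs <;> omega

theorem runs_readDoms {s : State} (hs : Bdd M s) (hE : HeadAt I s)
    (hM : (I.n + 1) * (1 + 2 * I.D.card) + 10 ≤ M) (hsM : I.size + 2 ≤ M) (h : ReadInv I 0 s) :
    Runs B M readDoms s (I.n * (I.D.card * 110 + 70) + 10) (ReadInv I I.n) := by
  refine Runs.for hB (ReadInv I) I.n (I.D.card * 110 + 60) rfl hs h ?_ ?_ ?_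
  · intro k s₁ hk hf h₁
    simp [h₁.x, (hE.frame hf rfl rfl).n]
  · intro k s₁ hk hs₁ hf h₁
    exact runs_readDom hB hI hs₁ (hE.frame hf rfl rfl) hk hM hsM h₁
  · simp only [Exp.cost]
    rw [add_assoc (I.n * _) (1 + 1 + 1) 1]
    exact Nat.add_le_add (Nat.mul_le_mul_left _ (by omega)) (by norm_num)

omit hI in
theorem runs_readValues {s : State} (hs : Bdd M s) (hd : s.reg regD = I.D.card)
    (hin : Holds (s.arr arrIn) 0 I.encode) (hi : s.reg regI = 0) (hdM : I.D.card + 1 ≤ M) :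
    Runs B M readValues s (I.D.card * 40 + 10) fun s' => ∀ v ∈ I.D, s'.arr arrRk v = rk I.D v := by
  refine (Runs.for hB (fun k s₁ => s₁.reg regI = k ∧ ∀ p, 1 ≤ p → p ≤ k →
    s₁.arr arrRk (val I.D p) = p) I.D.card 30 rfl hs ⟨hi, fun p h h' => by omega⟩ ?_ ?_
    (T := I.D.card * 40 + 10) ?_).mono le_rfl ?_
  · rintro k s₁ hk hf ⟨h1, -⟩
    have : s₁.reg regD = I.D.card := (hf.1 _ rfl).trans hd
    simp [h1, this]
  · rintro k s₁ hk hs₁ hf ⟨h1, h2⟩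
    have hin₁ : s₁.arr arrIn (k + 4) = val I.D (k + 1) := by
      rw [hf.2 arrIn rfl]
      exact holds_encode_val hin (by omega) (by omega)
    refine Runs.straight hB rfl (by decide) hs₁ ?_ ⟨?_, fun p hp hp' => ?_⟩
    · simp [readValue, inc, h1]
      omega
    · simp [readValue, inc, h1]
    · rcases Nat.lt_succ_iff_lt_or_eq.1 (Nat.lt_succ_of_le hp') with hlt | rfl
      · have hne : val I.D p ≠ val I.D (k + 1) := (val_lt_val hp hlt (by omega)).ne
        simp [readValue, inc, h1, hin₁, hne]
        exact h2 p hp (by omega)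
      · simp [readValue, inc, h1, hin₁]
  · simp only [Exp.cost]
    omega
  · rintro s₁ - - ⟨-, h⟩ v hv
    have := h _ (one_le_rk v) (rk_le hv)
    rwa [val_rk hv] at this

omit hI in
theorem runs_numberSegments {s : State} (hs : Bdd M s) {d : ℕ} (hd : s.reg regD = d)
    (hdM : d + 1 ≤ M) (hP : s.reg regP = 0) (h0 : s.arr arrSg 0 = 0)
    (hmk : ∀ q, s.arr arrMk q ≤ 1) :
    Runs B M numberSegments s (d * 40 + 10) fun s' =>
      ∀ p ≤ d, s'.arr arrSg p = ∑ q ∈ Finset.range p, s.arr arrMk (q + 1) := by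
  refine (Runs.for hB (fun k s₁ => s₁.reg regP = k ∧ ∀ p ≤ k,
    s₁.arr arrSg p = ∑ q ∈ Finset.range p, s.arr arrMk (q + 1)) d 30 rfl hs ⟨hP, fun p h => ?_⟩ ?_ ?_
    (T := d * 40 + 10) ?_).mono le_rfl ?_
  · obtain rfl : p = 0 := by omega
    simpa using h0
  · rintro k s₁ hk hf ⟨h1, -⟩
    have : s₁.reg regD = d := (hf.1 _ rfl).trans hd
    simp [h1, this]
  · rintro k s₁ hk hs₁ hf ⟨h1, h2⟩
    have hmk₁ : s₁.arr arrMk = s.arr arrMk := hf.2 _ rfl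
    have hk' := h2 k le_rfl
    have hle : s₁.arr arrSg k ≤ k := by
      rw [hk']
      exact (Finset.sum_le_sum fun q _ => hmk (q + 1)).trans (by simp)
    have := hmk (k + 1)
    refine Runs.straight hB rfl (by decide) hs₁ ?_ ⟨?_, fun p hp => ?_⟩
    · simp [numberSegment, inc, h1, hmk₁]
      omega
    · simp [numberSegment, inc, h1]
    · rcases Nat.lt_succ_iff_lt_or_eq.1 (Nat.lt_succ_of_le hp) with hlt | rfl
      · have hne : p ≠ k + 1 := by omega
        simp [numberSegment, inc, h1, hne]
        exact h2 p (by omega)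
      · rw [Finset.sum_range_succ, ← hk', ← hmk₁]
        simp [numberSegment, inc, h1]
  · simp only [Exp.cost]
    omega
  · rintro s₁ - - ⟨-, h⟩
    exact h

end

/-! ### From marks to segments -/

/-- The tables in a state. -/
def tabOf (s : State) : Tab := ⟨s.arr arrSt, s.arr arrL, s.arr arrR, s.arr arrHl, s.arr arrSg⟩

/-- The segment number of a rank counts the marks up to it, so a mark in between separates two
ranks. -/
theorem sum_marks_lt {mk : ℕ → ℕ} {p q r : ℕ} (hpr : p < r) (hrq : r ≤ q) (h : mk r = 1) :
    ∑ i ∈ Finset.range p, mk (i + 1) < ∑ i ∈ Finset.range q, mk (i + 1) := by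
  obtain ⟨r, rfl⟩ : ∃ r', r = r' + 1 := ⟨r - 1, by omega⟩
  calc ∑ i ∈ Finset.range p, mk (i + 1) ≤ ∑ i ∈ Finset.range r, mk (i + 1) :=
        Finset.sum_le_sum_of_subset (Finset.range_subset_range.2 (by omega))
    _ < ∑ i ∈ Finset.range (r + 1), mk (i + 1) := by
        rw [Finset.sum_range_succ]
        omega
    _ ≤ _ := Finset.sum_le_sum_of_subset (Finset.range_subset_range.2 hrq)

theorem tab_wf {I : Instance} (hI : I.IsInput) {M : ℕ} {s : State}
    (hM : (I.n + 1) * (1 + 2 * I.D.card) + 10 ≤ M) (h : ReadInv I I.n s)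
    (hsg : ∀ p ≤ I.D.card, s.arr arrSg p = ∑ q ∈ Finset.range p, s.arr arrMk (q + 1)) :
    (tabOf s).WF I M := by
  have hP : I.Parsed (s.arr arrSt) (s.arr arrL) (s.arr arrR) (s.arr arrHl) :=
    ⟨fun x i hi => (h.stored x x.2).hl i hi, fun x i hi => (h.stored x x.2).L i hi hi,
      fun x i hi => (h.stored x x.2).R i hi hi⟩
  have hlen : ∀ (x : Fin I.n) (i : ℕ), i ≤ s.arr arrHl (s.arr arrSt x) → i < (I.iv x).length := by
    intro x i hi
    have := hP.hl_st hI x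
    omega
  have hlen' : ∀ x : Fin I.n, 0 < s.arr arrHl (s.arr arrSt x) → 1 < (I.iv x).length := by
    intro x hx
    have := hP.hl_st hI x
    omega
  refine ⟨hP, ?_, ?_, ?_, ?_, ?_, ?_⟩
  · intro p q hpq hq
    change s.arr arrSg p ≤ s.arr arrSg q
    rw [hsg p (hpq.trans hq), hsg q hq]
    exact Finset.sum_le_sum_of_subset (Finset.range_subset_range.2 hpq)
  · intro p hp hpd
    change s.arr arrSg 0 < s.arr arrSg p
    rw [hsg 0 (Nat.zero_le _), hsg p hpd]
    exact sum_marks_lt (r := 1) (by omega) hp h.marks.one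
  · intro x i p hx hi hlt
    have hb := hP.bound hI x i hi
    change p < s.arr arrL (s.arr arrSt x + i) at hlt
    change s.arr arrSg p < s.arr arrSg (s.arr arrL (s.arr arrSt x + i))
    rw [hsg _ (by omega), hsg _ (by omega)]
    exact sum_marks_lt hlt le_rfl ((h.stored x x.2).mark (hlen' x hx) i (hlen x i hi)).1
  · intro x i p hx hi hlt hp
    have hb := hP.bound hI x i hi
    change s.arr arrR (s.arr arrSt x + i) < p at hlt
    change s.arr arrSg (s.arr arrR (s.arr arrSt x + i)) < s.arr arrSg p
    rw [hsg _ (by omega), hsg _ (by omega)]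
    exact sum_marks_lt (Nat.lt_succ_self _) hlt
      ((h.stored x x.2).mark (hlen' x hx) i (hlen x i hi)).2
  -- The count of marks also covers the indices `0` and `d + 1`, which do not contribute to `sg d`;
  -- a right end at `d` puts its mark at `d + 1`.
  · change s.arr arrSg I.D.card ≤ _
    rw [hsg _ le_rfl]
    have h1 := h.marks.sum
    rw [Finset.filter_true_of_mem fun x _ => x.2, Finset.sum_range_succ,
      Finset.sum_range_succ'] at h1
    have : I.holes = ∑ x, numHoles I.D (I.dom x) := rfl
    omega
  · intro x i hi
    have h1 := (h.stored x x.2).bound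
    have h2 := h.t
    have h3 := hlen x i hi
    change s.arr arrSt x + i + 1 ≤ M
    nlinarith

end AtMostNValue

/-! ## The whole program -/
namespace AtMostNValue

open WordRAM Exp Prog

set_option linter.unusedSimpArgs false

/-! ### Bounds on the numbers in the machine -/

section bounds

variable {I : Instance} (hI : I.IsInput)

theorem le_length_encodeDoms (I : Instance) {k : ℕ} (hk : k ≤ I.n) :
    k ≤ (I.encodeDoms k).length := by
  induction k with
  | zero => exact Nat.zero_le _
  | succ k ih =>
    rw [Instance.encodeDoms_succ I hk, List.length_append, Instance.length_encodeDom]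
    have := ih (by omega)
    omega

theorem card_add_le_size (I : Instance) : 4 + I.D.card + I.n ≤ I.size := by
  have := le_length_encodeDoms I le_rfl
  rw [I.size_eq]
  omega

theorem size_le_wordBase (I : Instance) : I.size ≤ I.wordBase := by
  unfold Instance.wordBase
  omega

include hI

theorem le_wordBase_of_mem {v : ℕ} (hv : v ∈ I.encode) : v ≤ I.wordBase := by
  have h1 := card_add_le_size I
  have h2 : ∀ v ∈ I.D, v ≤ I.D.sup id := fun v hv => Finset.le_sup (f := id) hv
  have h3 : I.wordBase = I.size + I.D.sup id + I.N.natAbs := rfl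
  have h4 : ∀ v ∈ I.D, v ≤ I.wordBase := fun v hv => by
    have := h2 v hv
    omega
  rw [Instance.encode, List.mem_append, List.mem_append] at hv
  rcases hv with (hv | hv) | hv
  · simp only [List.mem_cons, List.not_mem_nil, or_false] at hv
    omega
  · exact h4 v ((Finset.mem_sort _).1 hv)
  · obtain ⟨x, -, hv⟩ := List.mem_flatMap.1 hv
    rw [encodeDom, List.mem_cons] at hv
    rcases hv with rfl | hv
    · have : (intervals I.D (I.dom x)).length ≤ I.D.card := length_iv_le_card hI x
      omega
    · obtain ⟨a, ha, hv⟩ := List.mem_flatMap.1 hv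
      obtain ⟨h5, h6, -⟩ := (intervalsSpec (hI.2 x).2).mem a ha
      simp only [List.mem_cons, List.not_mem_nil, or_false] at hv
      rcases hv with rfl | rfl
      exacts [h4 _ ((hI.2 x).2 h5), h4 _ ((hI.2 x).2 h6)]

/-- This crude cubic bound only serves to show that the number of holes fits into a word. -/
theorem holes_le : I.holes ≤ I.n * (I.D.card * I.D.card) := by
  calc I.holes ≤ ∑ _x : Fin I.n, I.D.card * I.D.card := by
        refine Finset.sum_le_sum fun x _ => ?_
        refine (Finset.card_filter_le _ _).trans ?_
        rw [Finset.card_product]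
        have := Finset.card_le_card (hI.2 x).2
        exact Nat.mul_le_mul this this
    _ = _ := by simp

theorem bdd_init : Bdd (I.wordBase ^ 4) (State.init I.encode) := by
  refine ⟨fun r => Nat.zero_le _, fun a i => ?_⟩
  change (if a = 0 then I.encode.getD i 0 else 0) ≤ _
  split_ifs
  · refine le_trans ?_ (Nat.le_self_pow (by norm_num) _)
    by_cases hi : i < I.encode.length
    · rw [List.getD_eq_getElem _ _ hi]
      exact le_wordBase_of_mem hI (List.getElem_mem hi)
    · rw [List.getD_eq_default _ _ (by omega)]
      exact Nat.zero_le _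
  · exact Nat.zero_le _

end bounds

theorem holds_init (l : List ℕ) : Holds ((State.init l).arr arrIn) 0 l := by
  intro i hi
  rw [Nat.zero_add]
  exact List.getD_eq_getElem _ _ hi

/-- A bound on the running time. -/
def enforceTime (n d k : ℕ) : ℕ :=
  80 + (d * 40 + 10) + (n * (d * 110 + 70) + 10) + (d * 40 + 10) +
    (d * (d * 150 + n * 200 + pot k * stepBound k + 410) + 10) + (n * (d * 130 + 70) + 30)

theorem runs_enforce {I : Instance} (hI : I.IsInput) {M B : ℕ} (hB : (M + 10) ^ 8 < B)
    (hs : Bdd M (State.init I.encode)) (hdM : I.D.card + 1 ≤ M) (hnM : I.n + 1 ≤ M)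
    (hkM : I.holes + 1 ≤ M) (hsM : I.size + 2 ≤ M)
    (hM : 10 + I.D.card + (I.n + 1) * (1 + 2 * I.D.card) ≤ M) :
    Runs B M enforce (State.init I.encode) (enforceTime I.n I.D.card I.holes) fun s =>
      s.HasOutput I.enforceHAC.encode := by
  have hin := holds_init I.encode
  have hhd := holds_encode_header hin
  have hsize := card_add_le_size I
  have hr0 : ∀ r, (State.init I.encode).reg r = 0 := fun r => rfl
  have ha0 : ∀ a i, a ≠ 0 → (State.init I.encode).arr a i = 0 := fun a i ha => if_neg ha
  set s₀ := State.init I.encode with hs₀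
  have hM' : (I.n + 1) * (1 + 2 * I.D.card) + 10 ≤ M := by omega
  refine Runs.seq (T₁ := 80) (R := fun s₁ => s₁.reg regN = I.n ∧ s₁.reg regD = I.D.card ∧
    s₁.reg regLim = I.N.toNat ∧ s₁.reg regQ = I.D.card + 4 ∧
    s₁.arr arrMk = Function.update (s₀.arr arrMk) 1 1 ∧
    s₁.arr arrOut = Function.update (Function.update (Function.update (s₀.arr arrOut) 0 I.n) 2
      I.N.toNat) 3 (-I.N).toNat) (T₂ := enforceTime I.n I.D.card I.holes - 80) ?_
    (by unfold enforceTime; omega) ?_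
  · have h2 := hs.2 arrIn 2
    have h3 := hs.2 arrIn 3
    rw [hhd.2.2.1] at h2
    rw [hhd.2.2.2] at h3
    refine Runs.straight hB rfl (by decide) hs ?_ ?_
    · simp [readHeader, hhd.1, hhd.2.1, hhd.2.2.1, hhd.2.2.2]
      omega
    · simp [readHeader, hhd.1, hhd.2.1, hhd.2.2.1, hhd.2.2.2]
  rintro s₁ hs₁ hf₁ ⟨b1, b2, b3, b4, b5, b6⟩
  have hin₁ : Holds (s₁.arr arrIn) 0 I.encode := by
    rw [hf₁.2 arrIn rfl]
    exact hin
  unfold enforceTime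
  refine Runs.seq (runs_readValues hB hs₁ b2 hin₁ ((hf₁.1 _ rfl).trans (hr0 _)) hdM)
    (T₂ := enforceTime I.n I.D.card I.holes - 80 - (I.D.card * 40 + 10))
    (by unfold enforceTime; omega) ?_
  intro s₂ hs₂ hf₂ hrk
  have hE₂ : HeadAt I s₂ := ⟨(hf₂.1 _ rfl).trans b1, (hf₂.1 _ rfl).trans b2,
    by rw [hf₂.2 arrIn rfl]; exact hin₁, hrk⟩
  have hread : ReadInv I 0 s₂ := by
    have hmk : s₂.arr arrMk = Function.update (s₀.arr arrMk) 1 1 := (hf₂.2 _ rfl).trans b5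
    refine ⟨(hf₂.1 _ rfl).trans ((hf₁.1 _ rfl).trans (hr0 _)), ?_, ?_,
      fun x hx => absurd hx (Nat.not_lt_zero _), ⟨?_, ?_, ?_⟩⟩
    · rw [hf₂.1 regQ rfl, b4, Instance.encodeDoms_zero, List.length_nil]
      omega
    · rw [hf₂.1 regT rfl, hf₁.1 regT rfl, hr0]
      exact Nat.zero_le _
    · intro q
      rw [hmk, Function.update_apply, ha0 _ _ (by decide)]
      split_ifs <;> omega
    · rw [hmk, Function.update_self]
    · rw [hmk]
      refine (sum_update_one_le _ _ _).trans ?_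
      rw [Finset.sum_eq_zero fun q _ => ha0 _ _ (by decide)]
      omega
  refine Runs.seq (runs_readDoms hB hI hs₂ hE₂ hM' hsM hread)
    (T₂ := enforceTime I.n I.D.card I.holes - 80 - (I.D.card * 40 + 10) -
      (I.n * (I.D.card * 110 + 70) + 10))
    (by unfold enforceTime; omega) ?_
  intro s₃ hs₃ hf₃ hread₃
  have hE₃ := hE₂.frame hf₃ rfl rfl
  refine Runs.seq (runs_numberSegments hB hs₃ hE₃.d hdM
    ((hf₃.1 _ rfl).trans ((hf₂.1 _ rfl).trans ((hf₁.1 _ rfl).trans (hr0 _))))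
    (by rw [hf₃.2 arrSg rfl, hf₂.2 arrSg rfl, hf₁.2 arrSg rfl, ha0 _ _ (by decide)])
    hread₃.marks.le)
    (T₂ := (I.D.card * (I.D.card * 150 + I.n * 200 + pot I.holes * stepBound I.holes + 410) + 10) +
      (I.n * (I.D.card * 130 + 70) + 30))
    (by unfold enforceTime; omega) ?_
  intro s₄ hs₄ hf₄ hsg
  have hE₄ := hE₃.frame hf₄ rfl rfl
  have hread₄ : ReadInv I I.n s₄ := by
    refine ⟨(hf₄.1 _ rfl).trans hread₃.x, (hf₄.1 _ rfl).trans hread₃.q, ?_, fun x hx => ?_,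
      hread₃.marks.mono (hf₄.2 _ rfl) le_rfl⟩
    · rw [hf₄.1 regT rfl]
      exact hread₃.t
    · exact (hread₃.stored x hx).step (by rw [hf₄.2 arrSt rfl]) (by rw [hf₄.2 arrPt rfl])
        (fun _ _ => by rw [hf₄.2 arrL rfl]) (fun _ _ => by rw [hf₄.2 arrR rfl])
        (fun _ _ => by rw [hf₄.2 arrHl rfl]) (fun _ h => by rw [hf₄.2 arrMk rfl, h])
        (by rw [hf₄.1 regT rfl])
  have hT : (tabOf s₄).WF I M := by
    refine tab_wf hI hM' hread₄ fun p hp => ?_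
    rw [hf₄.2 arrMk rfl]
    exact hsg p hp
  have hout : s₄.arr arrOut = s₁.arr arrOut :=
    (hf₄.2 _ rfl).trans ((hf₃.2 _ rfl).trans (hf₂.2 _ rfl))
  have hkept : s₄.reg regKept = 0 :=
    (hf₄.1 _ rfl).trans ((hf₃.1 _ rfl).trans ((hf₂.1 _ rfl).trans ((hf₁.1 _ rfl).trans (hr0 _))))
  have htest : TestInv I (tabOf s₄) 0 s₄ := by
    refine ⟨⟨hE₄.n, hE₄.d, ?_, hE₄.input, rfl, rfl, rfl, rfl, rfl⟩, ?_, fun x => ?_,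
      fun p h h' => by omega, ?_, ?_⟩
    · exact (hf₄.1 _ rfl).trans ((hf₃.1 _ rfl).trans ((hf₂.1 _ rfl).trans b3))
    · exact (hf₄.1 _ rfl).trans ((hf₃.1 _ rfl).trans ((hf₂.1 _ rfl).trans
        ((hf₁.1 _ rfl).trans (hr0 _))))
    · rw [(hread₄.stored x x.2).pt]
      exact ptrOK_zero I (tabOf s₄) x
    · rw [hkept, pre_zero, Finset.card_empty]
    · rw [hkept, hout, b6, pre_zero, Finset.sort_empty, List.append_nil]
      simp [holds_cons, holds_nil, ha0]
  refine Runs.seq (runs_testValues hB hI hT hs₄ hdM hnM hkM htest) le_rfl ?_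
  intro s₅ hs₅ hf₅ h₅
  exact runs_writeDoms hB hI hT hs₅ h₅ hM

/-! ### The total running time -/

theorem stepBound_eq (k : ℕ) : stepBound k = 600 * k ^ 2 + 1550 * k + 860 := by
  unfold stepBound
  ring

/-- For `k ≥ 1` the coefficients of `stepBound` sum to `3010`, and `pot_le` contributes the factor
`4`. For `k = 0` the main term vanishes, so the constant `860 = stepBound 0` has to be added. -/
theorem pot_mul_stepBound_le (k : ℕ) :
    ((pot k * stepBound k : ℕ) : ℝ) ≤ 12040 * (Real.goldenRatio ^ k * (k : ℝ) ^ 2) + 860 := by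
  rcases Nat.eq_zero_or_pos k with rfl | hk
  · rw [pot_zero, stepBound_eq]
    norm_num
  · have h1 := pot_le k
    have h2 : (stepBound k : ℝ) ≤ 3010 * (k : ℝ) ^ 2 := by
      rw [stepBound_eq]
      have : (1 : ℝ) ≤ k := by exact_mod_cast hk
      push_cast
      nlinarith
    have h3 : (0 : ℝ) ≤ Real.goldenRatio ^ k := pow_nonneg Real.goldenRatio_pos.le _
    calc ((pot k * stepBound k : ℕ) : ℝ) = pot k * stepBound k := by push_cast; rfl
      _ ≤ 4 * Real.goldenRatio ^ k * (3010 * (k : ℝ) ^ 2) :=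
        mul_le_mul h1 h2 (Nat.cast_nonneg _) (by positivity)
      _ ≤ _ := by linarith

theorem enforceTime_le {n d S : ℕ} (k : ℕ) (hd : 1 ≤ d) (hS : 4 + d + n ≤ S) :
    (enforceTime n d k : ℝ) ≤ 12040 * (Real.goldenRatio ^ k * (k : ℝ) ^ 2 * d + S * d) := by
  have h1 : enforceTime n d k ≤ 900 * (S * d) + d * (pot k * stepBound k) := by
    have h2 : (4 + d + n) * d ≤ S * d := Nat.mul_le_mul_right _ hS
    have h3 : n ≤ n * d := Nat.le_mul_of_pos_right _ hd
    have h4 : enforceTime n d k = 150 * (d * d) + 440 * (n * d) + 140 * n + 490 * d + 150 +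
        d * (pot k * stepBound k) := by
      unfold enforceTime
      ring
    have h5 : (4 + d + n) * d = 4 * d + d * d + n * d := by ring
    omega
  have h2 := pot_mul_stepBound_le k
  have hd0 : (0 : ℝ) ≤ d := Nat.cast_nonneg d
  have h3 := mul_le_mul_of_nonneg_left h2 hd0
  have h4 : (enforceTime n d k : ℝ) ≤ 900 * (S * d) + d * ((pot k * stepBound k : ℕ) : ℝ) := by
    exact_mod_cast h1
  -- This absorbs the constant amount of search per value into the term for reading and scanning.
  have h5 : (d : ℝ) ≤ S * d := by
    have : (1 : ℝ) ≤ S := by exact_mod_cast (show 1 ≤ S by omega)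
    nlinarith
  nlinarith

end AtMostNValue

theorem corollary2 :
    ((1 + Real.sqrt 5) / 2 < 1.6181) ∧
    (∀ I : AtMostNValue.Instance, I.IsInput →
      ∀ x : Fin I.n, I.enforceHAC.dom x = I.dom x ∩ I.enforceHAC.D) ∧
    ∃ (p : WordRAM.Prog) (C c : ℕ), ∀ I : AtMostNValue.Instance, I.IsInput →
      ∃ (t : ℕ) (s : WordRAM.State),
        WordRAM.Exec (I.wordBase ^ c) p (WordRAM.State.init I.encode) t s ∧
        s.HasOutput I.enforceHAC.encode ∧
        (t : ℝ) ≤ C * (((1 + Real.sqrt 5) / 2) ^ I.holes * (I.holes : ℝ) ^ 2 * I.D.card +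
          I.size * I.D.card) := by
  refine ⟨?_, fun I hI x => AtMostNValue.Instance.enforceHAC_dom hI x,
    AtMostNValue.enforce, 12040, 41, fun I hI => ?_⟩
  -- The constant is `2 * 1.6181 - 1`.
  · have : Real.sqrt 5 < 2.2362 := by
      rw [Real.sqrt_lt' (by norm_num)]
      norm_num
    linarith
  have hd : 1 ≤ I.D.card := Finset.card_pos.2 hI.1
  have hsize := AtMostNValue.card_add_le_size I
  have hw := AtMostNValue.size_le_wordBase I
  have hk := AtMostNValue.holes_le hI
  set w := I.wordBase with hwdef
  have hn : I.n + 5 ≤ w := by omega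
  have hdw : I.D.card + 4 ≤ w := by omega
  have h5 : 5 ≤ w := by omega
  have hw2 : 5 * w ≤ w ^ 2 := by nlinarith
  have hw3 : 5 * w ^ 2 ≤ w ^ 3 := by
    rw [pow_succ w 2, mul_comm]
    exact Nat.mul_le_mul_left _ h5
  have hw4 : 5 * w ^ 3 ≤ w ^ 4 := by
    rw [pow_succ w 3, mul_comm]
    exact Nat.mul_le_mul_left _ h5
  have hw5 : 5 * w ^ 4 ≤ w ^ 5 := by
    rw [pow_succ w 4, mul_comm]
    exact Nat.mul_le_mul_left _ h5
  -- Stored numbers are bounded by `M = w ^ 4`, which exceeds the cubic bound on the holes. Low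
  -- expressions are then at most `(M + 10) ^ 8 ≤ w ^ 40`, hence the exponent `41`.
  have hB : (w ^ 4 + 10) ^ 8 < w ^ 41 := by
    calc (w ^ 4 + 10) ^ 8 ≤ (w ^ 5) ^ 8 := Nat.pow_le_pow_left (by omega) _
      _ = w ^ 40 := by rw [← pow_mul]
      _ < w ^ 41 := Nat.pow_lt_pow_right (by omega) (by norm_num)
  have hholes : I.holes ≤ w ^ 3 := by
    refine hk.trans ?_
    calc I.n * (I.D.card * I.D.card) ≤ w * (w * w) :=
          Nat.mul_le_mul (by omega) (Nat.mul_le_mul (by omega) (by omega))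
      _ = w ^ 3 := by ring
  have hprod : (I.n + 1) * (1 + 2 * I.D.card) ≤ 2 * w ^ 2 := by
    calc (I.n + 1) * (1 + 2 * I.D.card) ≤ w * (2 * w) := Nat.mul_le_mul (by omega) (by omega)
      _ = 2 * w ^ 2 := by ring
  obtain ⟨t, s, hexec, ht, -, hout⟩ := AtMostNValue.runs_enforce hI hB
    (AtMostNValue.bdd_init hI) (by omega) (by omega) (by omega) (by omega) (by omega)
  refine ⟨t, s, hexec, hout, ?_⟩
  have h1 := AtMostNValue.enforceTime_le I.holes hd hsize
  have h2 : (t : ℝ) ≤ AtMostNValue.enforceTime I.n I.D.card I.holes := by exact_mod_cast ht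
  -- `Real.goldenRatio` is by definition `(1 + √5) / 2`.
  exact_mod_cast h2.trans h1
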